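/- Let $M$ be a smooth manifold of dimension $n\ge 2$, $\pi:T^*M\to M$ its cotangent bundle with natural coordinates $(x^i,p_a)$ and canonical symplectic form $\theta=dp_i\wedge dx^i$, and let $\widetilde{T^*M}$ be $T^*M$ without the null section. Let $H:T^*M\to\mathbb R$ be a Hamilton function: continuous on $T^*M$, smooth on $\widetilde{T^*M}$, with Hessian $g^{ab}=\partial^2H/\partial p_a\partial p_b$ non-degenerate and of constant signature on $\widetilde{T^*M}$. Let $(g_{ij})$ be the inverse of $(g^{ab})$, let $\{f,k\}=\frac{\partial f}{\partial p_i}\frac{\partial k}{\partial x^i}-\frac{\partial f}{\partial x^i}\frac{\partial k}{\partial p_i}$, and put $$N_{ij}=\tfrac12\Big[\{g_{ij},H\}-\frac{\partial^2H}{\partial p_k\partial x^i}g_{jk}-\frac{\partial^2H}{\partial p_k\partial x^j}g_{ik}\Big],\qquad e_i=\frac{\partial}{\partial x^i}+N_{ia}\frac{\partial}{\partial p_a},\qquad w^b=\frac{\partial}{\partial p_b}-g^{bi}e_i .$$ On $\widetilde{T^*M}$ these define, independently of the chart of $M$, the metric $\mathbf g=g_{ij}\,dx^i\otimes dx^j+g^{ab}\,\delta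 p_a\otimes\delta p_b$ with $\delta p_a=dp_a-N_{ia}dx^i$, and the almost product structure $\varphi$ with $\varphi e_i=e_i$, $\varphi w^b=-w^b$. This $\varphi$ is a symmetric connection-pair: $\varphi^2=1$, $\ker(1-\varphi)$ is supplementary to the vertical bundle $\ker d\pi$, and $\ker(1\mp\varphi)$ are isotropic for $\theta$. Let $h'=\frac12(1+\varphi)$ and $w=\frac12(1-\varphi)$. For a connection-pair $\varphi$ and a metric $\mathbf g$ on an open set $U\subset T^*M$, call a smooth linear connection $D$ on $U$, with torsion $T$, canonical for $(\varphi,\mathbf g)$ if $D\varphi=0$ and $Dw=0$ (it is a $\varphi$-connection), $D\mathbf g=0$ (it is metric compatible), $D\theta=0$ (it is almost symplectic), and $h'T(h'X,h'Y)=0$ and $wT(wX,wY)=0$ for all vector fields $X,Y$. Theorem. (1) There is exactly one linear connection $\widehat D$ on $\widetilde{T^*M}$ that is canonical for the pair $(\varphi,\mathbf g)$ of $H$. In every natural chart its coefficients are $$\widehat D_{e_k}e_j=L^i_{jk}e_i,\quad \widehat D_{e_k}w^b=-L^b_{ck}w^c,\quad \widehat D_{w^a}e_j=C_j^{ka}e_k,\quad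 \widehat D_{w^a}w^b=-C_c^{ba}w^c,$$ $$L^k_{ij}=\tfrac12g^{km}\big(e_ig_{mj}+e_jg_{im}-e_mg_{ij}\big)-\tfrac12g^{km}\big(A_{jim}+A_{mji}+A_{mij}\big),$$ $$C_i^{jk}=-\tfrac12g_{im}\big(w^jg^{mk}+w^kg^{jm}-w^mg^{jk}\big)-\tfrac12g_{im}\big(B^{jmk}+B^{kmj}+B^{mkj}\big),$$ where $A_{ijm}=\Omega_{ijm}=e_j(N_{im})-e_i(N_{jm})$ and $B^{mkj}=g^{mi}\big(g^{ka}\,w^jN_{ia}-g^{ja}\,w^kN_{ia}\big)$; and $\widehat D$ is the only linear connection on $\widetilde{T^*M}$ with these coefficients in all natural charts. (2) $\widehat D$ is adapted to symplectic morphisms: let $f$ be a diffeomorphism of $T^*M$ with $f^*\theta=\theta$ that is regular, i.e. for every $u\in\widetilde{T^*M}$ the differential $d(\pi\circ f)_u$ maps $\ker(1-\varphi_u)$ bijectively onto $T_{\pi(f(u))}M$. Then, on $f(\widetilde{T^*M})$, the push-forward $\overline\varphi=f_*\varphi f_*^{-1}$ is again a symmetric connection-pair, and the push-forward connection $\overline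 D_{f_*X}f_*Y=f_*(\widehat D_XY)$ is canonical for $(\overline\varphi,f_*\mathbf g)$, and is the only such connection. -/

import Mathlib

open Bundle
open scoped Manifold ContDiff

noncomputable section

namespace HamiltonGeometry

/-! ### Calculus in natural coordinates `z = (x, p)`

Everything in this part concerns a function `h (x, p)` of the `2n` coordinates `x^i`, `p_a`. -/

/-- The space of the base coordinates `x^i`. -/
abbrev Base (n : ℕ) := EuclideanSpace ℝ (Fin n)

/-- The space of the natural coordinates `(x^i, p_a)`. -/
abbrev Coord (n : ℕ) := Base n × (Fin n → ℝ)

section Local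

variable {n : ℕ}

/-- The partial derivative `∂f/∂x^i`. -/
def dX (i : Fin n) (f : Coord n → ℝ) (z : Coord n) : ℝ :=
  fderiv ℝ f z (EuclideanSpace.single i 1, 0)

/-- The partial derivative `∂f/∂p_a`. -/
def dP (a : Fin n) (f : Coord n → ℝ) (z : Coord n) : ℝ :=
  fderiv ℝ f z (0, Pi.single a 1)

/-- The fundamental tensor `g^{ab} = ∂²h/∂p_a∂p_b`. -/
def gUp (h : Coord n → ℝ) (z : Coord n) : Matrix (Fin n) (Fin n) ℝ :=
  Matrix.of fun a b => dP a (dP b h) z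

/-- The inverse `g_{ij}` of the fundamental tensor. -/
def gLow (h : Coord n → ℝ) (z : Coord n) : Matrix (Fin n) (Fin n) ℝ :=
  (gUp h z)⁻¹

/-- The Poisson bracket `{f, k} = θ(X_f, X_k)` of `θ = dp_i ∧ dx^i`, where
`X_f = (∂f/∂p_i) ∂/∂x^i - (∂f/∂x^i) ∂/∂p_i`. -/
def poisson (f k : Coord n → ℝ) (z : Coord n) : ℝ :=
  ∑ i, (dP i f z * dX i k z - dX i f z * dP i k z)

/-- The canonical nonlinear connection
`N_{ij} = ½ ({g_{ij}, h} - (∂²h/∂p_k∂x^i) g_{jk} - (∂²h/∂p_k∂x^j) g_{ik})`. -/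
def nonlin (h : Coord n → ℝ) (z : Coord n) (i j : Fin n) : ℝ :=
  1 / 2 * (poisson (fun y => gLow h y i j) h z -
    ∑ k, (dP k (dX i h) z * gLow h z j k + dP k (dX j h) z * gLow h z i k))

/-- The horizontal frame vector `e_i = ∂/∂x^i + N_{ia} ∂/∂p_a`. -/
def hVec (h : Coord n → ℝ) (i : Fin n) (z : Coord n) : Coord n :=
  (EuclideanSpace.single i 1, fun a => nonlin h z i a)

/-- The vertical frame vector `∂/∂p_a`. -/
def vVec (a : Fin n) (_z : Coord n) : Coord n := (0, Pi.single a 1)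

/-- The oblique frame vector `w^b = ∂/∂p_b - g^{bi} e_i`. -/
def wVec (h : Coord n → ℝ) (b : Fin n) (z : Coord n) : Coord n :=
  vVec b z - ∑ i, gUp h z b i • hVec h i z

/-- The derivative `e_i f`. -/
def eH (h : Coord n → ℝ) (i : Fin n) (f : Coord n → ℝ) (z : Coord n) : ℝ :=
  fderiv ℝ f z (hVec h i z)

/-- The derivative `w^b f`. -/
def eW (h : Coord n → ℝ) (b : Fin n) (f : Coord n → ℝ) (z : Coord n) : ℝ :=
  fderiv ℝ f z (wVec h b z)

/-- The coordinate form `dx^i`. -/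
def dxForm (i : Fin n) : Coord n →L[ℝ] ℝ :=
  (EuclideanSpace.proj i : Base n →L[ℝ] ℝ) ∘L ContinuousLinearMap.fst ℝ (Base n) (Fin n → ℝ)

/-- The coordinate form `dp_a`. -/
def dpForm (a : Fin n) : Coord n →L[ℝ] ℝ :=
  (ContinuousLinearMap.proj a : (Fin n → ℝ) →L[ℝ] ℝ) ∘L
    ContinuousLinearMap.snd ℝ (Base n) (Fin n → ℝ)

/-- The coframe element `w_b = dp_b - N_{ib} dx^i`. -/
def wForm (h : Coord n → ℝ) (z : Coord n) (b : Fin n) : Coord n →L[ℝ] ℝ :=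
  dpForm b - ∑ i, nonlin h z i b • dxForm i

/-- The coframe element `e^i = dx^i + g^{bi} w_b`. -/
def hForm (h : Coord n → ℝ) (z : Coord n) (i : Fin n) : Coord n →L[ℝ] ℝ :=
  dxForm i + ∑ b, gUp h z b i • wForm h z b

/-- The canonical connection-pair `φ = e_i ⊗ e^i - w^b ⊗ w_b` in coordinates. -/
def phiLoc (h : Coord n → ℝ) (z : Coord n) : Coord n →L[ℝ] Coord n :=
  ∑ i, (hForm h z i).smulRight (hVec h i z) - ∑ b, (wForm h z b).smulRight (wVec h b z)

/-- The metric `g_{ij} dx^i ⊗ dx^j + g^{ab} (dp_a - N_{ia} dx^i) ⊗ (dp_b - N_{jb} dx^j)`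
in coordinates. -/
def metricLoc (h : Coord n → ℝ) (z : Coord n) : LinearMap.BilinForm ℝ (Coord n) :=
  ∑ i, ∑ j, gLow h z i j • LinearMap.BilinForm.linMulLin
      (dxForm i).toLinearMap (dxForm j).toLinearMap +
    ∑ a, ∑ b, gUp h z a b • LinearMap.BilinForm.linMulLin
      (wForm h z a).toLinearMap (wForm h z b).toLinearMap

/-- The form `dp_i ∧ dx^i` in coordinates. -/
def thetaLoc (n : ℕ) : LinearMap.BilinForm ℝ (Coord n) :=
  ∑ i, (LinearMap.BilinForm.linMulLin (dpForm i).toLinearMap (dxForm i).toLinearMap -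
    LinearMap.BilinForm.linMulLin (dxForm i).toLinearMap (dpForm i).toLinearMap)

/-- The curvature of the nonlinear connection, `Ω_{ija} = e_j N_{ia} - e_i N_{ja}`. -/
def curvN (h : Coord n → ℝ) (z : Coord n) (i j a : Fin n) : ℝ :=
  eH h j (fun y => nonlin h y i a) z - eH h i (fun y => nonlin h y j a) z

/-- `B^{mkj} = g^{mi} (g^{ka} w^j N_{ia} - g^{ja} w^k N_{ia})`. -/
def bTerm (h : Coord n → ℝ) (z : Coord n) (m k j : Fin n) : ℝ :=
  ∑ i, ∑ a, gUp h z m i * (gUp h z k a * eW h j (fun y => nonlin h y i a) z -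
    gUp h z j a * eW h k (fun y => nonlin h y i a) z)

/-- The horizontal coefficients
`L^k_{ij} = ½ g^{km} (e_i g_{mj} + e_j g_{im} - e_m g_{ij}) - ½ g^{km} (Ω_{jim} + Ω_{mji} + Ω_{mij})`;
the arguments are `k i j` in this order. -/
def coeffL (h : Coord n → ℝ) (z : Coord n) (k i j : Fin n) : ℝ :=
  1 / 2 * ∑ m, gUp h z k m *
      (eH h i (fun y => gLow h y m j) z + eH h j (fun y => gLow h y i m) z -
        eH h m (fun y => gLow h y i j) z) -
    1 / 2 * ∑ m, gUp h z k m * (curvN h z j i m + curvN h z m j i + curvN h z m i j)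

/-- The oblique coefficients
`C_i^{jk} = -½ g_{im} (w^j g^{mk} + w^k g^{jm} - w^m g^{jk}) - ½ g_{im} (B^{jmk} + B^{kmj} + B^{mkj})`;
the arguments are `i j k` in this order. -/
def coeffC (h : Coord n → ℝ) (z : Coord n) (i j k : Fin n) : ℝ :=
  -(1 / 2) * ∑ m, gLow h z i m *
      (eW h j (fun y => gUp h y m k) z + eW h k (fun y => gUp h y j m) z -
        eW h m (fun y => gUp h y j k) z) -
    1 / 2 * ∑ m, gLow h z i m * (bTerm h z j m k + bTerm h z k m j + bTerm h z m k j)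

end Local

/-! ### The cotangent bundle and its natural charts -/

/-- The model space of the cotangent bundle. -/
abbrev CotModel (n : ℕ) := Base n × (Base n →L[ℝ] ℝ)

/-- The model with corners of the cotangent bundle. -/
abbrev cotI (n : ℕ) := (𝓡 n).prod 𝓘(ℝ, Base n →L[ℝ] ℝ)

/-- The total space of the cotangent bundle `T*M`; its points are pairs `(x, α)`, `α ∈ T_x*M`. -/
abbrev Cotangent (n : ℕ) (M : Type*) [TopologicalSpace M] [ChartedSpace (Base n) M]
    [IsManifold (𝓡 n) ∞ M] :=
  TotalSpace (Base n →L[ℝ] ℝ) (fun x : M => TangentSpace (𝓡 n) x →L[ℝ] ℝ)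

section Global

variable {n : ℕ} {M : Type*} [TopologicalSpace M] [ChartedSpace (Base n) M]
  [IsManifold (𝓡 n) ∞ M]

/-- Vector fields on `T*M` (no regularity is built in). -/
abbrev VField (n : ℕ) (M : Type*) [TopologicalSpace M] [ChartedSpace (Base n) M]
    [IsManifold (𝓡 n) ∞ M] :=
  Π u : Cotangent n M, TangentSpace (cotI n) u

/-- Fields of endomorphisms of the tangent spaces of `T*M`. -/
abbrev EndoField (n : ℕ) (M : Type*) [TopologicalSpace M] [ChartedSpace (Base n) M]
    [IsManifold (𝓡 n) ∞ M] :=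
  Π u : Cotangent n M, TangentSpace (cotI n) u →L[ℝ] TangentSpace (cotI n) u

/-- Fields of bilinear forms on the tangent spaces of `T*M`. -/
abbrev FormField (n : ℕ) (M : Type*) [TopologicalSpace M] [ChartedSpace (Base n) M]
    [IsManifold (𝓡 n) ∞ M] :=
  Π u : Cotangent n M, LinearMap.BilinForm ℝ (TangentSpace (cotI n) u)

/-- Operators `D` on vector fields of `T*M`; `D Y u X` stands for `(D_X Y)(u)`. -/
abbrev Conn (n : ℕ) (M : Type*) [TopologicalSpace M] [ChartedSpace (Base n) M]
    [IsManifold (𝓡 n) ∞ M] :=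
  VField n M → EndoField n M

/-- `T*M` without the null section. -/
def slit (n : ℕ) (M : Type*) [TopologicalSpace M] [ChartedSpace (Base n) M]
    [IsManifold (𝓡 n) ∞ M] : Set (Cotangent n M) :=
  {u | u.2 ≠ 0}

/-- The natural chart `(x^i, p_a)` of `T*M` induced by a chart `e` of `M`: the `x^i` are the
coordinates of the base point, and `p_a` is the value of the covector on `∂/∂x^a`. -/
def cotChart (e : OpenPartialHomeomorph M (Base n)) (u : Cotangent n M) : Coord n :=
  (e u.1, fun a => u.2 ((mfderiv (𝓡 n) (𝓡 n) e u.1).inverse (EuclideanSpace.single a 1)))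

/-- The inverse of the natural chart, `(x, p) ↦ p_a dx^a`. -/
def cotChartSymm (e : OpenPartialHomeomorph M (Base n)) (z : Coord n) : Cotangent n M :=
  ⟨e.symm z.1, ∑ a, z.2 a •
    ((EuclideanSpace.proj a : Base n →L[ℝ] ℝ) ∘L mfderiv (𝓡 n) (𝓡 n) e (e.symm z.1))⟩

/-- The coordinate expression of a function on `T*M`. -/
def inChart (e : OpenPartialHomeomorph M (Base n)) (H : Cotangent n M → ℝ) (z : Coord n) : ℝ :=
  H (cotChartSymm e z)

/-- The differential of the natural chart. -/
def dChart (e : OpenPartialHomeomorph M (Base n)) (u : Cotangent n M) :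
    TangentSpace (cotI n) u →L[ℝ] Coord n :=
  mfderiv (cotI n) 𝓘(ℝ, Coord n) (cotChart e) u

/-- The vector field on `T*M` with the given components in the natural chart. -/
def ofChart (e : OpenPartialHomeomorph M (Base n)) (V : Coord n → Coord n) : VField n M :=
  fun u => (dChart e u).inverse (V (cotChart e u))

/-- The horizontal frame field `e_i` on `T*M` in the natural chart. -/
def hFrame (H : Cotangent n M → ℝ) (e : OpenPartialHomeomorph M (Base n)) (i : Fin n) :
    VField n M :=
  ofChart e (hVec (inChart e H) i)

/-- The vertical frame field `∂/∂p_a` on `T*M` in the natural chart. -/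
def vFrame (e : OpenPartialHomeomorph M (Base n)) (a : Fin n) : VField n M :=
  ofChart e (vVec a)

/-- The oblique frame field `w^b` on `T*M` in the natural chart. -/
def wFrame (H : Cotangent n M → ℝ) (e : OpenPartialHomeomorph M (Base n)) (b : Fin n) :
    VField n M :=
  ofChart e (wVec (inChart e H) b)

/-- A fundamental Hamilton function: continuous on `T*M`, smooth off the null section, and with
non-degenerate Hessian `∂²H/∂p_a∂p_b` of constant signature there. -/
structure IsHamiltonFunction (H : Cotangent n M → ℝ) : Prop where
  continuous : Continuous H
  smooth : ContMDiffOn (cotI n) 𝓘(ℝ, ℝ) ∞ H (slit n M)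
  nondegenerate : ∀ e ∈ IsManifold.maximalAtlas (𝓡 n) ∞ M, ∀ u ∈ slit n M, u.1 ∈ e.source →
    (gUp (inChart e H) (cotChart e u)).det ≠ 0
  signature : ∃ q : ℕ, ∀ e ∈ IsManifold.maximalAtlas (𝓡 n) ∞ M, ∀ u ∈ slit n M,
    u.1 ∈ e.source → sigPos (gUp (inChart e H) (cotChart e u)).toQuadraticForm' = q

/-- The canonical connection-pair `φ` of a Hamilton function. -/
def canonicalPair (H : Cotangent n M → ℝ) : EndoField n M := fun u =>
  (dChart (chartAt (Base n) u.1) u).inverse ∘L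
    phiLoc (inChart (chartAt (Base n) u.1) H) (cotChart (chartAt (Base n) u.1) u) ∘L
      dChart (chartAt (Base n) u.1) u

/-- The lift to `T*M` of the fundamental tensor of a Hamilton function. -/
def liftedMetric (H : Cotangent n M → ℝ) : FormField n M := fun u =>
  (metricLoc (inChart (chartAt (Base n) u.1) H)
    (cotChart (chartAt (Base n) u.1) u)).compl₁₂
      (dChart (chartAt (Base n) u.1) u).toLinearMap
      (dChart (chartAt (Base n) u.1) u).toLinearMap

/-- The canonical symplectic form `θ = dp_i ∧ dx^i` of `T*M`. -/
def theta (n : ℕ) (M : Type*) [TopologicalSpace M] [ChartedSpace (Base n) M]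
    [IsManifold (𝓡 n) ∞ M] : FormField n M := fun u =>
  (thetaLoc n).compl₁₂ (dChart (chartAt (Base n) u.1) u).toLinearMap
    (dChart (chartAt (Base n) u.1) u).toLinearMap

/-! ### Connection-pairs and connections adapted to them -/

/-- The projection `(1 + φ)/2` onto the horizontal bundle. -/
def hProj (φ : EndoField n M) : EndoField n M := fun u =>
  (1 / 2 : ℝ) • (ContinuousLinearMap.id ℝ (TangentSpace (cotI n) u) + φ u)

/-- The projection `(1 - φ)/2` onto the oblique bundle. -/
def wProj (φ : EndoField n M) : EndoField n M := fun u =>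
  (1 / 2 : ℝ) • (ContinuousLinearMap.id ℝ (TangentSpace (cotI n) u) - φ u)

/-- A symmetric connection-pair on `U`: an almost product structure `φ` such that `ker (1 - φ)` is
supplementary to the vertical bundle. Symmetry (`N_{ij} = N_{ji}` and `Π^{ij} = Π^{ji}` for the
adapted frame `∂/∂x^i + N_{ij} ∂/∂p_j`, `∂/∂p_i - Π^{ij} (∂/∂x^j + N_{jk} ∂/∂p_k)`) says that
`ker (1 - φ)` and `ker (1 + φ)` are isotropic for `θ`. -/
structure IsConnectionPair (φ : EndoField n M) (U : Set (Cotangent n M)) : Prop where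
  involutive : ∀ u ∈ U, ∀ X : TangentSpace (cotI n) u, φ u (φ u X) = X
  supplementary : ∀ u ∈ U, IsCompl
    (LinearMap.ker (ContinuousLinearMap.id ℝ (TangentSpace (cotI n) u) - φ u).toLinearMap)
    (LinearMap.ker (mfderiv (cotI n) (𝓡 n) (fun v : Cotangent n M => v.1) u).toLinearMap)
  symmetric_h : ∀ u ∈ U, ∀ X Y : TangentSpace (cotI n) u, φ u X = X → φ u Y = Y →
    theta n M u X Y = 0
  symmetric_w : ∀ u ∈ U, ∀ X Y : TangentSpace (cotI n) u, φ u X = -X → φ u Y = -Y →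
    theta n M u X Y = 0

/-- A vector field on `T*M` is differentiable at `u`. -/
def DiffAt (Y : VField n M) (u : Cotangent n M) : Prop :=
  MDifferentiableAt (cotI n) ((cotI n).prod 𝓘(ℝ, CotModel n))
    (fun v => TotalSpace.mk' (CotModel n) v (Y v)) u

/-- `D` is a smooth linear connection on `U`. -/
structure IsLinearConnection (D : Conn n M) (U : Set (Cotangent n M)) : Prop where
  covariant : IsCovariantDerivativeOn (I := cotI n) (CotModel n) D U
  smooth : ContMDiffCovariantDerivativeOn (I := cotI n) (CotModel n) ∞ D U

/-- `D ψ = 0` on `U` for a field of endomorphisms `ψ`: `D_X (ψ Y) = ψ (D_X Y)`. -/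
def ParallelEndo (D : Conn n M) (ψ : EndoField n M) (U : Set (Cotangent n M)) : Prop :=
  ∀ u ∈ U, ∀ Y : VField n M, DiffAt Y u → ∀ X : TangentSpace (cotI n) u,
    D (fun v => ψ v (Y v)) u X = ψ u (D Y u X)

/-- `D b = 0` on `U` for a field of bilinear forms `b`:
`X (b (Y, Z)) = b (D_X Y, Z) + b (Y, D_X Z)`. -/
def ParallelForm (D : Conn n M) (b : FormField n M) (U : Set (Cotangent n M)) : Prop :=
  ∀ u ∈ U, ∀ Y Z : VField n M, DiffAt Y u → DiffAt Z u → ∀ X : TangentSpace (cotI n) u,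
    mvfderiv (cotI n) (fun v => b v (Y v) (Z v)) u X =
      b u (D Y u X) (Z u) + b u (Y u) (D Z u X)

/-- The torsion `D_X Y - D_Y X - [X, Y]`. -/
def torsion (D : Conn n M) (X Y : VField n M) : VField n M := fun u =>
  D Y u (X u) - D X u (Y u) - VectorField.mlieBracket (cotI n) X Y u

/-- The defining properties of the canonical connection of a connection-pair `φ` and a metric `g`
on `U`: it is a linear connection with `D φ = 0` and `D w = 0` (a `φ`-connection), metric
(`D g = 0`), almost symplectic (`D θ = 0`), and its torsion has no horizontal component on
horizontal fields and no oblique component on oblique fields. -/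
structure IsCanonicalPhiConnection (φ : EndoField n M) (g : FormField n M)
    (U : Set (Cotangent n M)) (D : Conn n M) : Prop where
  linear : IsLinearConnection D U
  parallel_phi : ParallelEndo D φ U
  parallel_w : ParallelEndo D (wProj φ) U
  metric : ParallelForm D g U
  symplectic : ParallelForm D (theta n M) U
  torsion_h : ∀ u ∈ U, ∀ X Y : VField n M, DiffAt X u → DiffAt Y u →
    hProj φ u (torsion D (fun v => hProj φ v (X v)) (fun v => hProj φ v (Y v)) u) = 0
  torsion_w : ∀ u ∈ U, ∀ X Y : VField n M, DiffAt X u → DiffAt Y u →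
    wProj φ u (torsion D (fun v => wProj φ v (X v)) (fun v => wProj φ v (Y v)) u) = 0

/-- Two operators define the same connection on `U`. -/
def SameOn (D D' : Conn n M) (U : Set (Cotangent n M)) : Prop :=
  ∀ u ∈ U, ∀ Y : VField n M, DiffAt Y u → D Y u = D' Y u

/-- In every natural chart, `D` has the canonical coefficients of `H`:
`D_{e_k} e_j = L^i_{jk} e_i`, `D_{e_k} w^b = -L^b_{ck} w^c`,
`D_{w^a} e_j = C_j^{ka} e_k`, `D_{w^a} w^b = -C_c^{ba} w^c`. -/
def HasCanonicalCoeffs (H : Cotangent n M → ℝ) (D : Conn n M) : Prop :=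
  ∀ e ∈ IsManifold.maximalAtlas (𝓡 n) ∞ M, ∀ u ∈ slit n M, u.1 ∈ e.source →
    (∀ j k, D (hFrame H e j) u (hFrame H e k u) =
      ∑ i, coeffL (inChart e H) (cotChart e u) i j k • hFrame H e i u) ∧
    (∀ b k, D (wFrame H e b) u (hFrame H e k u) =
      -∑ c, coeffL (inChart e H) (cotChart e u) b c k • wFrame H e c u) ∧
    (∀ j a, D (hFrame H e j) u (wFrame H e a u) =
      ∑ k, coeffC (inChart e H) (cotChart e u) j k a • hFrame H e k u) ∧
    (∀ b a, D (wFrame H e b) u (wFrame H e a u) =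
      -∑ c, coeffC (inChart e H) (cotChart e u) c b a • wFrame H e c u)

/-! ### Diffeomorphisms of the cotangent bundle -/

/-- `f` is a symplectic morphism: `f^* θ = θ`. -/
def IsSymplecticMorphism
    (f : Cotangent n M ≃ₘ^∞⟮cotI n, cotI n⟯ Cotangent n M) : Prop :=
  ∀ (u : Cotangent n M) (X Y : TangentSpace (cotI n) u),
    theta n M (f u) (mfderiv (cotI n) (cotI n) f u X) (mfderiv (cotI n) (cotI n) f u Y) =
      theta n M u X Y

/-- `f` is regular for the horizontal bundle `ker (1 - φ)` over `U`: the differential of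
`π ∘ f` maps each horizontal space isomorphically onto a tangent space of `M`. -/
def IsRegularFor (φ : EndoField n M) (U : Set (Cotangent n M))
    (f : Cotangent n M ≃ₘ^∞⟮cotI n, cotI n⟯ Cotangent n M) : Prop :=
  ∀ u ∈ U, Function.Bijective
    (fun X : {X : TangentSpace (cotI n) u // φ u X = X} =>
      mfderiv (cotI n) (𝓡 n) (fun v : Cotangent n M => (f v).1) u X.1)

/-- The push-forward `f_* φ f_*⁻¹` of a field of endomorphisms. -/
def pushEndo (f : Cotangent n M ≃ₘ^∞⟮cotI n, cotI n⟯ Cotangent n M) (φ : EndoField n M) :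
    EndoField n M := fun v =>
  (mfderiv (cotI n) (cotI n) f.symm v).inverse ∘L φ (f.symm v) ∘L
    mfderiv (cotI n) (cotI n) f.symm v

/-- The push-forward of a field of bilinear forms. -/
def pushForm (f : Cotangent n M ≃ₘ^∞⟮cotI n, cotI n⟯ Cotangent n M) (b : FormField n M) :
    FormField n M := fun v =>
  (b (f.symm v)).compl₁₂ (mfderiv (cotI n) (cotI n) f.symm v).toLinearMap
    (mfderiv (cotI n) (cotI n) f.symm v).toLinearMap

/-- The push-forward of a connection, `(f_* D)_{f_* X} (f_* Y) = f_* (D_X Y)`. -/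
def pushConn (f : Cotangent n M ≃ₘ^∞⟮cotI n, cotI n⟯ Cotangent n M) (D : Conn n M) :
    Conn n M := fun Y v =>
  (mfderiv (cotI n) (cotI n) f.symm v).inverse ∘L
    D (VectorField.mpullback (cotI n) (cotI n) f Y) (f.symm v) ∘L
      mfderiv (cotI n) (cotI n) f.symm v

end Global

end HamiltonGeometry

end

open HamiltonGeometry

/-! All conditions are read in the adapted frame (e_i, w^b) with dual coframe (h^i, w_b), where h^i
= dx^i + g^{bi} w_b. There φ is +1 on the e_i and -1 on the w^b; symmetry of N and of g gives θ =
w_i ∧ h^i (`thetaLoc_eq`); and the metric has the blocks g_{ij} and 2 g^{ab} together with a mixed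
block that is the constant -δ (`metricLoc_eq`).

Parallelism of φ means that both subbundles are preserved, so D e_j = η^i_j e_i. Parallelism of θ, a
duality between the two subbundles, forces D w^b = -η^b_c w^c. The constant mixed block of the
metric is then parallel for free, and the equations for g_{ij} and for g^{ab} are equivalent because
the two matrices are inverse to each other (`fderiv_gLow_iff`). What remains are two independent
Koszul problems. Along e_k, the equation for g_{ij} and the horizontal torsion condition determine
η(e_k), with the curvature Ω as bracket term. Along w^a, the equation for g^{ab} and the oblique
torsion condition determine η(w^a), with B as bracket term. Each has exactly one solution, namely L
and C (`IsCanonicalOmega.eq_omegaLoc`, `isCanonicalOmega_omegaLoc`).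

The tensors are defined through preferred charts, so they must be shown not to depend on them. The
form θ is the differential of the tautological form, hence intrinsic, and so is the Hamilton field
S. The tensor J = g_{ij} dx^i ⊗ ∂/∂p_j is characterised by J[S,V] = -V for vertical V, and the
vertical projection by [S,JX] - J[S,X] + X = 2 v(X); this second identity is the invariant meaning
of the formula for N. Both φ and the metric are expressed by θ, J and v
(`IsRegularOn.eq_phiLoc_iff`, `IsRegularOn.metricLoc_eq_thetaLoc`).

Each chart therefore carries a canonical connection. Two canonical connections near a point have the
same coefficients there, and their difference is a tensor, so they agree
(`IsCanonicalPhiConnection.eq_of_mem_nhds`); this gives uniqueness and also glues the chart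
connections.

Every defining condition is natural under diffeomorphisms preserving θ, which gives existence for
the push-forward. Uniqueness follows by transporting a competitor back with the inverse of f.
Regularity of f enters only in the supplementarity of the pushed pair with the vertical bundle. -/

noncomputable section

namespace HamiltonGeometry

open Filter Topology ContinuousLinearMap

/-! ### Smoothness of fields built from the differential of a map. -/

section Generic

variable {E : Type*} [NormedAddCommGroup E] [NormedSpace ℝ E] [CompleteSpace E]
  {H : Type*} [TopologicalSpace H] {I : ModelWithCorners ℝ E H}
  {M : Type*} [TopologicalSpace M] [ChartedSpace H M] [IsManifold I ∞ M]
  {E' : Type*} [NormedAddCommGroup E'] [NormedSpace ℝ E']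
  {H' : Type*} [TopologicalSpace H'] {I' : ModelWithCorners ℝ E' H'}
  {M' : Type*} [TopologicalSpace M'] [ChartedSpace H' M'] [IsManifold I' ∞ M']

/-- A field of endomorphisms that is conjugated to a smooth one by the differential of a local
diffeomorphism is smooth. -/
theorem contMDiffAt_conj_mfderiv {f : M → M'} {x₀ : M} (hf : ContMDiffAt I I' ∞ f x₀)
    (hf' : (mfderiv I I' f x₀).IsInvertible)
    {A : Π y : M', TangentSpace I' y →L[ℝ] TangentSpace I' y}
    (hA : ContMDiffAt I' (I'.prod 𝓘(ℝ, E' →L[ℝ] E')) ∞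
      (fun y => (⟨y, A y⟩ : TotalSpace (E' →L[ℝ] E')
        fun y : M' => TangentSpace I' y →L[ℝ] TangentSpace I' y)) (f x₀)) :
    ContMDiffAt I (I.prod 𝓘(ℝ, E →L[ℝ] E)) ∞
      (fun x => (⟨x, (mfderiv I I' f x).inverse ∘L A (f x) ∘L mfderiv I I' f x⟩ :
        TotalSpace (E →L[ℝ] E) fun x : M => TangentSpace I x →L[ℝ] TangentSpace I x)) x₀ := by
  have h1 : ContMDiffAt I 𝓘(ℝ, E →L[ℝ] E') ∞ (fun x : M ↦ ContinuousLinearMap.inCoordinates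
        E (TangentSpace I (M := M)) E' (TangentSpace I' (M := M'))
        x₀ x (f x₀) (f x) (mfderiv I I' f x)) x₀ :=
    hf.mfderiv_const (m := ∞) (by simp)
  -- Between fixed trivialisations the differential is a smooth operator-valued map, and inversion
  -- is smooth at an invertible operator.
  have h2 : ContMDiffAt I 𝓘(ℝ, E' →L[ℝ] E) ∞
      (ContinuousLinearMap.inverse ∘ (fun x : M ↦ ContinuousLinearMap.inCoordinates
        E (TangentSpace I (M := M)) E' (TangentSpace I' (M := M'))
        x₀ x (f x₀) (f x) (mfderiv I I' f x))) x₀ := by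
    apply ContMDiffAt.comp x₀ _ h1
    apply ContDiffAt.contMDiffAt
    apply IsInvertible.contDiffAt_map_inverse
    rw [inCoordinates_eq (FiberBundle.mem_baseSet_trivializationAt' x₀)
      (FiberBundle.mem_baseSet_trivializationAt' (f x₀))]
    exact isInvertible_equiv.comp (hf'.comp isInvertible_equiv)
  rw [contMDiffAt_hom_bundle] at hA
  have h3 := hA.2.comp x₀ hf
  rw [contMDiffAt_hom_bundle]
  refine ⟨contMDiffAt_id, ?_⟩
  apply (h2.clm_comp (h3.clm_comp h1)).congr_of_eventuallyEq
  have hx : (trivializationAt E (TangentSpace I) x₀).baseSet ∈ 𝓝 x₀ :=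
    (trivializationAt _ _ _).open_baseSet.mem_nhds (FiberBundle.mem_baseSet_trivializationAt' _)
  have hy : f ⁻¹' (trivializationAt E' (TangentSpace I') (f x₀)).baseSet ∈ 𝓝 x₀ := by
    apply hf.continuousAt.preimage_mem_nhds
    exact (trivializationAt _ _ _).open_baseSet.mem_nhds
      (FiberBundle.mem_baseSet_trivializationAt' _)
  filter_upwards [hx, hy] with x hx h'x
  simp only [Function.comp_apply]
  -- Where both trivialisations are defined, their fibre isomorphisms cancel between the three
  -- consecutive factors.
  rw [inCoordinates_eq hx (by exact hx), inCoordinates_eq hx h'x, inCoordinates_eq h'x h'x]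
  simp only [inverse_equiv_comp, inverse_comp_equiv, ContinuousLinearEquiv.symm_symm]
  ext v
  simp only [coe_comp, Function.comp_apply, ContinuousLinearEquiv.coe_coe,
    ContinuousLinearEquiv.symm_apply_apply]

omit [CompleteSpace E] in
/-- The covector field `ℓ ∘ df` is smooth. -/
theorem contMDiffAt_comp_mfderiv {f : M → E'} {x₀ : M} (hf : ContMDiffAt I 𝓘(ℝ, E') ∞ f x₀)
    (ℓ : E' →L[ℝ] ℝ) :
    ContMDiffAt I (I.prod 𝓘(ℝ, E →L[ℝ] ℝ)) ∞
      (fun x => (⟨x, ℓ ∘L mfderiv I 𝓘(ℝ, E') f x⟩ :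
        TotalSpace (E →L[ℝ] ℝ) fun x : M => TangentSpace I x →L[ℝ] ℝ)) x₀ := by
  have h1 : ContMDiffAt I 𝓘(ℝ, E →L[ℝ] E') ∞ (fun x : M ↦ ContinuousLinearMap.inCoordinates
        E (TangentSpace I (M := M)) E' (TangentSpace 𝓘(ℝ, E') (M := E'))
        x₀ x (f x₀) (f x) (mfderiv I 𝓘(ℝ, E') f x)) x₀ :=
    hf.mfderiv_const (m := ∞) (by simp)
  have key := contMDiffAt_hom_bundle (IB := I) (F₁ := E) (E₁ := fun x : M => TangentSpace I x)
    (F₂ := ℝ) (E₂ := Bundle.Trivial M ℝ) (n := ∞) (IM := I)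
    (fun x => (⟨x, ℓ ∘L mfderiv I 𝓘(ℝ, E') f x⟩ :
        TotalSpace (E →L[ℝ] ℝ) fun x : M => TangentSpace I x →L[ℝ] Bundle.Trivial M ℝ x)) (x₀ := x₀)
  refine key.2 ⟨contMDiffAt_id, ?_⟩
  apply ((contMDiffAt_const (c := ℓ)).clm_comp h1).congr_of_eventuallyEq
  have hx : (trivializationAt E (TangentSpace I) x₀).baseSet ∈ 𝓝 x₀ :=
    (trivializationAt _ _ _).open_baseSet.mem_nhds (FiberBundle.mem_baseSet_trivializationAt' _)
  filter_upwards [hx] with x hx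
  ext v
  simp [ContinuousLinearMap.inCoordinates]
  rfl
end Generic

/-! ### Natural charts of the cotangent bundle are smooth local diffeomorphisms. -/

section Charts

variable {n : ℕ} {M : Type*} [TopologicalSpace M] [ChartedSpace (Base n) M]
  [IsManifold (𝓡 n) ∞ M] {e : OpenPartialHomeomorph M (Base n)}

/-- The frame A⁻¹(e_a) and the coframe e^a ∘ A are dual bases; with A the differential of a chart
this is α = p_a dx^a. -/
theorem sum_smul_proj_comp {V : Type*} [AddCommGroup V] [Module ℝ V] [TopologicalSpace V]
    [IsTopologicalAddGroup V] [ContinuousSMul ℝ V]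
    {A : V →L[ℝ] Base n} (hA : A.IsInvertible) (α : V →L[ℝ] ℝ) :
    ∑ a, α (A.inverse (EuclideanSpace.single a 1)) •
      ((EuclideanSpace.proj a : Base n →L[ℝ] ℝ) ∘L A) = α := by
  obtain ⟨L, rfl⟩ := hA
  ext v
  have h : L v = ∑ a, (L v) a • EuclideanSpace.single a (1 : ℝ) := by
    ext i
    simp [Finset.sum_apply, Pi.single_apply]
  have h2 : v = ∑ a, (L v) a • L.symm (EuclideanSpace.single a (1 : ℝ)) := by
    conv_lhs => rw [← L.symm_apply_apply v, h]
    rw [map_sum]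
    simp
  conv_rhs => rw [h2]
  simp [mul_comm]

theorem sum_smul_proj_comp_inverse {V : Type*} [AddCommGroup V] [Module ℝ V] [TopologicalSpace V]
    [IsTopologicalAddGroup V] [ContinuousSMul ℝ V]
    {A : V →L[ℝ] Base n} (hA : A.IsInvertible) (p : Fin n → ℝ) (b : Fin n) :
    (∑ a, p a • ((EuclideanSpace.proj a : Base n →L[ℝ] ℝ) ∘L A))
      (A.inverse (EuclideanSpace.single b 1)) = p b := by
  obtain ⟨L, rfl⟩ := hA
  simp

omit [IsManifold (𝓡 n) ∞ M] in
theorem isInvertible_mfderiv_of_mem_maximalAtlas (he : e ∈ IsManifold.maximalAtlas (𝓡 n) ∞ M)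
    {x : M} (hx : x ∈ e.source) : (mfderiv (𝓡 n) (𝓡 n) e x).IsInvertible := by
  have h : e.MDifferentiable (𝓡 n) (𝓡 n) :=
    ⟨(contMDiffOn_of_mem_maximalAtlas he).mdifferentiableOn (by simp),
      (contMDiffOn_symm_of_mem_maximalAtlas he).mdifferentiableOn (by simp)⟩
  exact ⟨h.mfderiv hx, rfl⟩

theorem isOpen_fst_preimage (s : Set M) (hs : IsOpen s) :
    IsOpen {u : Cotangent n M | u.1 ∈ s} :=
  hs.preimage (FiberBundle.continuous_proj _ _)

theorem contMDiff_fst : ContMDiff (cotI n) (𝓡 n) ∞ (fun u : Cotangent n M => u.1) :=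
  contMDiff_proj _

theorem contMDiffAt_apply_field {X : Π x : M, TangentSpace (𝓡 n) x} {u : Cotangent n M}
    (hX : ContMDiffAt (𝓡 n) ((𝓡 n).prod 𝓘(ℝ, Base n)) ∞
      (fun x => TotalSpace.mk' (Base n) x (X x)) u.1) :
    ContMDiffAt (cotI n) 𝓘(ℝ, ℝ) ∞ (fun u : Cotangent n M => u.2 (X u.1)) u := by
  have := ContMDiffAt.clm_bundle_apply (𝕜 := ℝ) (n := ∞) (IM := cotI n) (IB := 𝓡 n)
    (F₁ := Base n) (F₂ := ℝ) (E₁ := fun x : M => TangentSpace (𝓡 n) x)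
    (E₂ := Bundle.Trivial M ℝ) (b := fun u : Cotangent n M => u.1) (ϕ := fun u => u.2)
    (v := fun u => X u.1) (x := u) contMDiffAt_id (hX.comp u contMDiff_fst.contMDiffAt)
  rw [contMDiffAt_totalSpace] at this
  exact this.2

theorem cotChartSymm_cotChart (he : e ∈ IsManifold.maximalAtlas (𝓡 n) ∞ M)
    {u : Cotangent n M} (hu : u.1 ∈ e.source) : cotChartSymm e (cotChart e u) = u := by
  obtain ⟨x, α⟩ := u
  have h1 : e.symm (e x) = x := e.left_inv hu
  simp only [cotChart, cotChartSymm]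
  -- The fibre depends on the base point, so the point `e.symm (e x)` is generalised before it is
  -- identified with `x`.
  have key : ∀ y : M, y = x → (⟨y, ∑ a, α ((mfderiv (𝓡 n) (𝓡 n) e x).inverse
      (EuclideanSpace.single a 1)) • ((EuclideanSpace.proj a : Base n →L[ℝ] ℝ) ∘L
        mfderiv (𝓡 n) (𝓡 n) e y)⟩ : Cotangent n M) = ⟨x, α⟩ := by
    rintro y rfl
    congr 1
    exact sum_smul_proj_comp (isInvertible_mfderiv_of_mem_maximalAtlas he hu) α
  exact key _ h1

theorem cotChart_cotChartSymm (he : e ∈ IsManifold.maximalAtlas (𝓡 n) ∞ M)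
    {z : Coord n} (hz : z.1 ∈ e.target) : cotChart e (cotChartSymm e z) = z := by
  have h := isInvertible_mfderiv_of_mem_maximalAtlas he (e.map_target hz)
  refine Prod.ext (e.right_inv hz) ?_
  ext a
  exact sum_smul_proj_comp_inverse h z.2 a

theorem contMDiffAt_cotChart (he : e ∈ IsManifold.maximalAtlas (𝓡 n) ∞ M)
    {u : Cotangent n M} (hu : u.1 ∈ e.source) :
    ContMDiffAt (cotI n) 𝓘(ℝ, Coord n) ∞ (cotChart e) u := by
  have h1 : ContMDiffAt (cotI n) (𝓡 n) ∞ (fun u : Cotangent n M => e u.1) u :=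
    (contMDiffAt_of_mem_maximalAtlas he hu).comp u contMDiff_fst.contMDiffAt
  refine h1.prodMk_space (contMDiffAt_pi_space.2 fun a => ?_)
  -- The coordinate p_a is the covector evaluated on ∂/∂x^a, and ∂/∂x^a is the pull-back of a
  -- constant field.
  apply contMDiffAt_apply_field (X := VectorField.mpullback (𝓡 n) (𝓡 n) e
    (fun _ => EuclideanSpace.single a 1))
  refine ContMDiffAt.mpullback_vectorField_preimage (n := ∞) ?_
    (contMDiffAt_of_mem_maximalAtlas he hu) (isInvertible_mfderiv_of_mem_maximalAtlas he hu)
    (by simp)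
  exact contMDiffAt_vectorSpace_iff_contDiffAt.2 contDiffAt_const

theorem contMDiffAt_cotChartSymm (he : e ∈ IsManifold.maximalAtlas (𝓡 n) ∞ M)
    {z : Coord n} (hz : z.1 ∈ e.target) :
    ContMDiffAt 𝓘(ℝ, Coord n) (cotI n) ∞ (cotChartSymm (M := M) e) z := by
  have hb : ContMDiffAt 𝓘(ℝ, Coord n) (𝓡 n) ∞ (fun z : Coord n => e.symm z.1) z :=
    (contMDiffAt_symm_of_mem_maximalAtlas he hz).comp z
      contDiff_fst.contMDiff.contMDiffAt
  have key := contMDiffAt_hom_bundle (IB := 𝓡 n) (F₁ := Base n)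
    (E₁ := fun x : M => TangentSpace (𝓡 n) x)
    (F₂ := ℝ) (E₂ := Bundle.Trivial M ℝ) (n := ∞) (IM := 𝓘(ℝ, Coord n))
    (cotChartSymm (M := M) e) (x₀ := z)
  refine key.2 ⟨hb, ?_⟩
  have h : ∀ a, ContMDiffAt 𝓘(ℝ, Coord n) 𝓘(ℝ, Base n →L[ℝ] ℝ) ∞ (fun y : Coord n =>
      inCoordinates (Base n) (fun x : M => TangentSpace (𝓡 n) x) ℝ (Bundle.Trivial M ℝ)
        (e.symm z.1) (e.symm y.1) (e.symm z.1) (e.symm y.1)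
        ((EuclideanSpace.proj a : Base n →L[ℝ] ℝ) ∘L mfderiv (𝓡 n) (𝓡 n) e (e.symm y.1))) z := by
    intro a
    have h1 := contMDiffAt_comp_mfderiv (contMDiffAt_of_mem_maximalAtlas he (e.map_target hz))
      (EuclideanSpace.proj a : Base n →L[ℝ] ℝ)
    have h2 := h1.comp z hb
    exact ((contMDiffAt_hom_bundle (IB := 𝓡 n) (F₁ := Base n)
      (E₁ := fun x : M => TangentSpace (𝓡 n) x)
      (F₂ := ℝ) (E₂ := Bundle.Trivial M ℝ) (n := ∞) (IM := 𝓘(ℝ, Coord n)) _).1 h2).2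
  have h3 : ∀ a, ContMDiffAt 𝓘(ℝ, Coord n) 𝓘(ℝ, ℝ) ∞ (fun y : Coord n => y.2 a) z := fun a => by
    apply ContDiffAt.contMDiffAt
    fun_prop
  have h4 : ContMDiffAt 𝓘(ℝ, Coord n) 𝓘(ℝ, Base n →L[ℝ] ℝ) ∞ (fun y : Coord n => ∑ a, y.2 a •
      inCoordinates (Base n) (fun x : M => TangentSpace (𝓡 n) x) ℝ (Bundle.Trivial M ℝ)
        (e.symm z.1) (e.symm y.1) (e.symm z.1) (e.symm y.1)
        ((EuclideanSpace.proj a : Base n →L[ℝ] ℝ) ∘L mfderiv (𝓡 n) (𝓡 n) e (e.symm y.1))) z :=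
    ContMDiffAt.sum fun a _ => (h3 a).smul (h a)
  refine h4.congr_of_eventuallyEq (Eventually.of_forall fun y => ?_)
  simp only [inCoordinates, cotChartSymm]
  ext v
  simp

/-- The natural chart as a local homeomorphism. -/
def cotHomeo (e : OpenPartialHomeomorph M (Base n))
    (he : e ∈ IsManifold.maximalAtlas (𝓡 n) ∞ M) :
    OpenPartialHomeomorph (Cotangent n M) (Coord n) where
  toFun := cotChart e
  invFun := cotChartSymm e
  source := {u | u.1 ∈ e.source}
  target := {z | z.1 ∈ e.target}
  map_source' _ hu := e.map_source hu
  map_target' _ hz := e.map_target hz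
  left_inv' _ hu := cotChartSymm_cotChart he hu
  right_inv' _ hz := cotChart_cotChartSymm he hz
  open_source := isOpen_fst_preimage _ e.open_source
  open_target := e.open_target.preimage continuous_fst
  continuousOn_toFun _ hu := (contMDiffAt_cotChart he hu).continuousAt.continuousWithinAt
  continuousOn_invFun _ hz := (contMDiffAt_cotChartSymm he hz).continuousAt.continuousWithinAt

theorem isInvertible_dChart (he : e ∈ IsManifold.maximalAtlas (𝓡 n) ∞ M)
    {u : Cotangent n M} (hu : u.1 ∈ e.source) : (dChart e u).IsInvertible := by
  have h : (cotHomeo e he).MDifferentiable (cotI n) 𝓘(ℝ, Coord n) :=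
    ⟨fun v hv => ((contMDiffAt_cotChart he hv).mdifferentiableAt
        (by simp)).mdifferentiableWithinAt,
      fun z hz => ((contMDiffAt_cotChartSymm he hz).mdifferentiableAt
        (by simp)).mdifferentiableWithinAt⟩
  exact ⟨h.mfderiv hu, rfl⟩

end Charts

/-! ### Vector fields, brackets and endomorphism fields on a vector space. -/

section Flat

variable {E : Type*} [NormedAddCommGroup E] [NormedSpace ℝ E]

theorem mdifferentiableAt_field_iff {V : E → E} {x : E} :
    MDifferentiableAt 𝓘(ℝ, E) (𝓘(ℝ, E).prod 𝓘(ℝ, E))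
      (fun y => (TotalSpace.mk' E y (V y) : TangentBundle 𝓘(ℝ, E) E)) x ↔
      DifferentiableAt ℝ V x := by
  refine ⟨fun h => ?_, fun h => ?_⟩
  · exact MDifferentiableAt.differentiableAt <|
      ((contMDiff_snd_tangentBundle_modelSpace (n := 1) E 𝓘(ℝ, E)).contMDiffAt.mdifferentiableAt
        one_ne_zero).comp x h
  · refine (mdifferentiableAt_totalSpace 𝓘(ℝ, E) _).2 ⟨mdifferentiableAt_id, ?_⟩
    convert! h.mdifferentiableAt with y
    simp

theorem mlieBracket_vectorSpace (V W : E → E) (x : E) :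
    VectorField.mlieBracket 𝓘(ℝ, E) V W x = VectorField.lieBracket ℝ V W x := by
  have h := congrFun (VectorField.mlieBracketWithin_eq_lieBracketWithin (𝕜 := ℝ) (V := V) (W := W)
    (s := Set.univ)) x
  rw [VectorField.lieBracketWithin_univ] at h
  rw [← h]
  rfl

theorem contMDiffAt_endo_iff {A : E → E →L[ℝ] E} {x : E} :
    ContMDiffAt 𝓘(ℝ, E) (𝓘(ℝ, E).prod 𝓘(ℝ, E →L[ℝ] E)) ∞
      (fun y => (⟨y, A y⟩ : TotalSpace (E →L[ℝ] E)
        fun y : E => TangentSpace 𝓘(ℝ, E) y →L[ℝ] TangentSpace 𝓘(ℝ, E) y)) x ↔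
      ContDiffAt ℝ ∞ A x := by
  rw [contMDiffAt_hom_bundle]
  have h : (fun y : E => inCoordinates E (TangentSpace 𝓘(ℝ, E) (M := E)) E
      (TangentSpace 𝓘(ℝ, E) (M := E)) x y x y (A y)) = A := by
    ext y v
    simp [inCoordinates]
    rfl
  exact ⟨fun h' => by have := h'.2; erw [h] at this; exact this.contDiffAt,
    fun h' => ⟨contMDiffAt_id, by erw [h]; exact h'.contMDiffAt⟩⟩

end Flat

theorem two_le_infty : (2 : WithTop ℕ∞) ≤ ∞ := by
  have : ((2 : ℕ∞) : WithTop ℕ∞) ≤ ∞ := WithTop.coe_le_coe.2 le_top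
  exact this

/-! ### Vector fields, brackets and derivatives read in a natural chart. -/

section Charts

variable {n : ℕ} {M : Type*} [TopologicalSpace M] [ChartedSpace (Base n) M]
  [IsManifold (𝓡 n) ∞ M] {e : OpenPartialHomeomorph M (Base n)}

theorem cotChart_mem_target {u : Cotangent n M} (hu : u.1 ∈ e.source) :
    (cotChart e u).1 ∈ e.target := e.map_source hu

theorem cotChartSymm_mem_source {z : Coord n} (hz : z.1 ∈ e.target) :
    (cotChartSymm (M := M) e z).1 ∈ e.source := e.map_target hz

theorem eventually_mem_source {u : Cotangent n M} (hu : u.1 ∈ e.source) :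
    ∀ᶠ v : Cotangent n M in 𝓝 u, v.1 ∈ e.source :=
  (isOpen_fst_preimage _ e.open_source).mem_nhds hu

omit [ChartedSpace (Base n) M] [IsManifold (𝓡 n) ∞ M] in
theorem eventually_mem_target {z : Coord n} (hz : z.1 ∈ e.target) :
    ∀ᶠ y : Coord n in 𝓝 z, y.1 ∈ e.target :=
  (e.open_target.preimage continuous_fst).mem_nhds hz

theorem tendsto_cotChart (he : e ∈ IsManifold.maximalAtlas (𝓡 n) ∞ M)
    {u : Cotangent n M} (hu : u.1 ∈ e.source) :
    Tendsto (cotChart e) (𝓝 u) (𝓝 (cotChart e u)) :=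
  (contMDiffAt_cotChart he hu).continuousAt

theorem tendsto_cotChartSymm (he : e ∈ IsManifold.maximalAtlas (𝓡 n) ∞ M)
    {u : Cotangent n M} (hu : u.1 ∈ e.source) :
    Tendsto (cotChartSymm e) (𝓝 (cotChart e u)) (𝓝 u) := by
  have := (contMDiffAt_cotChartSymm he (cotChart_mem_target hu)).continuousAt
  rwa [ContinuousAt, cotChartSymm_cotChart he hu] at this

/-- The components of a vector field in the natural chart. -/
def chartRep (e : OpenPartialHomeomorph M (Base n)) (Y : VField n M) (z : Coord n) : Coord n :=
  dChart e (cotChartSymm e z) (Y (cotChartSymm e z))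

theorem chartRep_cotChart (he : e ∈ IsManifold.maximalAtlas (𝓡 n) ∞ M)
    {u : Cotangent n M} (hu : u.1 ∈ e.source) (Y : VField n M) :
    chartRep e Y (cotChart e u) = dChart e u (Y u) := by
  unfold chartRep
  rw [cotChartSymm_cotChart he hu]

theorem dChart_inverse_dChart (he : e ∈ IsManifold.maximalAtlas (𝓡 n) ∞ M)
    {u : Cotangent n M} (hu : u.1 ∈ e.source) (X : TangentSpace (cotI n) u) :
    (dChart e u).inverse (dChart e u X) = X := by
  obtain ⟨L, hL⟩ := isInvertible_dChart he hu
  simp [← hL]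

theorem dChart_dChart_inverse (he : e ∈ IsManifold.maximalAtlas (𝓡 n) ∞ M)
    {u : Cotangent n M} (hu : u.1 ∈ e.source) (X : Coord n) :
    dChart e u ((dChart e u).inverse X) = X := by
  obtain ⟨L, hL⟩ := isInvertible_dChart he hu
  simp [← hL]

theorem dChart_ofChart (he : e ∈ IsManifold.maximalAtlas (𝓡 n) ∞ M)
    {u : Cotangent n M} (hu : u.1 ∈ e.source) (V : Coord n → Coord n) :
    dChart e u (ofChart e V u) = V (cotChart e u) :=
  dChart_dChart_inverse he hu _

theorem ofChart_chartRep (he : e ∈ IsManifold.maximalAtlas (𝓡 n) ∞ M)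
    {u : Cotangent n M} (hu : u.1 ∈ e.source) (Y : VField n M) :
    ofChart e (chartRep e Y) u = Y u := by
  rw [ofChart, chartRep_cotChart he hu, dChart_inverse_dChart he hu]

theorem chartRep_ofChart (he : e ∈ IsManifold.maximalAtlas (𝓡 n) ∞ M)
    {z : Coord n} (hz : z.1 ∈ e.target) (V : Coord n → Coord n) :
    chartRep (M := M) e (ofChart e V) z = V z := by
  rw [chartRep, dChart_ofChart he (cotChartSymm_mem_source hz), cotChart_cotChartSymm he hz]

theorem ofChart_chartRep_eventuallyEq (he : e ∈ IsManifold.maximalAtlas (𝓡 n) ∞ M)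
    {u : Cotangent n M} (hu : u.1 ∈ e.source) (Y : VField n M) :
    Y =ᶠ[𝓝 u] ofChart e (chartRep e Y) := by
  filter_upwards [eventually_mem_source hu] with v hv
  exact (ofChart_chartRep he hv Y).symm

theorem chartRep_ofChart_eventuallyEq (he : e ∈ IsManifold.maximalAtlas (𝓡 n) ∞ M)
    {z : Coord n} (hz : z.1 ∈ e.target) (V : Coord n → Coord n) :
    chartRep (M := M) e (ofChart e V) =ᶠ[𝓝 z] V := by
  filter_upwards [eventually_mem_target hz] with y hy
  exact chartRep_ofChart he hy V

theorem chartRep_congr (he : e ∈ IsManifold.maximalAtlas (𝓡 n) ∞ M)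
    {u : Cotangent n M} (hu : u.1 ∈ e.source) {Y Z : VField n M} (h : Y =ᶠ[𝓝 u] Z) :
    chartRep e Y =ᶠ[𝓝 (cotChart e u)] chartRep e Z := by
  filter_upwards [(tendsto_cotChartSymm he hu).eventually h] with z hz
  simp only [chartRep, hz]

theorem inverse_mfderiv_cotChartSymm (he : e ∈ IsManifold.maximalAtlas (𝓡 n) ∞ M)
    {z : Coord n} (hz : z.1 ∈ e.target) :
    (mfderiv 𝓘(ℝ, Coord n) (cotI n) (cotChartSymm (M := M) e) z).IsInvertible ∧
    (mfderiv 𝓘(ℝ, Coord n) (cotI n) (cotChartSymm (M := M) e) z).inverse =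
      dChart e (cotChartSymm e z) := by
  have h : (cotHomeo e he).MDifferentiable (cotI n) 𝓘(ℝ, Coord n) :=
    ⟨fun v hv => ((contMDiffAt_cotChart he hv).mdifferentiableAt
        (by simp)).mdifferentiableWithinAt,
      fun z hz => ((contMDiffAt_cotChartSymm he hz).mdifferentiableAt
        (by simp)).mdifferentiableWithinAt⟩
  refine ⟨⟨h.symm.mfderiv hz, rfl⟩, ?_⟩
  exact ContinuousLinearMap.inverse_equiv (h.symm.mfderiv hz)

theorem diffAt_ofChart (he : e ∈ IsManifold.maximalAtlas (𝓡 n) ∞ M)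
    {u : Cotangent n M} (hu : u.1 ∈ e.source) {V : Coord n → Coord n}
    (hV : DifferentiableAt ℝ V (cotChart e u)) : DiffAt (ofChart e V) u :=
  MDifferentiableAt.mpullback_vectorField (n := ∞) (V := V)
    (mdifferentiableAt_field_iff.2 hV)
    (contMDiffAt_cotChart he hu) (isInvertible_dChart he hu) two_le_infty

theorem DiffAt.congr {u : Cotangent n M} {Y Z : VField n M} (hY : DiffAt Y u)
    (h : Z =ᶠ[𝓝 u] Y) : DiffAt Z u := by
  refine MDifferentiableAt.congr_of_eventuallyEq hY ?_
  filter_upwards [h] with v hv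
  rw [hv]

/-- Taking components is pulling back by the inverse chart, so regularity results for pulled-back
fields apply to components. -/
theorem chartRep_eventuallyEq_mpullback (he : e ∈ IsManifold.maximalAtlas (𝓡 n) ∞ M)
    {z : Coord n} (hz : z.1 ∈ e.target) (Y : VField n M) :
    chartRep e Y =ᶠ[𝓝 z]
      VectorField.mpullback 𝓘(ℝ, Coord n) (cotI n) (cotChartSymm (M := M) e) Y := by
  filter_upwards [eventually_mem_target hz] with y hy
  rw [VectorField.mpullback_apply, (inverse_mfderiv_cotChartSymm he hy).2]
  rfl

theorem DiffAt.chartRep (he : e ∈ IsManifold.maximalAtlas (𝓡 n) ∞ M)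
    {u : Cotangent n M} (hu : u.1 ∈ e.source) {Y : VField n M} (hY : DiffAt Y u) :
    DifferentiableAt ℝ (chartRep e Y) (cotChart e u) := by
  have hz := cotChart_mem_target hu
  rw [← cotChartSymm_cotChart he hu] at hY
  have := MDifferentiableAt.mpullback_vectorField (n := ∞) hY
    (contMDiffAt_cotChartSymm he hz) (inverse_mfderiv_cotChartSymm he hz).1
    two_le_infty
  exact (mdifferentiableAt_field_iff.1 this).congr_of_eventuallyEq
    (chartRep_eventuallyEq_mpullback he hz Y)

theorem contDiffAt_chartRep (he : e ∈ IsManifold.maximalAtlas (𝓡 n) ∞ M)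
    {u : Cotangent n M} (hu : u.1 ∈ e.source) {Y : VField n M}
    (hY : ContMDiffAt (cotI n) ((cotI n).prod 𝓘(ℝ, CotModel n)) ∞
      (fun v => TotalSpace.mk' (CotModel n) v (Y v)) u) :
    ContDiffAt ℝ ∞ (HamiltonGeometry.chartRep e Y) (cotChart e u) := by
  have hz := cotChart_mem_target hu
  rw [← cotChartSymm_cotChart he hu] at hY
  have := ContMDiffAt.mpullback_vectorField_preimage (n := ∞) hY
    (contMDiffAt_cotChartSymm he hz) (inverse_mfderiv_cotChartSymm he hz).1
    (by simp)
  exact (contMDiffAt_vectorSpace_iff_contDiffAt.1 this).congr_of_eventuallyEq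
    (chartRep_eventuallyEq_mpullback he hz Y)

/-- Brackets are natural under pull-back. Both fields are replaced near `u` by pull-backs of their
components, which the bracket does not notice. -/
theorem dChart_mlieBracket (he : e ∈ IsManifold.maximalAtlas (𝓡 n) ∞ M)
    {u : Cotangent n M} (hu : u.1 ∈ e.source) {X Y : VField n M} (hX : DiffAt X u)
    (hY : DiffAt Y u) :
    dChart e u (VectorField.mlieBracket (cotI n) X Y u) =
      VectorField.lieBracket ℝ (HamiltonGeometry.chartRep e X) (HamiltonGeometry.chartRep e Y)
        (cotChart e u) := by
  have : IsManifold (cotI n) (minSmoothness ℝ 2) (Cotangent n M) := by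
    rw [minSmoothness_of_isRCLikeNormedField]
    infer_instance
  have h := VectorField.mpullback_mlieBracket (n := ∞)
    (V := HamiltonGeometry.chartRep e X) (W := HamiltonGeometry.chartRep e Y)
    (mdifferentiableAt_field_iff.2 (hX.chartRep he hu))
    (mdifferentiableAt_field_iff.2 (hY.chartRep he hu)) (contMDiffAt_cotChart he hu)
    (by rw [minSmoothness_of_isRCLikeNormedField]; exact two_le_infty)
  have h2 := Filter.EventuallyEq.mlieBracket_vectorField_eq (I := cotI n)
    (ofChart_chartRep_eventuallyEq he hu X) (ofChart_chartRep_eventuallyEq he hu Y)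
  rw [h2]
  refine (congrArg (dChart e u) h.symm).trans ?_
  rw [VectorField.mpullback_apply]
  refine (dChart_dChart_inverse he hu _).trans ?_
  exact mlieBracket_vectorSpace _ _ _

theorem mvfderiv_eq_fderiv (he : e ∈ IsManifold.maximalAtlas (𝓡 n) ∞ M)
    {u : Cotangent n M} (hu : u.1 ∈ e.source) {f : Cotangent n M → ℝ}
    {F : Coord n → ℝ} (hF : DifferentiableAt ℝ F (cotChart e u))
    (hf : f =ᶠ[𝓝 u] fun v => F (cotChart e v))
    (X : TangentSpace (cotI n) u) :
    mvfderiv (cotI n) f u X = fderiv ℝ F (cotChart e u) (dChart e u X) := by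
  have h1 := (hF.mdifferentiableAt.hasMFDerivAt.comp u
    ((contMDiffAt_cotChart he hu).mdifferentiableAt (by simp)).hasMFDerivAt).congr_of_eventuallyEq
      hf
  rw [mvfderiv, h1.mfderiv, mfderiv_eq_fderiv]
  rfl

end Charts

/-! ### The Koszul formula with prescribed torsion, as linear algebra. -/

section Koszul

variable {n : ℕ} {G Gi : Matrix (Fin n) (Fin n) ℝ} {Γ dG τ : Fin n → Fin n → Fin n → ℝ}

/-- The Koszul expression of the coefficients `Γ^i_{jk}` of a metric connection
(`D_k E_j = Γ^i_{jk} E_i`) from the derivatives `dG k i j = E_k G_{ij}` and the lowered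
torsion `τ m k j`. -/
def koszulCoeff (Gi : Matrix (Fin n) (Fin n) ℝ) (dG τ : Fin n → Fin n → Fin n → ℝ)
    (i j k : Fin n) : ℝ :=
  ∑ m, Gi i m * (1 / 2 * (dG k j m + dG j k m - dG m k j + τ m k j - τ j k m - τ k j m))

theorem sum_inverse_mul (hG : Gi * G = 1) (v : Fin n → ℝ) (i : Fin n) :
    ∑ m, Gi i m * ∑ l, G m l * v l = v i := by
  have h : Matrix.mulVec Gi (Matrix.mulVec G v) i = v i := by
    rw [Matrix.mulVec_mulVec, hG, Matrix.one_mulVec]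
  simpa [Matrix.mulVec, dotProduct] using h

/-- Koszul's trick: in E_k G_{jm} + E_j G_{km} - E_m G_{kj} the metric equation leaves one symmetric
pair of Γ's and two skew differences, and the latter are torsion. This is the uniqueness half. -/
theorem eq_koszulCoeff (hG : Gi * G = 1) (hsym : ∀ i j, G i j = G j i)
    (metric : ∀ k i j, dG k i j = ∑ m, Γ m i k * G m j + ∑ m, Γ m j k * G i m)
    (torsion : ∀ m k j, ∑ i, G m i * (Γ i j k - Γ i k j) = τ m k j) (i j k : Fin n) :
    Γ i j k = koszulCoeff Gi dG τ i j k := by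
  have h : ∀ m, ∑ l, G m l * Γ l j k =
      1 / 2 * (dG k j m + dG j k m - dG m k j + τ m k j - τ j k m - τ k j m) := by
    intro m
    have e : ∀ a b c, ∑ l, Γ l a b * G l c = ∑ l, G c l * Γ l a b := fun a b c =>
      Finset.sum_congr rfl fun l _ => by rw [hsym l c, mul_comm]
    have e' : ∀ a b c, ∑ l, Γ l a b * G c l = ∑ l, G c l * Γ l a b := fun a b c =>
      Finset.sum_congr rfl fun l _ => mul_comm _ _
    simp only [metric, ← torsion, mul_sub, Finset.sum_sub_distrib, e, e']
    ring
  rw [koszulCoeff, ← sum_inverse_mul hG (fun l => Γ l j k) i]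
  exact Finset.sum_congr rfl fun m _ => by rw [h m]

theorem koszulCoeff_lower (hG : G * Gi = 1) (m j k : Fin n) :
    ∑ i, G m i * koszulCoeff Gi dG τ i j k =
      1 / 2 * (dG k j m + dG j k m - dG m k j + τ m k j - τ j k m - τ k j m) :=
  sum_inverse_mul hG
    (fun m => 1 / 2 * (dG k j m + dG j k m - dG m k j + τ m k j - τ j k m - τ k j m)) m

/-- Existence half: after lowering the index, all terms but E_k G_{ij} cancel in pairs, by the
symmetry of `dG` and the skewness of `τ`. -/
theorem koszulCoeff_metric (hG : G * Gi = 1) (hsym : ∀ i j, G i j = G j i)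
    (hd : ∀ k i j, dG k i j = dG k j i) (hτ : ∀ m k j, τ m k j = -τ m j k) (k i j : Fin n) :
    dG k i j = ∑ m, koszulCoeff Gi dG τ m i k * G m j +
      ∑ m, koszulCoeff Gi dG τ m j k * G i m := by
  have e : ∀ a b c, ∑ l, koszulCoeff Gi dG τ l a b * G l c =
      ∑ l, G c l * koszulCoeff Gi dG τ l a b := fun a b c =>
    Finset.sum_congr rfl fun l _ => by rw [hsym l c, mul_comm]
  have e' : ∀ a b c, ∑ l, koszulCoeff Gi dG τ l a b * G c l =
      ∑ l, G c l * koszulCoeff Gi dG τ l a b := fun a b c =>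
    Finset.sum_congr rfl fun l _ => mul_comm _ _
  rw [e, e', koszulCoeff_lower hG, koszulCoeff_lower hG]
  rw [hd i k j, hd j k i, hd k j i, hτ k i j, hτ j k i, hτ i k j]
  ring

theorem koszulCoeff_torsion (hG : G * Gi = 1) (hd : ∀ k i j, dG k i j = dG k j i)
    (hτ : ∀ m k j, τ m k j = -τ m j k) (m k j : Fin n) :
    ∑ i, G m i * (koszulCoeff Gi dG τ i j k - koszulCoeff Gi dG τ i k j) = τ m k j := by
  simp only [mul_sub, Finset.sum_sub_distrib, koszulCoeff_lower hG]
  rw [hd m k j, hτ m j k]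
  ring

end Koszul

/-! ### Smoothness and symmetry of the local objects generated by a Hamilton function. -/

section Regular

variable {n : ℕ}

/-- `h` is smooth with non-degenerate fundamental tensor on the open set `Z`. -/
structure IsRegularOn (h : Coord n → ℝ) (Z : Set (Coord n)) : Prop where
  isOpen : IsOpen Z
  smooth : ∀ z ∈ Z, ContDiffAt ℝ ∞ h z
  det_ne : ∀ z ∈ Z, (gUp h z).det ≠ 0

theorem contDiffAt_fderiv_apply {f : Coord n → ℝ} {V : Coord n → Coord n} {z : Coord n}
    (hf : ContDiffAt ℝ ∞ f z) (hV : ContDiffAt ℝ ∞ V z) :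
    ContDiffAt ℝ ∞ (fun y => fderiv ℝ f y (V y)) z :=
  (hf.fderiv_right (m := ∞) (by simp)).clm_apply hV

theorem contDiffAt_dX {f : Coord n → ℝ} {z : Coord n} (hf : ContDiffAt ℝ ∞ f z) (i : Fin n) :
    ContDiffAt ℝ ∞ (dX i f) z := contDiffAt_fderiv_apply hf contDiffAt_const

theorem contDiffAt_dP {f : Coord n → ℝ} {z : Coord n} (hf : ContDiffAt ℝ ∞ f z) (i : Fin n) :
    ContDiffAt ℝ ∞ (dP i f) z := contDiffAt_fderiv_apply hf contDiffAt_const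

theorem contDiffAt_matrix_det {A : Coord n → Matrix (Fin n) (Fin n) ℝ} {z : Coord n}
    (hA : ∀ i j, ContDiffAt ℝ ∞ (fun y => A y i j) z) :
    ContDiffAt ℝ ∞ (fun y => (A y).det) z := by
  simp only [Matrix.det_apply']
  exact ContDiffAt.sum fun σ _ => contDiffAt_const.mul (contDiffAt_prod fun i _ => hA _ _)

theorem contDiffAt_matrix_inv {A : Coord n → Matrix (Fin n) (Fin n) ℝ} {z : Coord n}
    (hA : ∀ i j, ContDiffAt ℝ ∞ (fun y => A y i j) z) (hz : (A z).det ≠ 0) (i j : Fin n) :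
    ContDiffAt ℝ ∞ (fun y => (A y)⁻¹ i j) z := by
  simp only [Matrix.inv_def, Matrix.smul_apply, Ring.inverse_eq_inv', smul_eq_mul,
    Matrix.adjugate_apply]
  refine ((contDiffAt_matrix_det hA).inv hz).mul (contDiffAt_matrix_det fun k l => ?_)
  by_cases hk : k = j
  · subst hk
    simp only [Matrix.updateRow_self]
    exact contDiffAt_const
  · simp only [Matrix.updateRow_ne hk]
    exact hA k l

theorem minSmoothness_le_infty : minSmoothness ℝ 2 ≤ (∞ : WithTop ℕ∞) := by
  rw [minSmoothness_of_isRCLikeNormedField]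
  have : ((2 : ℕ∞) : WithTop ℕ∞) ≤ ∞ := WithTop.coe_le_coe.2 le_top
  exact this

theorem fderiv_fderiv_apply_const {f : Coord n → ℝ} {z : Coord n} (hf : ContDiffAt ℝ ∞ f z)
    (v w : Coord n) :
    fderiv ℝ (fun y => fderiv ℝ f y v) z w = fderiv ℝ (fun y => fderiv ℝ f y w) z v := by
  have hd : DifferentiableAt ℝ (fderiv ℝ f) z :=
    (hf.fderiv_right (m := ∞) (by simp)).differentiableAt (by simp)
  have e : ∀ v w, fderiv ℝ (fun y => fderiv ℝ f y v) z w = fderiv ℝ (fderiv ℝ f) z w v := by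
    intro v w
    rw [fderiv_clm_apply hd (differentiableAt_const _)]
    simp
  rw [e, e]
  exact (hf.isSymmSndFDerivAt (minSmoothness_le_infty)) w v

variable {h : Coord n → ℝ} {Z : Set (Coord n)} {z : Coord n}

namespace IsRegularOn

theorem eventually (hZ : IsRegularOn h Z) (hz : z ∈ Z) : ∀ᶠ y in 𝓝 z, y ∈ Z :=
  hZ.isOpen.mem_nhds hz

theorem contDiffAt_gUp (hZ : IsRegularOn h Z) (hz : z ∈ Z) (a b : Fin n) :
    ContDiffAt ℝ ∞ (fun y => gUp h y a b) z :=
  contDiffAt_dP (contDiffAt_dP (hZ.smooth z hz) b) a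

theorem contDiffAt_gLow (hZ : IsRegularOn h Z) (hz : z ∈ Z) (a b : Fin n) :
    ContDiffAt ℝ ∞ (fun y => gLow h y a b) z :=
  contDiffAt_matrix_inv (hZ.contDiffAt_gUp hz) (hZ.det_ne z hz) a b

theorem gUp_symm (hZ : IsRegularOn h Z) (hz : z ∈ Z) (a b : Fin n) :
    gUp h z a b = gUp h z b a :=
  fderiv_fderiv_apply_const (hZ.smooth z hz) _ _

theorem gUp_transpose (hZ : IsRegularOn h Z) (hz : z ∈ Z) : (gUp h z).transpose = gUp h z := by
  ext a b
  exact hZ.gUp_symm hz b a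

theorem gLow_symm (hZ : IsRegularOn h Z) (hz : z ∈ Z) (a b : Fin n) :
    gLow h z a b = gLow h z b a := by
  have := Matrix.transpose_nonsing_inv (gUp h z)
  rw [hZ.gUp_transpose hz] at this
  exact (congrFun (congrFun this b) a)

theorem gUp_mul_gLow (hZ : IsRegularOn h Z) (hz : z ∈ Z) : gUp h z * gLow h z = 1 :=
  Matrix.mul_nonsing_inv _ (isUnit_iff_ne_zero.2 (hZ.det_ne z hz))

theorem gLow_mul_gUp (hZ : IsRegularOn h Z) (hz : z ∈ Z) : gLow h z * gUp h z = 1 :=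
  Matrix.nonsing_inv_mul _ (isUnit_iff_ne_zero.2 (hZ.det_ne z hz))

/-- The formula is symmetric once g_{ij} is; as the bracket differentiates g_{ij}, its symmetry is
needed on a neighbourhood. This makes the horizontal space Lagrangian. -/
theorem nonlin_symm (hZ : IsRegularOn h Z) (hz : z ∈ Z) (i j : Fin n) :
    nonlin h z i j = nonlin h z j i := by
  have e : (fun y => gLow h y i j) =ᶠ[𝓝 z] fun y => gLow h y j i := by
    filter_upwards [hZ.eventually hz] with y hy
    exact hZ.gLow_symm hy i j
  have e2 : poisson (fun y => gLow h y i j) h z = poisson (fun y => gLow h y j i) h z := by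
    simp only [poisson, dX, dP, e.fderiv_eq]
  simp only [nonlin, e2, add_comm]

theorem contDiffAt_nonlin (hZ : IsRegularOn h Z) (hz : z ∈ Z) (i j : Fin n) :
    ContDiffAt ℝ ∞ (fun y => nonlin h y i j) z := by
  have hs := hZ.smooth z hz
  have hg := hZ.contDiffAt_gLow hz
  refine contDiffAt_const.mul (ContDiffAt.sub ?_ ?_)
  · exact ContDiffAt.sum fun k _ => ((contDiffAt_dP (hg i j) k).mul (contDiffAt_dX hs k)).sub
      ((contDiffAt_dX (hg i j) k).mul (contDiffAt_dP hs k))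
  · exact ContDiffAt.sum fun k _ => ((contDiffAt_dP (contDiffAt_dX hs i) k).mul (hg j k)).add
      ((contDiffAt_dP (contDiffAt_dX hs j) k).mul (hg i k))

theorem contDiffAt_hVec (hZ : IsRegularOn h Z) (hz : z ∈ Z) (i : Fin n) :
    ContDiffAt ℝ ∞ (hVec h i) z :=
  contDiffAt_const.prodMk (contDiffAt_pi.2 fun a => hZ.contDiffAt_nonlin hz i a)

theorem contDiffAt_wVec (hZ : IsRegularOn h Z) (hz : z ∈ Z) (b : Fin n) :
    ContDiffAt ℝ ∞ (wVec h b) z :=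
  contDiffAt_const.sub (ContDiffAt.sum fun i _ =>
    (hZ.contDiffAt_gUp hz b i).smul (hZ.contDiffAt_hVec hz i))

theorem contDiffAt_wForm (hZ : IsRegularOn h Z) (hz : z ∈ Z) (b : Fin n) :
    ContDiffAt ℝ ∞ (fun y => wForm h y b) z :=
  contDiffAt_const.sub (ContDiffAt.sum fun i _ =>
    (hZ.contDiffAt_nonlin hz i b).smul contDiffAt_const)

theorem contDiffAt_hForm (hZ : IsRegularOn h Z) (hz : z ∈ Z) (i : Fin n) :
    ContDiffAt ℝ ∞ (fun y => hForm h y i) z :=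
  contDiffAt_const.add (ContDiffAt.sum fun b _ =>
    (hZ.contDiffAt_gUp hz b i).smul (hZ.contDiffAt_wForm hz b))

theorem contDiffAt_eH (hZ : IsRegularOn h Z) (hz : z ∈ Z) {f : Coord n → ℝ}
    (hf : ContDiffAt ℝ ∞ f z) (i : Fin n) : ContDiffAt ℝ ∞ (eH h i f) z :=
  contDiffAt_fderiv_apply hf (hZ.contDiffAt_hVec hz i)

theorem contDiffAt_eW (hZ : IsRegularOn h Z) (hz : z ∈ Z) {f : Coord n → ℝ}
    (hf : ContDiffAt ℝ ∞ f z) (i : Fin n) : ContDiffAt ℝ ∞ (eW h i f) z :=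
  contDiffAt_fderiv_apply hf (hZ.contDiffAt_wVec hz i)

theorem contDiffAt_curvN (hZ : IsRegularOn h Z) (hz : z ∈ Z) (i j a : Fin n) :
    ContDiffAt ℝ ∞ (fun y => curvN h y i j a) z :=
  (hZ.contDiffAt_eH hz (hZ.contDiffAt_nonlin hz i a) j).sub
    (hZ.contDiffAt_eH hz (hZ.contDiffAt_nonlin hz j a) i)

theorem contDiffAt_bTerm (hZ : IsRegularOn h Z) (hz : z ∈ Z) (m k j : Fin n) :
    ContDiffAt ℝ ∞ (fun y => bTerm h y m k j) z :=
  ContDiffAt.sum fun i _ => ContDiffAt.sum fun a _ => (hZ.contDiffAt_gUp hz m i).mul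
    (((hZ.contDiffAt_gUp hz k a).mul (hZ.contDiffAt_eW hz (hZ.contDiffAt_nonlin hz i a) j)).sub
      ((hZ.contDiffAt_gUp hz j a).mul (hZ.contDiffAt_eW hz (hZ.contDiffAt_nonlin hz i a) k)))

theorem contDiffAt_coeffL (hZ : IsRegularOn h Z) (hz : z ∈ Z) (k i j : Fin n) :
    ContDiffAt ℝ ∞ (fun y => coeffL h y k i j) z := by
  have hg := hZ.contDiffAt_gLow hz
  have hc := hZ.contDiffAt_curvN hz
  refine ContDiffAt.sub (contDiffAt_const.mul (ContDiffAt.sum fun m _ => ?_))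
    (contDiffAt_const.mul (ContDiffAt.sum fun m _ => ?_))
  · exact (hZ.contDiffAt_gUp hz k m).mul (((hZ.contDiffAt_eH hz (hg m j) i).add
      (hZ.contDiffAt_eH hz (hg i m) j)).sub (hZ.contDiffAt_eH hz (hg i j) m))
  · exact (hZ.contDiffAt_gUp hz k m).mul (((hc j i m).add (hc m j i)).add (hc m i j))

theorem contDiffAt_coeffC (hZ : IsRegularOn h Z) (hz : z ∈ Z) (i j k : Fin n) :
    ContDiffAt ℝ ∞ (fun y => coeffC h y i j k) z := by
  have hg := hZ.contDiffAt_gUp hz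
  have hb := hZ.contDiffAt_bTerm hz
  refine ContDiffAt.sub (contDiffAt_const.mul (ContDiffAt.sum fun m _ => ?_))
    (contDiffAt_const.mul (ContDiffAt.sum fun m _ => ?_))
  · exact (hZ.contDiffAt_gLow hz i m).mul (((hZ.contDiffAt_eW hz (hg m k) j).add
      (hZ.contDiffAt_eW hz (hg j m) k)).sub (hZ.contDiffAt_eW hz (hg j k) m))
  · exact (hZ.contDiffAt_gLow hz i m).mul (((hb j m k).add (hb k m j)).add (hb m k j))

end IsRegularOn

/-! ### The adapted frame and coframe -/

theorem dxForm_apply (i : Fin n) (X : Coord n) : dxForm i X = X.1 i := rfl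

theorem dpForm_apply (i : Fin n) (X : Coord n) : dpForm i X = X.2 i := rfl

theorem wForm_apply (h : Coord n → ℝ) (z : Coord n) (b : Fin n) (X : Coord n) :
    wForm h z b X = X.2 b - ∑ i, nonlin h z i b * X.1 i := by
  simp [wForm, dxForm_apply, dpForm_apply]

theorem hForm_apply (h : Coord n → ℝ) (z : Coord n) (i : Fin n) (X : Coord n) :
    hForm h z i X = X.1 i + ∑ b, gUp h z b i * wForm h z b X := by
  simp [hForm, dxForm_apply]

theorem wForm_hVec (h : Coord n → ℝ) (z : Coord n) (b i : Fin n) :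
    wForm h z b (hVec h i z) = 0 := by
  simp [wForm_apply, hVec]

theorem hForm_hVec (h : Coord n → ℝ) (z : Coord n) (i j : Fin n) :
    hForm h z i (hVec h j z) = if i = j then 1 else 0 := by
  rw [hForm_apply]
  simp only [wForm_hVec]
  simp [hVec]

theorem wForm_vVec (h : Coord n → ℝ) (z : Coord n) (a b : Fin n) :
    wForm h z a (vVec b z) = if a = b then 1 else 0 := by
  simp [wForm_apply, vVec, Pi.single_apply]

theorem hForm_vVec (h : Coord n → ℝ) (z : Coord n) (i b : Fin n) :
    hForm h z i (vVec b z) = gUp h z b i := by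
  simp [hForm_apply, wForm_vVec]
  simp [vVec]

theorem wForm_wVec (h : Coord n → ℝ) (z : Coord n) (a b : Fin n) :
    wForm h z a (wVec h b z) = if a = b then 1 else 0 := by
  simp [wVec, wForm_hVec, wForm_vVec]

theorem hForm_wVec (h : Coord n → ℝ) (z : Coord n) (i b : Fin n) :
    hForm h z i (wVec h b z) = 0 := by
  simp [wVec, hForm_hVec, hForm_vVec]

theorem frame_decomp (h : Coord n → ℝ) (z X : Coord n) :
    X = ∑ i, hForm h z i X • hVec h i z + ∑ b, wForm h z b X • wVec h b z := by
  refine Prod.ext ?_ ?_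
  · ext i
    simp [wVec, vVec, hVec, hForm_apply, Prod.fst_sum, Pi.single_apply, mul_comm]
  · ext a
    simp only [wVec, vVec, hVec, hForm_apply, Prod.snd_add, Prod.snd_sum, Prod.snd_sub,
      Prod.smul_snd, Pi.add_apply, Finset.sum_apply, Pi.smul_apply, Pi.sub_apply, smul_eq_mul,
      add_mul, mul_sub, Finset.sum_add_distrib, Finset.sum_sub_distrib, Finset.mul_sum,
      Finset.sum_mul]
    have e1 : ∑ b, wForm h z b X * Pi.single (M := fun _ => ℝ) b 1 a = wForm h z a X := by
      simp [Pi.single_apply]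
    rw [e1, Finset.sum_comm, wForm_apply h z a X]
    simp only [mul_comm, mul_left_comm]
    ring_nf

end Regular

/-! ### The tensors φ, θ and the metric in the adapted coframe. -/

section LocalTensors

variable {n : ℕ} {h : Coord n → ℝ} {Z : Set (Coord n)} {z : Coord n}

theorem phiLoc_apply (h : Coord n → ℝ) (z X : Coord n) :
    phiLoc h z X = ∑ i, hForm h z i X • hVec h i z - ∑ b, wForm h z b X • wVec h b z := by
  simp [phiLoc]

theorem coframe_ext (h : Coord n → ℝ) (z : Coord n) {X Y : Coord n}
    (h1 : ∀ i, hForm h z i X = hForm h z i Y) (h2 : ∀ b, wForm h z b X = wForm h z b Y) :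
    X = Y := by
  rw [frame_decomp h z X, frame_decomp h z Y]
  simp only [h1, h2]

theorem hForm_phiLoc (h : Coord n → ℝ) (z X : Coord n) (i : Fin n) :
    hForm h z i (phiLoc h z X) = hForm h z i X := by
  simp [phiLoc_apply, hForm_hVec, hForm_wVec]

theorem wForm_phiLoc (h : Coord n → ℝ) (z X : Coord n) (b : Fin n) :
    wForm h z b (phiLoc h z X) = -wForm h z b X := by
  simp [phiLoc_apply, wForm_hVec, wForm_wVec]

theorem phiLoc_hVec (h : Coord n → ℝ) (z : Coord n) (i : Fin n) :
    phiLoc h z (hVec h i z) = hVec h i z :=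
  coframe_ext h z (hForm_phiLoc h z _) fun b => by rw [wForm_phiLoc, wForm_hVec, neg_zero]

theorem phiLoc_wVec (h : Coord n → ℝ) (z : Coord n) (b : Fin n) :
    phiLoc h z (wVec h b z) = -wVec h b z :=
  coframe_ext h z (fun i => by rw [hForm_phiLoc, map_neg, hForm_wVec, neg_zero])
    fun a => by rw [wForm_phiLoc, map_neg]

theorem phiLoc_phiLoc (h : Coord n → ℝ) (z X : Coord n) : phiLoc h z (phiLoc h z X) = X :=
  coframe_ext h z (fun i => by simp only [hForm_phiLoc])
    fun b => by simp only [wForm_phiLoc, neg_neg]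

theorem wForm_eq_zero_of_phiLoc {X : Coord n} (hX : phiLoc h z X = X) (b : Fin n) :
    wForm h z b X = 0 := by
  have := wForm_phiLoc h z X b
  rw [hX] at this
  linarith

theorem hForm_eq_zero_of_phiLoc {X : Coord n} (hX : phiLoc h z X = -X) (i : Fin n) :
    hForm h z i X = 0 := by
  have := hForm_phiLoc h z X i
  rw [hX, map_neg] at this
  linarith

theorem thetaLoc_apply (X Y : Coord n) :
    thetaLoc n X Y = ∑ i, (X.2 i * Y.1 i - X.1 i * Y.2 i) := by
  simp [thetaLoc, LinearMap.BilinForm.linMulLin_apply, dxForm_apply, dpForm_apply]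

theorem metricLoc_apply (h : Coord n → ℝ) (z X Y : Coord n) :
    metricLoc h z X Y = ∑ i, ∑ j, gLow h z i j * (X.1 i * Y.1 j) +
      ∑ a, ∑ b, gUp h z a b * (wForm h z a X * wForm h z b Y) := by
  simp [metricLoc, LinearMap.BilinForm.linMulLin_apply, dxForm_apply]

theorem fst_eq_hForm (h : Coord n → ℝ) (z X : Coord n) (i : Fin n) :
    X.1 i = hForm h z i X - ∑ b, gUp h z b i * wForm h z b X := by
  rw [hForm_apply]
  ring

theorem snd_eq_wForm (h : Coord n → ℝ) (z X : Coord n) (b : Fin n) :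
    X.2 b = wForm h z b X + ∑ i, nonlin h z i b * X.1 i := by
  rw [wForm_apply]
  ring

/-- Passing from (dx, dp) to the adapted coframe adds terms in N and in g^{ab} contracted with skew
expressions; both vanish by symmetry. -/
theorem thetaLoc_eq (hZ : IsRegularOn h Z) (hz : z ∈ Z) (X Y : Coord n) :
    thetaLoc n X Y = ∑ i, (wForm h z i X * hForm h z i Y - hForm h z i X * wForm h z i Y) := by
  rw [thetaLoc_apply]
  have e1 : ∑ i, (∑ j, nonlin h z j i * X.1 j) * Y.1 i =
      ∑ i, X.1 i * ∑ j, nonlin h z j i * Y.1 j := by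
    simp only [Finset.sum_mul, Finset.mul_sum]
    rw [Finset.sum_comm]
    refine Finset.sum_congr rfl fun i _ => Finset.sum_congr rfl fun j _ => ?_
    rw [hZ.nonlin_symm hz i j]
    ring
  have e2 : ∑ i, wForm h z i X * ∑ b, gUp h z b i * wForm h z b Y =
      ∑ i, (∑ b, gUp h z b i * wForm h z b X) * wForm h z i Y := by
    simp only [Finset.sum_mul, Finset.mul_sum]
    rw [Finset.sum_comm]
    refine Finset.sum_congr rfl fun i _ => Finset.sum_congr rfl fun j _ => ?_
    rw [hZ.gUp_symm hz i j]
    ring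
  simp only [snd_eq_wForm h z, hForm_apply, add_mul, mul_add, Finset.sum_sub_distrib,
    Finset.sum_add_distrib] at *
  rw [e1, e2]
  ring

theorem sum_gLow_gUp (hZ : IsRegularOn h Z) (hz : z ∈ Z) (v w : Fin n → ℝ) :
    ∑ i, ∑ j, gLow h z i j * (v i * ∑ b, gUp h z b j * w b) = ∑ i, v i * w i := by
  refine Finset.sum_congr rfl fun i _ => ?_
  rw [← sum_inverse_mul (hZ.gLow_mul_gUp hz) w i, Finset.mul_sum]
  refine Finset.sum_congr rfl fun j _ => ?_
  simp only [hZ.gUp_symm hz j]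
  ring

/-- Substituting dx^i = h^i - g^{bi} w_b into the first block yields a second copy of g^{ab} w_a
w_b, whence the factor 2. The mixed terms have the constant coefficient g_{ij} g^{jb} = δ, which
makes them harmless for the connection. -/
theorem metricLoc_eq (hZ : IsRegularOn h Z) (hz : z ∈ Z) (X Y : Coord n) :
    metricLoc h z X Y = ∑ i, ∑ j, gLow h z i j * (hForm h z i X * hForm h z j Y) +
      2 * ∑ a, ∑ b, gUp h z a b * (wForm h z a X * wForm h z b Y) -
      ∑ i, (hForm h z i X * wForm h z i Y + wForm h z i X * hForm h z i Y) := by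
  have e1 := sum_gLow_gUp hZ hz
  have e2 : ∀ v w : Fin n → ℝ,
      ∑ i, ∑ j, gLow h z i j * ((∑ b, gUp h z b i * w b) * v j) = ∑ i, w i * v i := by
    intro v w
    rw [Finset.sum_comm]
    simp only [mul_comm _ (v _), hZ.gLow_symm hz _ _]
    rw [← e1 v w]
  have e3 : ∑ i, (∑ b, gUp h z b i * wForm h z b X) * wForm h z i Y =
      ∑ a, ∑ b, gUp h z a b * (wForm h z a X * wForm h z b Y) := by
    simp only [Finset.sum_mul]
    rw [Finset.sum_comm]
    simp only [mul_assoc]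
  rw [metricLoc_apply]
  simp only [fst_eq_hForm h z, sub_mul, mul_sub, Finset.sum_sub_distrib, e1, e2, e3,
    Finset.sum_add_distrib]
  ring

end LocalTensors

/-! ### Structure equations of the canonical connection and their unique solution. -/

section LocalConnection

variable {n : ℕ} {h : Coord n → ℝ} {Z : Set (Coord n)} {z : Coord n}

theorem clm_ext_frame {F : Type*} [AddCommGroup F] [Module ℝ F] [TopologicalSpace F]
    (h : Coord n → ℝ) (z : Coord n) {f g : Coord n →L[ℝ] F}
    (h1 : ∀ i, f (hVec h i z) = g (hVec h i z)) (h2 : ∀ b, f (wVec h b z) = g (wVec h b z)) :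
    f = g := by
  refine ContinuousLinearMap.ext fun X => ?_
  rw [frame_decomp h z X]
  simp only [map_add, map_sum, map_smul, h1, h2]

/-- The exterior derivative of a one-form. -/
def dForm (α : Coord n → Coord n →L[ℝ] ℝ) (z X Y : Coord n) : ℝ :=
  fderiv ℝ α z X Y - fderiv ℝ α z Y X

theorem fderiv_apply_field {α : Coord n → Coord n →L[ℝ] ℝ} {Y : Coord n → Coord n}
    (hα : DifferentiableAt ℝ α z) (hY : DifferentiableAt ℝ Y z) (X : Coord n) :
    fderiv ℝ (fun y => α y (Y y)) z X = fderiv ℝ α z X (Y z) + α z (fderiv ℝ Y z X) := by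
  rw [fderiv_clm_apply hα hY]
  simp [add_comm]

/-- Cartan's formula, without a factor ½: the derivatives of X and Y cancel against the bracket. It
turns torsion into a pointwise bilinear expression. -/
theorem dForm_eq_lieBracket {α : Coord n → Coord n →L[ℝ] ℝ} {X Y : Coord n → Coord n}
    (hα : DifferentiableAt ℝ α z) (hX : DifferentiableAt ℝ X z) (hY : DifferentiableAt ℝ Y z) :
    fderiv ℝ (fun y => α y (Y y)) z (X z) - fderiv ℝ (fun y => α y (X y)) z (Y z) -
      α z (VectorField.lieBracket ℝ X Y z) = dForm α z (X z) (Y z) := by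
  rw [fderiv_apply_field hα hX, fderiv_apply_field hα hY, VectorField.lieBracket_eq, dForm]
  simp only [map_sub]
  ring

theorem fderiv_form_apply {α : Coord n → Coord n →L[ℝ] ℝ} (hα : DifferentiableAt ℝ α z)
    (X Y : Coord n) : fderiv ℝ α z X Y = fderiv ℝ (fun y => α y Y) z X := by
  rw [fderiv_apply_field hα (differentiableAt_const Y)]
  simp

theorem fderiv_wForm (hZ : IsRegularOn h Z) (hz : z ∈ Z) (b : Fin n) (X Y : Coord n) :
    fderiv ℝ (fun y => wForm h y b) z X Y =
      -∑ i, fderiv ℝ (fun y => nonlin h y i b) z X * Y.1 i := by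
  have hN : ∀ i, DifferentiableAt ℝ (fun y => nonlin h y i b) z := fun i =>
    (hZ.contDiffAt_nonlin hz i b).differentiableAt (by simp)
  rw [fderiv_form_apply ((hZ.contDiffAt_wForm hz b).differentiableAt (by simp))]
  simp only [wForm_apply]
  have : HasFDerivAt (fun y => Y.2 b - ∑ i, nonlin h y i b * Y.1 i)
      (0 - ∑ i, Y.1 i • fderiv ℝ (fun y => nonlin h y i b) z) z :=
    (hasFDerivAt_const (Y.2 b) z).sub
      (HasFDerivAt.fun_sum fun i _ => (hN i).hasFDerivAt.mul_const (Y.1 i))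
  rw [this.fderiv]
  simp [mul_comm]

theorem dForm_wForm (hZ : IsRegularOn h Z) (hz : z ∈ Z) (b : Fin n) (X Y : Coord n) :
    dForm (fun y => wForm h y b) z X Y =
      ∑ i, (fderiv ℝ (fun y => nonlin h y i b) z Y * X.1 i -
        fderiv ℝ (fun y => nonlin h y i b) z X * Y.1 i) := by
  simp only [dForm, fderiv_wForm hZ hz, Finset.sum_sub_distrib]
  ring

/-- In the derivative of dx^i + g^{bi} w_b the factor multiplying dg^{bi} is w_b(Y), which is zero.
Hence dh^i is g^{bi} dw_b on horizontal vectors. -/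
theorem fderiv_hForm (hZ : IsRegularOn h Z) (hz : z ∈ Z) (i : Fin n) (X : Coord n) {Y : Coord n}
    (hY : ∀ b, wForm h z b Y = 0) :
    fderiv ℝ (fun y => hForm h y i) z X Y =
      ∑ b, gUp h z b i * fderiv ℝ (fun y => wForm h y b) z X Y := by
  have hg : ∀ b, DifferentiableAt ℝ (fun y => gUp h y b i) z := fun b =>
    (hZ.contDiffAt_gUp hz b i).differentiableAt (by simp)
  have hw : ∀ b, DifferentiableAt ℝ (fun y => wForm h y b) z := fun b =>
    (hZ.contDiffAt_wForm hz b).differentiableAt (by simp)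
  have hwY : ∀ b, DifferentiableAt ℝ (fun y => wForm h y b Y) z := fun b =>
    (hw b).clm_apply (differentiableAt_const Y)
  rw [fderiv_form_apply ((hZ.contDiffAt_hForm hz i).differentiableAt (by simp))]
  simp only [hForm_apply, fderiv_form_apply (hw _)]
  have : HasFDerivAt (fun y => Y.1 i + ∑ b, gUp h y b i * wForm h y b Y)
      (0 + ∑ b, (gUp h z b i • fderiv ℝ (fun y => wForm h y b Y) z +
        wForm h z b Y • fderiv ℝ (fun y => gUp h y b i) z)) z :=
    (hasFDerivAt_const (Y.1 i) z).add (HasFDerivAt.fun_sum fun b _ =>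
      (hg b).hasFDerivAt.mul (hwY b).hasFDerivAt)
  rw [this.fderiv]
  simp [hY]

theorem dForm_hForm (hZ : IsRegularOn h Z) (hz : z ∈ Z) (i : Fin n) {X Y : Coord n}
    (hX : ∀ b, wForm h z b X = 0) (hY : ∀ b, wForm h z b Y = 0) :
    dForm (fun y => hForm h y i) z X Y =
      ∑ b, gUp h z b i * dForm (fun y => wForm h y b) z X Y := by
  simp only [dForm, fderiv_hForm hZ hz i _ hX, fderiv_hForm hZ hz i _ hY, mul_sub,
    Finset.sum_sub_distrib]

/-- The form dw_b only sees base components in its undifferentiated slot, and those of w^k are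
-g^{ki}. -/
theorem dForm_wForm_wVec (hZ : IsRegularOn h Z) (hz : z ∈ Z) (b k j : Fin n) :
    dForm (fun y => wForm h y b) z (wVec h k z) (wVec h j z) =
      ∑ i, (gUp h z j i * eW h k (fun y => nonlin h y i b) z -
        gUp h z k i * eW h j (fun y => nonlin h y i b) z) := by
  have e : ∀ k i, (wVec h k z).1 i = - gUp h z k i := by
    intro k i
    rw [fst_eq_hForm h z]
    simp [hForm_wVec, wForm_wVec]
  rw [dForm_wForm hZ hz]
  simp only [e, eW]
  exact Finset.sum_congr rfl fun i _ => by ring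

theorem dForm_wForm_hVec (hZ : IsRegularOn h Z) (hz : z ∈ Z) (b k j : Fin n) :
    dForm (fun y => wForm h y b) z (hVec h k z) (hVec h j z) = curvN h z k j b := by
  rw [dForm_wForm hZ hz]
  simp [hVec, curvN, eH]

theorem dForm_hForm_hVec (hZ : IsRegularOn h Z) (hz : z ∈ Z) (i k j : Fin n) :
    dForm (fun y => hForm h y i) z (hVec h k z) (hVec h j z) =
      ∑ b, gUp h z i b * curvN h z k j b := by
  rw [dForm_hForm hZ hz i (fun b => wForm_hVec h z b k) (fun b => wForm_hVec h z b j)]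
  simp only [dForm_wForm_hVec hZ hz, hZ.gUp_symm hz i]

theorem curvN_antisymm (h : Coord n → ℝ) (z : Coord n) (i j a : Fin n) :
    curvN h z i j a = -curvN h z j i a := by
  simp [curvN]

theorem bTerm_antisymm (h : Coord n → ℝ) (z : Coord n) (m k j : Fin n) :
    bTerm h z m k j = -bTerm h z m j k := by
  simp only [bTerm, ← Finset.sum_neg_distrib]
  exact Finset.sum_congr rfl fun i _ => Finset.sum_congr rfl fun a _ => by ring

theorem fderiv_symm_entry {A : Coord n → Matrix (Fin n) (Fin n) ℝ}
    (hA : ∀ᶠ y in 𝓝 z, ∀ i j, A y i j = A y j i) (i j : Fin n) :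
    fderiv ℝ (fun y => A y i j) z = fderiv ℝ (fun y => A y j i) z :=
  Filter.EventuallyEq.fderiv_eq (hA.mono fun _ hy => hy i j)

/-- The stated formula is the Koszul expression for g_{ij} on the e-frame: the torsion condition
equates the skew part of L with minus the curvature term, and skewness of Ω aligns the remaining
signs. -/
theorem coeffL_eq_koszulCoeff (hZ : IsRegularOn h Z) (hz : z ∈ Z) (i j k : Fin n) :
    coeffL h z i j k = koszulCoeff (gUp h z) (fun k i j => eH h k (fun y => gLow h y i j) z)
      (fun m k j => -curvN h z k j m) i j k := by
  have hs : ∀ i j, fderiv ℝ (fun y => gLow h y i j) z = fderiv ℝ (fun y => gLow h y j i) z :=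
    fderiv_symm_entry ((hZ.eventually hz).mono fun y hy => hZ.gLow_symm hy)
  simp only [coeffL, koszulCoeff, Finset.mul_sum, ← Finset.sum_sub_distrib, eH]
  refine Finset.sum_congr rfl fun m _ => ?_
  rw [curvN_antisymm h z m k j, curvN_antisymm h z m j k, hs m k, hs k j]
  ring

/-- On the w-frame the metric is g^{ab} and its inverse g_{ij}, so the two matrices change roles.
The overall sign reflects that w^b transforms with -C. -/
theorem coeffC_eq_koszulCoeff (hZ : IsRegularOn h Z) (hz : z ∈ Z) (i j k : Fin n) :
    coeffC h z i j k = -koszulCoeff (gLow h z) (fun k i j => eW h k (fun y => gUp h y i j) z)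
      (fun m k j => bTerm h z m k j) i j k := by
  have hs : ∀ i j, fderiv ℝ (fun y => gUp h y i j) z = fderiv ℝ (fun y => gUp h y j i) z :=
    fderiv_symm_entry ((hZ.eventually hz).mono fun y hy => hZ.gUp_symm hy)
  simp only [coeffC, koszulCoeff, Finset.mul_sum, ← Finset.sum_sub_distrib,
    ← Finset.sum_neg_distrib, eW]
  refine Finset.sum_congr rfl fun m _ => ?_
  rw [bTerm_antisymm h z j k m, bTerm_antisymm h z k j m, hs m k, hs k j]
  ring

/-- The connection forms `η^i_j = L^i_{jk} h^k + C_j^{ia} w_a`. -/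
def omegaLoc (h : Coord n → ℝ) (z : Coord n) (i j : Fin n) : Coord n →L[ℝ] ℝ :=
  ∑ k, coeffL h z i j k • hForm h z k + ∑ a, coeffC h z j i a • wForm h z a

theorem omegaLoc_hVec (h : Coord n → ℝ) (z : Coord n) (i j k : Fin n) :
    omegaLoc h z i j (hVec h k z) = coeffL h z i j k := by
  simp [omegaLoc, hForm_hVec, wForm_hVec]

theorem omegaLoc_wVec (h : Coord n → ℝ) (z : Coord n) (i j a : Fin n) :
    omegaLoc h z i j (wVec h a z) = coeffC h z j i a := by
  simp [omegaLoc, hForm_wVec, wForm_wVec]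

/-- The structure equations of the canonical connection, for its connection forms `η^i_j` in the
adapted frame. -/
def IsCanonicalOmega (h : Coord n → ℝ) (z : Coord n)
    (η : Fin n → Fin n → Coord n →L[ℝ] ℝ) : Prop :=
  (∀ i j X, fderiv ℝ (fun y => gLow h y i j) z X =
    ∑ m, η m i X * gLow h z m j + ∑ m, η m j X * gLow h z i m) ∧
  (∀ a b X, fderiv ℝ (fun y => gUp h y a b) z X =
    -∑ m, η a m X * gUp h z m b - ∑ m, η b m X * gUp h z a m) ∧
  (∀ i k j, η i j (hVec h k z) - η i k (hVec h j z) +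
    dForm (fun y => hForm h y i) z (hVec h k z) (hVec h j z) = 0) ∧
  (∀ b k j, -η j b (wVec h k z) + η k b (wVec h j z) +
    dForm (fun y => wForm h y b) z (wVec h k z) (wVec h j z) = 0)

/-- Identifies B with the lowered torsion term of the oblique Koszul problem. Symmetry of N is
needed to match the index being differentiated. -/
theorem sum_gUp_dForm_wForm (hZ : IsRegularOn h Z) (hz : z ∈ Z) (m k j : Fin n) :
    ∑ b, gUp h z m b * dForm (fun y => wForm h y b) z (wVec h k z) (wVec h j z) =
      -bTerm h z m k j := by
  have hs : ∀ i j, fderiv ℝ (fun y => nonlin h y i j) z = fderiv ℝ (fun y => nonlin h y j i) z :=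
    fderiv_symm_entry (A := fun y => Matrix.of (nonlin h y))
      ((hZ.eventually hz).mono fun y hy => hZ.nonlin_symm hy)
  simp only [dForm_wForm_wVec hZ hz, bTerm, ← Finset.sum_neg_distrib, Finset.mul_sum, eW]
  refine Finset.sum_congr rfl fun i _ => Finset.sum_congr rfl fun a _ => ?_
  rw [hs a i]
  ring

/-- A one-form is determined on the frame; on the e_k the Koszul problem for g_{ij} applies, on the
w^a the one for g^{ab}. -/
theorem IsCanonicalOmega.eq_omegaLoc (hZ : IsRegularOn h Z) (hz : z ∈ Z)
    {η : Fin n → Fin n → Coord n →L[ℝ] ℝ} (hη : IsCanonicalOmega h z η) (i j : Fin n) :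
    η i j = omegaLoc h z i j := by
  refine clm_ext_frame h z (fun k => ?_) fun a => ?_
  · rw [omegaLoc_hVec, coeffL_eq_koszulCoeff hZ hz]
    refine eq_koszulCoeff (Γ := fun i j k => η i j (hVec h k z)) (hZ.gUp_mul_gLow hz)
      (hZ.gLow_symm hz) (fun k i j => hη.1 i j _) (fun m k j => ?_) i j k
    have e : ∀ i, η i j (hVec h k z) - η i k (hVec h j z) =
        ∑ b, gUp h z i b * -curvN h z k j b := by
      intro i
      have := hη.2.2.1 i k j
      rw [dForm_hForm_hVec hZ hz] at this
      simp only [mul_neg, Finset.sum_neg_distrib]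
      linarith
    simp only [e]
    exact sum_inverse_mul (hZ.gLow_mul_gUp hz) (fun b => -curvN h z k j b) m
  · rw [omegaLoc_wVec, coeffC_eq_koszulCoeff hZ hz, eq_neg_iff_add_eq_zero, ← neg_eq_zero,
      neg_add, add_comm, neg_add_eq_zero, eq_comm]
    -- The coefficients of D on the w-frame are minus the transpose of η, by duality under θ.
    refine eq_koszulCoeff (Γ := fun i j k => -η j i (wVec h k z)) (hZ.gLow_mul_gUp hz)
      (hZ.gUp_symm hz) (fun k i j => ?_) (fun m k j => ?_) j i a
    · refine (hη.2.1 i j _).trans ?_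
      simp only [neg_mul, Finset.sum_neg_distrib]
      ring
    · rw [← neg_eq_iff_eq_neg.2 (sum_gUp_dForm_wForm hZ hz m k j), ← Finset.sum_neg_distrib]
      refine Finset.sum_congr rfl fun b _ => ?_
      have := hη.2.2.2 b k j
      linear_combination gUp h z m b * this

theorem fderiv_matrix_inverse {A B : Coord n → Matrix (Fin n) (Fin n) ℝ}
    (hA : ∀ i j, DifferentiableAt ℝ (fun y => A y i j) z)
    (hB : ∀ i j, DifferentiableAt ℝ (fun y => B y i j) z)
    (hAB : ∀ᶠ y in 𝓝 z, A y * B y = 1) (hBA : B z * A z = 1) (X : Coord n) :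
    Matrix.of (fun i j => fderiv ℝ (fun y => B y i j) z X) =
      -(B z * Matrix.of (fun i j => fderiv ℝ (fun y => A y i j) z X) * B z) := by
  set dA := Matrix.of (fun i j => fderiv ℝ (fun y => A y i j) z X) with hdA
  set dB := Matrix.of (fun i j => fderiv ℝ (fun y => B y i j) z X) with hdB
  have key : dA * B z + A z * dB = 0 := by
    ext i j
    have h1 : fderiv ℝ (fun y => (A y * B y) i j) z X = 0 := by
      have : (fun y => (A y * B y) i j) =ᶠ[𝓝 z] fun _ => (1 : Matrix (Fin n) (Fin n) ℝ) i j := by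
        filter_upwards [hAB] with y hy
        rw [hy]
      rw [this.fderiv_eq]
      simp
    have h2 : HasFDerivAt (fun y => (A y * B y) i j)
        (∑ k, (A z i k • fderiv ℝ (fun y => B y k j) z +
          B z k j • fderiv ℝ (fun y => A y i k) z)) z := by
      simp only [Matrix.mul_apply]
      exact HasFDerivAt.fun_sum fun k _ => (hA i k).hasFDerivAt.mul (hB k j).hasFDerivAt
    rw [h2.fderiv] at h1
    simp only [Matrix.add_apply, Matrix.mul_apply, Matrix.zero_apply, ← h1]
    simp [hdA, hdB, Finset.sum_add_distrib, mul_comm, add_comm]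
  have h3 : B z * (dA * B z + A z * dB) = 0 := by rw [key, mul_zero]
  rw [mul_add, ← mul_assoc (B z) (A z), hBA, one_mul, ← mul_assoc] at h3
  exact (neg_eq_of_add_eq_zero_right h3).symm

/-- For mutually inverse matrices d(G⁻¹) = -G⁻¹ dG G⁻¹, so multiplying either equation on both sides
by the other matrix gives the other equation. Hence the metric condition on one subbundle implies
that on the other. -/
theorem fderiv_gLow_iff (hZ : IsRegularOn h Z) (hz : z ∈ Z)
    (W : Matrix (Fin n) (Fin n) ℝ) (X : Coord n) :
    (∀ i j, fderiv ℝ (fun y => gLow h y i j) z X =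
      ∑ m, W m i * gLow h z m j + ∑ m, W m j * gLow h z i m) ↔
    (∀ a b, fderiv ℝ (fun y => gUp h y a b) z X =
      -∑ m, W a m * gUp h z m b - ∑ m, W b m * gUp h z a m) := by
  have hdU : ∀ i j, DifferentiableAt ℝ (fun y => gUp h y i j) z := fun i j =>
    (hZ.contDiffAt_gUp hz i j).differentiableAt (by simp)
  have hdL : ∀ i j, DifferentiableAt ℝ (fun y => gLow h y i j) z := fun i j =>
    (hZ.contDiffAt_gLow hz i j).differentiableAt (by simp)
  have hUL := hZ.gUp_mul_gLow hz
  have hLU := hZ.gLow_mul_gUp hz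
  have i1 := fderiv_matrix_inverse hdU hdL
    ((hZ.eventually hz).mono fun y hy => hZ.gUp_mul_gLow hy) hLU X
  have i2 := fderiv_matrix_inverse hdL hdU
    ((hZ.eventually hz).mono fun y hy => hZ.gLow_mul_gUp hy) hUL X
  have eL : (∀ i j, fderiv ℝ (fun y => gLow h y i j) z X =
      ∑ m, W m i * gLow h z m j + ∑ m, W m j * gLow h z i m) ↔
      Matrix.of (fun i j => fderiv ℝ (fun y => gLow h y i j) z X) =
        W.transpose * gLow h z + gLow h z * W := by
    rw [← Matrix.ext_iff]
    simp [Matrix.mul_apply, mul_comm]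
  have eU : (∀ a b, fderiv ℝ (fun y => gUp h y a b) z X =
      -∑ m, W a m * gUp h z m b - ∑ m, W b m * gUp h z a m) ↔
      Matrix.of (fun i j => fderiv ℝ (fun y => gUp h y i j) z X) =
        -(W * gUp h z) - gUp h z * W.transpose := by
    rw [← Matrix.ext_iff]
    simp [Matrix.mul_apply, mul_comm]
  rw [eL, eU]
  constructor
  · intro hL
    rw [i2, hL, mul_add, add_mul, ← mul_assoc, ← mul_assoc, hUL, mul_assoc _ (gLow h z), hLU]
    noncomm_ring
  · intro hU
    rw [i1, hU, mul_sub, sub_mul, mul_neg, ← mul_assoc, ← mul_assoc, hLU, neg_mul,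
      mul_assoc _ (gUp h z), hUL]
    noncomm_ring

theorem isCanonicalOmega_omegaLoc (hZ : IsRegularOn h Z) (hz : z ∈ Z) :
    IsCanonicalOmega h z (omegaLoc h z) := by
  have hsL : ∀ i j, fderiv ℝ (fun y => gLow h y i j) z = fderiv ℝ (fun y => gLow h y j i) z :=
    fderiv_symm_entry ((hZ.eventually hz).mono fun y hy => hZ.gLow_symm hy)
  have hsU : ∀ i j, fderiv ℝ (fun y => gUp h y i j) z = fderiv ℝ (fun y => gUp h y j i) z :=
    fderiv_symm_entry ((hZ.eventually hz).mono fun y hy => hZ.gUp_symm hy)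
  have low_h : ∀ k i j, fderiv ℝ (fun y => gLow h y i j) z (hVec h k z) =
      ∑ m, omegaLoc h z m i (hVec h k z) * gLow h z m j +
        ∑ m, omegaLoc h z m j (hVec h k z) * gLow h z i m := by
    intro k i j
    simp only [omegaLoc_hVec, coeffL_eq_koszulCoeff hZ hz]
    exact koszulCoeff_metric (dG := fun k i j => eH h k (fun y => gLow h y i j) z)
      (hZ.gLow_mul_gUp hz) (hZ.gLow_symm hz)
      (fun k i j => by simp only [eH, hsL i j])
      (fun m k j => by rw [curvN_antisymm]) k i j
  have up_w : ∀ k a b, fderiv ℝ (fun y => gUp h y a b) z (wVec h k z) =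
      -∑ m, omegaLoc h z a m (wVec h k z) * gUp h z m b -
        ∑ m, omegaLoc h z b m (wVec h k z) * gUp h z a m := by
    intro k a b
    simp only [omegaLoc_wVec, coeffC_eq_koszulCoeff hZ hz, neg_mul, Finset.sum_neg_distrib,
      neg_neg, sub_neg_eq_add]
    exact koszulCoeff_metric (dG := fun k i j => eW h k (fun y => gUp h y i j) z)
      (hZ.gUp_mul_gLow hz) (hZ.gUp_symm hz)
      (fun k i j => by simp only [eW, hsU i j])
      (fun m k j => by rw [bTerm_antisymm]) k a b
  -- Koszul solves the equation for g_{ij} only along e_k and the one for g^{ab} only along w^k; the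
  -- equivalence brings the latter back to g_{ij}, so that g_{ij} is treated along the whole frame.
  have low_w := fun k => (fderiv_gLow_iff hZ hz
    (Matrix.of fun i j => omegaLoc h z i j (wVec h k z)) (wVec h k z)).2 (up_w k)
  have low : ∀ i j X, fderiv ℝ (fun y => gLow h y i j) z X =
      ∑ m, omegaLoc h z m i X * gLow h z m j + ∑ m, omegaLoc h z m j X * gLow h z i m := by
    intro i j X
    have : fderiv ℝ (fun y => gLow h y i j) z =
        ∑ m, gLow h z m j • omegaLoc h z m i + ∑ m, gLow h z i m • omegaLoc h z m j := by
      refine clm_ext_frame h z (fun k => ?_) fun k => ?_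
      · rw [low_h]
        simp [mul_comm]
      · rw [low_w]
        simp [mul_comm]
    rw [this]
    simp [mul_comm]
  refine ⟨low, fun a b X => (fderiv_gLow_iff hZ hz
    (Matrix.of fun i j => omegaLoc h z i j X) X).1 (fun i j => low i j X) a b, ?_, ?_⟩
  · intro i k j
    rw [omegaLoc_hVec, omegaLoc_hVec, dForm_hForm_hVec hZ hz, coeffL_eq_koszulCoeff hZ hz,
      coeffL_eq_koszulCoeff hZ hz]
    have := koszulCoeff_torsion (dG := fun k i j => eH h k (fun y => gLow h y i j) z)
      (τ := fun m k j => -curvN h z k j m) (hZ.gLow_mul_gUp hz)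
      (fun k i j => by simp only [eH, hsL i j])
      (fun m k j => by rw [curvN_antisymm])
    rw [← sum_inverse_mul (hZ.gUp_mul_gLow hz) (fun i => koszulCoeff (gUp h z) _ _ i j k -
      koszulCoeff (gUp h z) _ _ i k j) i]
    simp only [this]
    simp
  · intro b k j
    rw [omegaLoc_wVec, omegaLoc_wVec, coeffC_eq_koszulCoeff hZ hz, coeffC_eq_koszulCoeff hZ hz]
    have := koszulCoeff_torsion (dG := fun k i j => eW h k (fun y => gUp h y i j) z)
      (τ := fun m k j => bTerm h z m k j) (hZ.gUp_mul_gLow hz)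
      (fun k i j => by simp only [eW, hsU i j])
      (fun m k j => by rw [bTerm_antisymm])
    have e1 := sum_inverse_mul (hZ.gLow_mul_gUp hz) (fun i => koszulCoeff (gLow h z)
      (fun k i j => eW h k (fun y => gUp h y i j) z) (fun m k j => bTerm h z m k j) i j k -
      koszulCoeff (gLow h z) (fun k i j => eW h k (fun y => gUp h y i j) z)
        (fun m k j => bTerm h z m k j) i k j) b
    have e2 := sum_inverse_mul (hZ.gLow_mul_gUp hz)
      (fun b => dForm (fun y => wForm h y b) z (wVec h k z) (wVec h j z)) b
    simp only [this] at e1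
    simp only [sum_gUp_dForm_wForm hZ hz, mul_neg, Finset.sum_neg_distrib] at e2
    linarith

end LocalConnection

/-! ### The local connection and its properties. -/

section FlatConnection

variable {n : ℕ} {h : Coord n → ℝ} {Z : Set (Coord n)} {z : Coord n}

/-- The connection with connection forms `η^i_j` on the `h`-frame and `-η^c_b` on the `w`-frame. -/
def connLoc (h : Coord n → ℝ) (Y : Coord n → Coord n) (z : Coord n) : Coord n →L[ℝ] Coord n :=
  ∑ i, (fderiv ℝ (fun y => hForm h y i (Y y)) z +
      ∑ j, hForm h z j (Y z) • omegaLoc h z i j).smulRight (hVec h i z) +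
    ∑ b, (fderiv ℝ (fun y => wForm h y b (Y y)) z -
      ∑ c, wForm h z c (Y z) • omegaLoc h z c b).smulRight (wVec h b z)

theorem hForm_connLoc (h : Coord n → ℝ) (Y : Coord n → Coord n) (z X : Coord n) (i : Fin n) :
    hForm h z i (connLoc h Y z X) = fderiv ℝ (fun y => hForm h y i (Y y)) z X +
      ∑ j, hForm h z j (Y z) * omegaLoc h z i j X := by
  simp [connLoc, hForm_hVec, hForm_wVec]

theorem wForm_connLoc (h : Coord n → ℝ) (Y : Coord n → Coord n) (z X : Coord n) (b : Fin n) :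
    wForm h z b (connLoc h Y z X) = fderiv ℝ (fun y => wForm h y b (Y y)) z X -
      ∑ c, wForm h z c (Y z) * omegaLoc h z c b X := by
  simp [connLoc, wForm_hVec, wForm_wVec]

theorem connLoc_congr {Y Y' : Coord n → Coord n} (hY : Y =ᶠ[𝓝 z] Y') :
    connLoc h Y z = connLoc h Y' z := by
  have h1 : ∀ i, fderiv ℝ (fun y => hForm h y i (Y y)) z =
      fderiv ℝ (fun y => hForm h y i (Y' y)) z := fun i =>
    Filter.EventuallyEq.fderiv_eq (hY.mono fun y hy => by simp only [hy])
  have h2 : ∀ i, fderiv ℝ (fun y => wForm h y i (Y y)) z =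
      fderiv ℝ (fun y => wForm h y i (Y' y)) z := fun i =>
    Filter.EventuallyEq.fderiv_eq (hY.mono fun y hy => by simp only [hy])
  simp only [connLoc, h1, h2, hY.eq_of_nhds]

namespace IsRegularOn

variable {Y Y' : Coord n → Coord n}

theorem differentiableAt_hForm_apply (hZ : IsRegularOn h Z) (hz : z ∈ Z)
    (hY : DifferentiableAt ℝ Y z) (i : Fin n) :
    DifferentiableAt ℝ (fun y => hForm h y i (Y y)) z :=
  ((hZ.contDiffAt_hForm hz i).differentiableAt (by simp)).clm_apply hY

theorem differentiableAt_wForm_apply (hZ : IsRegularOn h Z) (hz : z ∈ Z)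
    (hY : DifferentiableAt ℝ Y z) (i : Fin n) :
    DifferentiableAt ℝ (fun y => wForm h y i (Y y)) z :=
  ((hZ.contDiffAt_wForm hz i).differentiableAt (by simp)).clm_apply hY

theorem connLoc_add (hZ : IsRegularOn h Z) (hz : z ∈ Z) (hY : DifferentiableAt ℝ Y z)
    (hY' : DifferentiableAt ℝ Y' z) :
    connLoc h (fun y => Y y + Y' y) z = connLoc h Y z + connLoc h Y' z := by
  refine ContinuousLinearMap.ext fun X => coframe_ext h z (fun i => ?_) fun b => ?_
  · simp only [add_apply, map_add, hForm_connLoc]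
    rw [fderiv_fun_add (hZ.differentiableAt_hForm_apply hz hY i)
      (hZ.differentiableAt_hForm_apply hz hY' i)]
    simp only [add_apply, add_mul, Finset.sum_add_distrib]
    ring
  · simp only [add_apply, map_add, wForm_connLoc]
    rw [fderiv_fun_add (hZ.differentiableAt_wForm_apply hz hY b)
      (hZ.differentiableAt_wForm_apply hz hY' b)]
    simp only [add_apply, add_mul, Finset.sum_add_distrib]
    ring

theorem connLoc_smul (hZ : IsRegularOn h Z) (hz : z ∈ Z) {f : Coord n → ℝ}
    (hf : DifferentiableAt ℝ f z) (hY : DifferentiableAt ℝ Y z) :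
    connLoc h (fun y => f y • Y y) z =
      f z • connLoc h Y z + (fderiv ℝ f z).smulRight (Y z) := by
  refine ContinuousLinearMap.ext fun X => coframe_ext h z (fun i => ?_) fun b => ?_
  · simp only [add_apply, smul_apply, map_add, map_smul,
      ContinuousLinearMap.smulRight_apply, hForm_connLoc, smul_eq_mul]
    rw [fderiv_fun_mul hf (hZ.differentiableAt_hForm_apply hz hY i)]
    simp only [add_apply, smul_apply, smul_eq_mul,
      mul_assoc, ← Finset.mul_sum]
    ring
  · simp only [add_apply, smul_apply, map_add, map_smul,
      ContinuousLinearMap.smulRight_apply, wForm_connLoc, smul_eq_mul]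
    rw [fderiv_fun_mul hf (hZ.differentiableAt_wForm_apply hz hY b)]
    simp only [add_apply, smul_apply, smul_eq_mul,
      mul_assoc, ← Finset.mul_sum]
    ring

theorem contDiffAt_omegaLoc (hZ : IsRegularOn h Z) (hz : z ∈ Z) (i j : Fin n) :
    ContDiffAt ℝ ∞ (fun y => omegaLoc h y i j) z :=
  (ContDiffAt.sum fun k _ => (hZ.contDiffAt_coeffL hz i j k).smul (hZ.contDiffAt_hForm hz k)).add
    (ContDiffAt.sum fun a _ => (hZ.contDiffAt_coeffC hz j i a).smul (hZ.contDiffAt_wForm hz a))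

theorem contDiffAt_connLoc (hZ : IsRegularOn h Z) (hz : z ∈ Z) (hY : ContDiffAt ℝ ∞ Y z) :
    ContDiffAt ℝ ∞ (connLoc h Y) z := by
  have hh : ∀ i, ContDiffAt ℝ ∞ (fun y => hForm h y i (Y y)) z := fun i =>
    (hZ.contDiffAt_hForm hz i).clm_apply hY
  have hw : ∀ i, ContDiffAt ℝ ∞ (fun y => wForm h y i (Y y)) z := fun i =>
    (hZ.contDiffAt_wForm hz i).clm_apply hY
  have h1 : ∀ i, ContDiffAt ℝ ∞ (fun y => fderiv ℝ (fun y => hForm h y i (Y y)) y +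
      ∑ j, hForm h y j (Y y) • omegaLoc h y i j) z := fun i =>
    ((hh i).fderiv_right (m := ∞) (by simp)).add
      (ContDiffAt.sum fun j _ => (hh j).smul (hZ.contDiffAt_omegaLoc hz i j))
  have h2 : ∀ b, ContDiffAt ℝ ∞ (fun y => fderiv ℝ (fun y => wForm h y b (Y y)) y -
      ∑ c, wForm h y c (Y y) • omegaLoc h y c b) z := fun b =>
    ((hw b).fderiv_right (m := ∞) (by simp)).sub
      (ContDiffAt.sum fun c _ => (hw c).smul (hZ.contDiffAt_omegaLoc hz c b))
  exact (ContDiffAt.sum fun i _ => (h1 i).smulRight (hZ.contDiffAt_hVec hz i)).add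
    (ContDiffAt.sum fun b _ => (h2 b).smulRight (hZ.contDiffAt_wVec hz b))

end IsRegularOn

/-- The map φ only changes the sign of the w-components, and no connection form mixes the two
blocks. No differentiability of Y is needed, since negation commutes with `fderiv` in any case. -/
theorem connLoc_phiLoc (h : Coord n → ℝ) (Y : Coord n → Coord n) (z X : Coord n) :
    connLoc h (fun y => phiLoc h y (Y y)) z X = phiLoc h z (connLoc h Y z X) := by
  refine coframe_ext h z (fun i => ?_) fun b => ?_
  · simp only [hForm_connLoc, hForm_phiLoc]
  · simp only [wForm_connLoc, wForm_phiLoc, fderiv_fun_neg, neg_apply, neg_mul,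
      Finset.sum_neg_distrib]
    ring

/-- Product rule for G_{ij} a^i b^j in which the metric equation trades dG for connection terms,
completing da and db to covariant derivatives. The metric equation is only required in the one
direction X, so the derivative is returned together with its value there. -/
theorem hasFDerivAt_sum_matrix {G : Coord n → Matrix (Fin n) (Fin n) ℝ} {a b : Fin n → Coord n → ℝ}
    (hG : ∀ i j, DifferentiableAt ℝ (fun y => G y i j) z) (ha : ∀ i, DifferentiableAt ℝ (a i) z)
    (hb : ∀ i, DifferentiableAt ℝ (b i) z) {X : Coord n} {W : Fin n → Fin n → ℝ}
    (hW : ∀ i j, fderiv ℝ (fun y => G y i j) z X = ∑ m, W m i * G z m j + ∑ m, W m j * G z i m) :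
    ∃ L : Coord n →L[ℝ] ℝ, HasFDerivAt (fun y => ∑ i, ∑ j, G y i j * (a i y * b j y)) L z ∧
      L X = ∑ i, ∑ j, G z i j * ((fderiv ℝ (a i) z X + ∑ m, a m z * W i m) * b j z) +
        ∑ i, ∑ j, G z i j * (a i z * (fderiv ℝ (b j) z X + ∑ m, b m z * W j m)) := by
  refine ⟨_, HasFDerivAt.fun_sum fun i _ => HasFDerivAt.fun_sum fun j _ =>
    (hG i j).hasFDerivAt.mul ((ha i).hasFDerivAt.mul (hb j).hasFDerivAt), ?_⟩
  simp only [sum_apply, add_apply, smul_apply, smul_eq_mul, hW]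
  have s1 : ∑ i, ∑ j, G z i j * ((∑ m, a m z * W i m) * b j z) =
      ∑ i, ∑ j, a i z * b j z * ∑ m, W m i * G z m j := by
    simp only [Finset.mul_sum, Finset.sum_mul]
    rw [Finset.sum_congr rfl fun i _ => Finset.sum_comm, Finset.sum_comm,
      Finset.sum_congr rfl fun i _ => Finset.sum_comm]
    exact Finset.sum_congr rfl fun i _ => Finset.sum_congr rfl fun j _ =>
      Finset.sum_congr rfl fun k _ => by ring
  have s2 : ∑ i, ∑ j, G z i j * (a i z * ∑ m, b m z * W j m) =
      ∑ i, ∑ j, a i z * b j z * ∑ m, W m j * G z i m := by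
    simp only [Finset.mul_sum]
    rw [Finset.sum_congr rfl fun i _ => Finset.sum_comm]
    exact Finset.sum_congr rfl fun i _ => Finset.sum_congr rfl fun j _ =>
      Finset.sum_congr rfl fun k _ => by ring
  simp only [mul_add, add_mul, Finset.sum_add_distrib, mul_comm (b _ z) (fderiv ℝ _ z X)] at s1 s2 ⊢
  linarith

/-- The pairing of a frame with its dual is constant: the terms with W and with its negative
transpose cancel, so they may be inserted freely. -/
theorem hasFDerivAt_sum_mul {a b : Fin n → Coord n → ℝ} (ha : ∀ i, DifferentiableAt ℝ (a i) z)
    (hb : ∀ i, DifferentiableAt ℝ (b i) z) (X : Coord n) (W : Fin n → Fin n → ℝ) :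
    ∃ L : Coord n →L[ℝ] ℝ, HasFDerivAt (fun y => ∑ i, a i y * b i y) L z ∧
      L X = ∑ i, (fderiv ℝ (a i) z X + ∑ m, a m z * W i m) * b i z +
        ∑ i, a i z * (fderiv ℝ (b i) z X - ∑ m, b m z * W m i) := by
  refine ⟨_, HasFDerivAt.fun_sum fun i _ => (ha i).hasFDerivAt.mul (hb i).hasFDerivAt, ?_⟩
  simp only [sum_apply, add_apply, smul_apply, smul_eq_mul]
  have s1 : ∑ i, (∑ m, a m z * W i m) * b i z = ∑ i, a i z * ∑ m, b m z * W m i := by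
    simp only [Finset.mul_sum, Finset.sum_mul]
    rw [Finset.sum_comm]
    exact Finset.sum_congr rfl fun i _ => Finset.sum_congr rfl fun j _ => by ring
  simp only [add_mul, mul_sub, Finset.sum_add_distrib, Finset.sum_sub_distrib,
    mul_comm (b _ z) (fderiv ℝ _ z X)] at s1 ⊢
  linarith

namespace IsRegularOn

variable {Y Y' : Coord n → Coord n}

/-- In the adapted coframe θ is a difference of two dual pairings, each of which is parallel. -/
theorem connLoc_thetaLoc (hZ : IsRegularOn h Z) (hz : z ∈ Z) (hY : DifferentiableAt ℝ Y z)
    (hY' : DifferentiableAt ℝ Y' z) (X : Coord n) :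
    fderiv ℝ (fun y => thetaLoc n (Y y) (Y' y)) z X =
      thetaLoc n (connLoc h Y z X) (Y' z) + thetaLoc n (Y z) (connLoc h Y' z X) := by
  have e : (fun y => thetaLoc n (Y y) (Y' y)) =ᶠ[𝓝 z] fun y =>
      ∑ i, hForm h y i (Y' y) * wForm h y i (Y y) -
        ∑ i, hForm h y i (Y y) * wForm h y i (Y' y) :=
    (hZ.eventually hz).mono fun y hy => by
      simp only [thetaLoc_eq hZ hy, Finset.sum_sub_distrib, mul_comm]
  have dh := hZ.differentiableAt_hForm_apply hz hY
  have dh' := hZ.differentiableAt_hForm_apply hz hY'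
  have dw := hZ.differentiableAt_wForm_apply hz hY
  have dw' := hZ.differentiableAt_wForm_apply hz hY'
  obtain ⟨L, hL, eL⟩ := hasFDerivAt_sum_mul dh' dw X fun i j => omegaLoc h z i j X
  obtain ⟨L', hL', eL'⟩ := hasFDerivAt_sum_mul dh dw' X fun i j => omegaLoc h z i j X
  rw [e.fderiv_eq, (hL.fun_sub hL').fderiv, thetaLoc_eq hZ hz, thetaLoc_eq hZ hz, sub_apply, eL, eL']
  simp only [hForm_connLoc, wForm_connLoc, Finset.sum_sub_distrib, mul_comm (wForm h z _ (Y z)),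
    mul_comm (hForm h z _ (Y' z))]
  ring

/-- The two diagonal blocks are parallel by the structure equations of `omegaLoc`, the mixed block
because it is a dual pairing. -/
theorem connLoc_metricLoc (hZ : IsRegularOn h Z) (hz : z ∈ Z) (hY : DifferentiableAt ℝ Y z)
    (hY' : DifferentiableAt ℝ Y' z) (X : Coord n) :
    fderiv ℝ (fun y => metricLoc h y (Y y) (Y' y)) z X =
      metricLoc h z (connLoc h Y z X) (Y' z) + metricLoc h z (Y z) (connLoc h Y' z X) := by
  have hη := isCanonicalOmega_omegaLoc hZ hz
  have e : (fun y => metricLoc h y (Y y) (Y' y)) =ᶠ[𝓝 z] fun y =>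
      ∑ i, ∑ j, gLow h y i j * (hForm h y i (Y y) * hForm h y j (Y' y)) +
      2 * ∑ a, ∑ b, gUp h y a b * (wForm h y a (Y y) * wForm h y b (Y' y)) -
      (∑ i, hForm h y i (Y y) * wForm h y i (Y' y) +
        ∑ i, hForm h y i (Y' y) * wForm h y i (Y y)) :=
    (hZ.eventually hz).mono fun y hy => by
      simp only [metricLoc_eq hZ hy, Finset.sum_add_distrib, mul_comm]
  have dh := hZ.differentiableAt_hForm_apply hz hY
  have dh' := hZ.differentiableAt_hForm_apply hz hY'
  have dw := hZ.differentiableAt_wForm_apply hz hY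
  have dw' := hZ.differentiableAt_wForm_apply hz hY'
  obtain ⟨L, hL, eL⟩ := hasFDerivAt_sum_mul dh' dw X fun i j => omegaLoc h z i j X
  obtain ⟨L', hL', eL'⟩ := hasFDerivAt_sum_mul dh dw' X fun i j => omegaLoc h z i j X
  obtain ⟨Ll, hLl, eLl⟩ := hasFDerivAt_sum_matrix
    (fun i j => (hZ.contDiffAt_gLow hz i j).differentiableAt (by simp)) dh dh'
    (fun i j => hη.1 i j X)
  obtain ⟨Lu, hLu, eLu⟩ := hasFDerivAt_sum_matrix
    (W := fun i j => -omegaLoc h z j i X)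
    (fun i j => (hZ.contDiffAt_gUp hz i j).differentiableAt (by simp)) dw dw'
    (fun i j => by
      rw [hη.2.1 i j X]
      simp only [neg_mul, Finset.sum_neg_distrib]
      ring)
  simp only [mul_neg, Finset.sum_neg_distrib, ← sub_eq_add_neg, ← hForm_connLoc,
    ← wForm_connLoc] at eL eL' eLl eLu
  rw [e.fderiv_eq, ((hLl.fun_add (hLu.const_mul 2)).fun_sub (hL'.fun_add hL)).fderiv,
    metricLoc_eq hZ hz, metricLoc_eq hZ hz]
  simp only [sub_apply, add_apply, smul_apply, smul_eq_mul, eL, eL', eLl, eLu]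
  simp only [Finset.sum_add_distrib, mul_comm]
  ring

end IsRegularOn

theorem frame_expand_of_wForm {X : Coord n} (hX : ∀ b, wForm h z b X = 0) :
    X = ∑ i, hForm h z i X • hVec h i z := by
  simpa [hX] using frame_decomp h z X

theorem frame_expand_of_hForm {X : Coord n} (hX : ∀ i, hForm h z i X = 0) :
    X = ∑ b, wForm h z b X • wVec h b z := by
  simpa [hX] using frame_decomp h z X

theorem bilin_eq_zero {B : Coord n →ₗ[ℝ] Coord n →ₗ[ℝ] ℝ} {e : Fin n → Coord n}
    (hB : ∀ i j, B (e i) (e j) = 0) (x y : Fin n → ℝ) :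
    B (∑ i, x i • e i) (∑ i, y i • e i) = 0 := by
  simp [hB]

/-- The bilinear form `(X, Y) ↦ ∑ (α_j(Y) η_j(X) - α_j(X) η_j(Y)) + dβ(X, Y)`. -/
def torsionForm (α η : Fin n → Coord n →L[ℝ] ℝ) (β : Coord n → Coord n →L[ℝ] ℝ) (z : Coord n) :
    Coord n →ₗ[ℝ] Coord n →ₗ[ℝ] ℝ :=
  LinearMap.mk₂ ℝ (fun X Y => ∑ j, (α j Y * η j X - α j X * η j Y) + dForm β z X Y)
    (fun X X' Y => by
      simp only [dForm, map_add, add_apply, mul_add, add_mul, Finset.sum_add_distrib,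
        Finset.sum_sub_distrib]
      ring)
    (fun c X Y => by
      simp only [dForm, map_smul, smul_apply, smul_eq_mul, mul_add, Finset.mul_sum, mul_sub]
      congr 1
      exact Finset.sum_congr rfl fun _ _ => by ring)
    (fun X Y Y' => by
      simp only [dForm, map_add, add_apply, mul_add, add_mul, Finset.sum_add_distrib,
        Finset.sum_sub_distrib]
      ring)
    (fun c X Y => by
      simp only [dForm, map_smul, smul_apply, smul_eq_mul, mul_add, Finset.mul_sum, mul_sub]
      congr 1
      exact Finset.sum_congr rfl fun _ _ => by ring)

theorem torsionForm_apply (α η : Fin n → Coord n →L[ℝ] ℝ) (β : Coord n → Coord n →L[ℝ] ℝ)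
    (z X Y : Coord n) : torsionForm α η β z X Y =
      ∑ j, (α j Y * η j X - α j X * η j Y) + dForm β z X Y := rfl

/-- By Cartan's formula the h-component of the torsion is the bilinear form `torsionForm` at z. It
suffices to test it on the e_k, where it is a structure equation. -/
theorem hForm_torsion (hZ : IsRegularOn h Z) (hz : z ∈ Z) {X Y : Coord n → Coord n}
    (hX : DifferentiableAt ℝ X z) (hY : DifferentiableAt ℝ Y z)
    (hX0 : ∀ b, wForm h z b (X z) = 0) (hY0 : ∀ b, wForm h z b (Y z) = 0) (i : Fin n) :
    hForm h z i (connLoc h Y z (X z) - connLoc h X z (Y z) -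
      VectorField.lieBracket ℝ X Y z) = 0 := by
  have e := dForm_eq_lieBracket ((hZ.contDiffAt_hForm hz i).differentiableAt (by simp)) hX hY
  have hB := bilin_eq_zero (B := torsionForm (hForm h z) (omegaLoc h z i) (fun y => hForm h y i) z)
    (e := fun k => hVec h k z) (fun k j => by
      have := (isCanonicalOmega_omegaLoc hZ hz).2.2.1 i k j
      simp only [torsionForm_apply, hForm_hVec, Finset.sum_sub_distrib]
      simpa using this) (fun k => hForm h z k (X z)) (fun k => hForm h z k (Y z))
  simp only [← frame_expand_of_wForm hX0, ← frame_expand_of_wForm hY0, torsionForm_apply,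
    Finset.sum_sub_distrib] at hB
  simp only [map_sub, hForm_connLoc]
  linarith

theorem wForm_torsion (hZ : IsRegularOn h Z) (hz : z ∈ Z) {X Y : Coord n → Coord n}
    (hX : DifferentiableAt ℝ X z) (hY : DifferentiableAt ℝ Y z)
    (hX0 : ∀ i, hForm h z i (X z) = 0) (hY0 : ∀ i, hForm h z i (Y z) = 0) (b : Fin n) :
    wForm h z b (connLoc h Y z (X z) - connLoc h X z (Y z) -
      VectorField.lieBracket ℝ X Y z) = 0 := by
  have e := dForm_eq_lieBracket ((hZ.contDiffAt_wForm hz b).differentiableAt (by simp)) hX hY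
  have hB := bilin_eq_zero
    (B := torsionForm (wForm h z) (fun c => -omegaLoc h z c b) (fun y => wForm h y b) z)
    (e := fun k => wVec h k z) (fun k j => by
      have := (isCanonicalOmega_omegaLoc hZ hz).2.2.2 b k j
      simp only [torsionForm_apply, wForm_wVec, Finset.sum_sub_distrib]
      simpa using this) (fun k => wForm h z k (X z)) (fun k => wForm h z k (Y z))
  simp only [← frame_expand_of_hForm hX0, ← frame_expand_of_hForm hY0, torsionForm_apply,
    Finset.sum_sub_distrib, neg_apply, mul_neg, Finset.sum_neg_distrib] at hB
  simp only [map_sub, wForm_connLoc]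
  linarith

end FlatConnection

/-! ### Coordinate-free characterisations of J, the vertical projection, φ and the metric. -/

section Intrinsic

variable {n : ℕ} {h : Coord n → ℝ} {Z : Set (Coord n)} {z : Coord n}

/-- The tautological form `p_i dx^i` in coordinates. -/
def lamLoc (z : Coord n) : Coord n →L[ℝ] ℝ := ∑ i, z.2 i • dxForm i

theorem lamLoc_apply (z X : Coord n) : lamLoc z X = ∑ i, z.2 i * X.1 i := by
  simp [lamLoc, dxForm_apply]

theorem contDiffAt_lamLoc : ContDiffAt ℝ ∞ (lamLoc (n := n)) z := by
  unfold lamLoc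
  fun_prop

theorem dForm_lamLoc (X Y : Coord n) : dForm lamLoc z X Y = thetaLoc n X Y := by
  have e : ∀ X Y : Coord n, fderiv ℝ lamLoc z X Y = ∑ i, X.2 i * Y.1 i := by
    intro X Y
    rw [fderiv_form_apply (contDiffAt_lamLoc.differentiableAt (by simp))]
    simp only [lamLoc_apply]
    have : HasFDerivAt (fun y : Coord n => ∑ i, y.2 i * Y.1 i) (∑ i, Y.1 i • dpForm i) z :=
      HasFDerivAt.fun_sum fun i _ => (dpForm i).hasFDerivAt.mul_const (Y.1 i)
    rw [this.fderiv]
    simp [dpForm_apply, mul_comm]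
  rw [dForm, e, e, thetaLoc_apply, Finset.sum_sub_distrib]
  congr 1
  exact Finset.sum_congr rfl fun i _ => mul_comm _ _

/-- Non-degeneracy of θ, tested on the coordinate vectors; used to see that the Hamilton field is
intrinsic. -/
theorem eq_of_thetaLoc {X X' : Coord n} (hX : ∀ Y, thetaLoc n X Y = thetaLoc n X' Y) :
    X = X' := by
  refine Prod.ext ?_ ?_
  · ext i
    have := hX (0, Pi.single i 1)
    simpa [thetaLoc_apply, Pi.single_apply] using this
  · ext i
    have := hX (EuclideanSpace.single i 1, 0)
    simpa [thetaLoc_apply, Pi.single_apply] using this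

theorem fderiv_eq_sum (f : Coord n → ℝ) (z X : Coord n) :
    fderiv ℝ f z X = ∑ i, X.1 i * dX i f z + ∑ a, X.2 a * dP a f z := by
  have h1 : X = ∑ i, X.1 i • ((EuclideanSpace.single i 1, 0) : Coord n) +
      ∑ a, X.2 a • ((0, Pi.single a 1) : Coord n) := by
    refine Prod.ext ?_ ?_
    · ext i
      simp [Prod.fst_sum, Finset.sum_apply, Pi.single_apply]
    · ext i
      simp [Prod.snd_sum, Finset.sum_apply, Pi.single_apply]
  conv_lhs => rw [h1]
  simp only [map_add, map_sum, map_smul, smul_eq_mul, dX, dP]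

/-- The Hamilton vector field in coordinates. -/
def hamLoc (h : Coord n → ℝ) (z : Coord n) : Coord n :=
  (WithLp.toLp 2 fun i => dP i h z, fun i => -dX i h z)

theorem thetaLoc_hamLoc (h : Coord n → ℝ) (z Y : Coord n) :
    thetaLoc n (hamLoc h z) Y = -fderiv ℝ h z Y := by
  rw [thetaLoc_apply, fderiv_eq_sum, neg_add, ← Finset.sum_neg_distrib, ← Finset.sum_neg_distrib,
    ← Finset.sum_add_distrib]
  exact Finset.sum_congr rfl fun i _ => by simp only [hamLoc]; ring

/-- The almost tangent structure `g_{ij} dx^i ⊗ ∂/∂p_j` in coordinates. -/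
def tanLoc (h : Coord n → ℝ) (z X : Coord n) : Coord n :=
  (0, fun a => ∑ j, gLow h z a j * X.1 j)

/-- The projection to the vertical bundle along the horizontal bundle, in coordinates. -/
def vertLoc (h : Coord n → ℝ) (z X : Coord n) : Coord n := (0, fun a => wForm h z a X)

theorem lieBracket_fst {X Y : Coord n → Coord n} (hX : DifferentiableAt ℝ X z)
    (hY : DifferentiableAt ℝ Y z) (i : Fin n) :
    (VectorField.lieBracket ℝ X Y z).1 i =
      fderiv ℝ (fun y => (Y y).1 i) z (X z) - fderiv ℝ (fun y => (X y).1 i) z (Y z) := by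
  have := dForm_eq_lieBracket (differentiableAt_const (dxForm (n := n) i)) hX hY
  simp only [dForm, dxForm_apply, fderiv_fun_const, Pi.zero_apply, zero_apply, sub_zero] at this
  linarith

theorem lieBracket_snd {X Y : Coord n → Coord n} (hX : DifferentiableAt ℝ X z)
    (hY : DifferentiableAt ℝ Y z) (i : Fin n) :
    (VectorField.lieBracket ℝ X Y z).2 i =
      fderiv ℝ (fun y => (Y y).2 i) z (X z) - fderiv ℝ (fun y => (X y).2 i) z (Y z) := by
  have := dForm_eq_lieBracket (differentiableAt_const (dpForm (n := n) i)) hX hY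
  simp only [dForm, dpForm_apply, fderiv_fun_const, Pi.zero_apply, zero_apply, sub_zero] at this
  linarith

namespace IsRegularOn

theorem contDiffAt_hamLoc (hZ : IsRegularOn h Z) (hz : z ∈ Z) : ContDiffAt ℝ ∞ (hamLoc h) z := by
  refine ContDiffAt.prodMk ?_ (contDiffAt_pi.2 fun i => (contDiffAt_dX (hZ.smooth z hz) i).neg)
  exact (contDiffAt_piLp 2).2 fun i => contDiffAt_dP (hZ.smooth z hz) i

theorem differentiableAt_tanLoc (hZ : IsRegularOn h Z) (hz : z ∈ Z) {X : Coord n → Coord n}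
    (hX : DifferentiableAt ℝ X z) : DifferentiableAt ℝ (fun y => tanLoc h y (X y)) z := by
  refine (differentiableAt_const _).prodMk (differentiableAt_pi.2 fun a => ?_)
  refine DifferentiableAt.fun_sum fun j _ =>
    ((hZ.contDiffAt_gLow hz a j).differentiableAt (by simp)).mul ?_
  exact (dxForm j).differentiableAt.comp z hX

/-- The base component of S is ∂H/∂p_i, whose derivative along a vertical vector is the Hessian.
This recovers g^{ab} from a bracket. -/
theorem lieBracket_hamLoc_vertical (hZ : IsRegularOn h Z) (hz : z ∈ Z) {V : Coord n → Coord n}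
    (hV : DifferentiableAt ℝ V z) (hV0 : ∀ᶠ y in 𝓝 z, (V y).1 = 0) (i : Fin n) :
    (VectorField.lieBracket ℝ (hamLoc h) V z).1 i = -∑ b, gUp h z i b * (V z).2 b := by
  have e : (fun y => (V y).1 i) =ᶠ[𝓝 z] fun _ => 0 := hV0.mono fun y hy => by simp [hy]
  rw [lieBracket_fst ((hZ.contDiffAt_hamLoc hz).differentiableAt (by simp)) hV, e.fderiv_eq]
  simp only [hamLoc, fderiv_eq_sum _ _ (V z), hV0.self_of_nhds, hZ.gUp_symm hz i]
  simp [gUp, mul_comm]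

theorem tanLoc_lieBracket (hZ : IsRegularOn h Z) (hz : z ∈ Z) {V : Coord n → Coord n}
    (hV : DifferentiableAt ℝ V z) (hV0 : ∀ᶠ y in 𝓝 z, (V y).1 = 0) :
    tanLoc h z (VectorField.lieBracket ℝ (hamLoc h) V z) = -V z := by
  refine Prod.ext (by simp [tanLoc, hV0.self_of_nhds]) ?_
  ext a
  simp only [tanLoc, hZ.lieBracket_hamLoc_vertical hz hV hV0, mul_neg, Finset.sum_neg_distrib]
  rw [sum_inverse_mul (hZ.gLow_mul_gUp hz)]
  rfl

/-- The Lie derivative of J along S, up to the identity, is twice the vertical projection. The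
formula for N is exactly what this identity requires, and with it the horizontal bundle is seen not
to depend on the chart. -/
theorem lieBracket_tanLoc (hZ : IsRegularOn h Z) (hz : z ∈ Z) {X : Coord n → Coord n}
    (hX : DifferentiableAt ℝ X z) :
    VectorField.lieBracket ℝ (hamLoc h) (fun y => tanLoc h y (X y)) z -
      tanLoc h z (VectorField.lieBracket ℝ (hamLoc h) X z) + X z = (2 : ℝ) • vertLoc h z (X z) := by
  have hS := (hZ.contDiffAt_hamLoc hz).differentiableAt (n := ∞) (by simp)
  have hJ := hZ.differentiableAt_tanLoc hz hX
  have hg : ∀ a j, DifferentiableAt ℝ (fun y => gLow h y a j) z := fun a j =>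
    (hZ.contDiffAt_gLow hz a j).differentiableAt (by simp)
  have hXj : ∀ j, DifferentiableAt ℝ (fun y => (X y).1 j) z := fun j =>
    (dxForm j).differentiableAt.comp z hX
  have hUp : ∀ i b, dP b (dP i h) z = gUp h z i b := fun i b => (hZ.gUp_symm hz i b).symm ▸ rfl
  refine Prod.ext ?_ ?_
  · ext i
    simp only [Prod.fst_add, Prod.fst_sub, PiLp.add_apply, PiLp.sub_apply]
    rw [hZ.lieBracket_hamLoc_vertical hz hJ (Eventually.of_forall fun y => rfl)]
    simp only [tanLoc]
    rw [sum_inverse_mul (hZ.gUp_mul_gLow hz)]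
    simp [vertLoc]
  · ext a
    have d : fderiv ℝ (fun y => ∑ j, gLow h y a j * (X y).1 j) z (hamLoc h z) =
        ∑ j, (gLow h z a j * fderiv ℝ (fun y => (X y).1 j) z (hamLoc h z) +
          (X z).1 j * fderiv ℝ (fun y => gLow h y a j) z (hamLoc h z)) := by
      rw [(HasFDerivAt.fun_sum (u := Finset.univ) fun j _ =>
        (hg a j).hasFDerivAt.fun_mul (hXj j).hasFDerivAt).fderiv]
      simp
    have e1 : fderiv ℝ (fun y => (hamLoc h y).2 a) z (tanLoc h z (X z)) =
        -∑ b, (∑ j, gLow h z b j * (X z).1 j) * dP b (dX a h) z := by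
      simp only [hamLoc, fderiv_fun_neg, neg_apply, fderiv_eq_sum _ _ (tanLoc h z (X z))]
      simp [tanLoc]
    have e2 : ∀ j, fderiv ℝ (fun y => (hamLoc h y).1 j) z (X z) =
        ∑ i, (X z).1 i * dP j (dX i h) z + ∑ b, gUp h z j b * (X z).2 b := by
      intro j
      have : ∀ i, dX i (dP j h) z = dP j (dX i h) z := fun i =>
        fderiv_fderiv_apply_const (hZ.smooth z hz) _ _
      simp only [hamLoc, fderiv_eq_sum _ _ (X z)]
      simp [this, hUp, mul_comm]
    -- With the sign convention of `poisson`, differentiating along S is bracketing with the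
    -- Hamilton function up to sign.
    have e3 : ∀ i, fderiv ℝ (fun y => gLow h y i a) z (hamLoc h z) =
        - poisson (fun y => gLow h y i a) h z := by
      intro i
      rw [fderiv_eq_sum, ← Finset.sum_add_distrib, poisson, ← Finset.sum_neg_distrib]
      exact Finset.sum_congr rfl fun i _ => by simp only [hamLoc]; ring
    have e4 : ∑ j, gLow h z a j * fderiv ℝ (fun y => (hamLoc h y).1 j) z (X z) =
        ∑ j, ∑ i, gLow h z a j * ((X z).1 i * dP j (dX i h) z) + (X z).2 a := by
      rw [← sum_inverse_mul (hZ.gLow_mul_gUp hz) (X z).2 a, ← Finset.sum_add_distrib]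
      refine Finset.sum_congr rfl fun j _ => ?_
      rw [e2, mul_add, Finset.mul_sum]
    simp only [Prod.snd_add, Prod.snd_sub, Pi.add_apply, Pi.sub_apply]
    rw [lieBracket_snd hS hJ]
    simp only [tanLoc, lieBracket_fst hS hX, vertLoc, Prod.smul_snd, Pi.smul_apply, smul_eq_mul,
      wForm_apply] at e1 ⊢
    rw [d, e1]
    simp only [nonlin]
    have hs : ∀ i, fderiv ℝ (fun y => gLow h y i a) z = fderiv ℝ (fun y => gLow h y a i) z :=
      fun i => fderiv_symm_entry ((hZ.eventually hz).mono fun y hy => hZ.gLow_symm hy) i a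
    -- The fibre component of the Lie derivative of J consists of three sums, coming from dg_{ij},
    -- from the base part of [S,X] and from [S,JX]; together they are -2 N_{ia} X^i.
    have e5 : ∑ i, 1 / 2 * (poisson (fun y => gLow h y i a) h z -
        ∑ k, (dP k (dX i h) z * gLow h z a k + dP k (dX a h) z * gLow h z i k)) * (X z).1 i =
        -(1 / 2) * (∑ j, (X z).1 j * fderiv ℝ (fun y => gLow h y a j) z (hamLoc h z) +
          ∑ j, ∑ i, gLow h z a j * ((X z).1 i * dP j (dX i h) z) +
          ∑ b, (∑ j, gLow h z b j * (X z).1 j) * dP b (dX a h) z) := by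
      simp only [Finset.sum_mul]
      rw [Finset.sum_comm, Finset.sum_comm (f := fun b j => gLow h z b j * (X z).1 j * _),
        ← Finset.sum_add_distrib, ← Finset.sum_add_distrib, Finset.mul_sum]
      refine Finset.sum_congr rfl fun i _ => ?_
      rw [← hs, e3, Finset.sum_add_distrib]
      have c1 : ∑ k, dP k (dX i h) z * gLow h z a k * (X z).1 i =
          ∑ k, gLow h z a k * ((X z).1 i * dP k (dX i h) z) :=
        Finset.sum_congr rfl fun k _ => by ring
      have c2 : ∑ k, dP k (dX a h) z * gLow h z i k * (X z).1 i =
          ∑ k, gLow h z k i * (X z).1 i * dP k (dX a h) z :=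
        Finset.sum_congr rfl fun k _ => by rw [hZ.gLow_symm hz i k]; ring
      rw [← c1, ← c2, ← Finset.sum_mul, ← Finset.sum_mul]
      ring
    rw [e5]
    simp only [mul_sub, Finset.sum_sub_distrib, e4, Finset.sum_add_distrib]
    ring

/-- Since φX = X - 2 w_b(X) w^b, the vector φX - X + 2 vX is 2 g^{bi} w_b(X) e_i: the only
horizontal vector with J-image 2 vX. Thus φ is defined by v and J alone. -/
theorem eq_phiLoc_iff (hZ : IsRegularOn h Z) (hz : z ∈ Z) (X Y : Coord n) :
    Y = phiLoc h z X ↔ vertLoc h z (Y - X + (2 : ℝ) • vertLoc h z X) = 0 ∧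
      tanLoc h z (Y - X + (2 : ℝ) • vertLoc h z X) = (2 : ℝ) • vertLoc h z X := by
  have ew : ∀ Y b, wForm h z b (Y - X + (2 : ℝ) • vertLoc h z X) =
      wForm h z b Y + wForm h z b X := by
    intro Y b
    have : wForm h z b (vertLoc h z X) = wForm h z b X := by
      rw [wForm_apply]
      simp [vertLoc]
    rw [map_add, map_sub, map_smul, this, smul_eq_mul]
    ring
  have ef : ∀ Y i, (Y - X + (2 : ℝ) • vertLoc h z X).1 i = Y.1 i - X.1 i := by
    intro Y i
    simp [vertLoc]
  have et : (∀ a, ∑ j, gLow h z a j * (Y.1 j - X.1 j) = 2 * wForm h z a X) ↔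
      ∀ a, Y.1 a - X.1 a = ∑ b, gUp h z a b * (2 * wForm h z b X) := by
    constructor
    · intro H a
      simp only [← H]
      exact (sum_inverse_mul (hZ.gUp_mul_gLow hz) (fun j => Y.1 j - X.1 j) a).symm
    · intro H a
      simp only [H]
      exact sum_inverse_mul (hZ.gLow_mul_gUp hz) _ a
  have e1 : vertLoc h z (Y - X + (2 : ℝ) • vertLoc h z X) = 0 ↔
      ∀ b, wForm h z b Y + wForm h z b X = 0 := by
    have : ∀ W, vertLoc h z W = 0 ↔ ∀ b, wForm h z b W = 0 := fun W => by
      simp [vertLoc, Prod.ext_iff, funext_iff]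
    simp only [this, ew]
  have e2 : tanLoc h z (Y - X + (2 : ℝ) • vertLoc h z X) = (2 : ℝ) • vertLoc h z X ↔
      ∀ a, ∑ j, gLow h z a j * (Y.1 j - X.1 j) = 2 * wForm h z a X := by
    simp only [tanLoc, ef]
    simp [vertLoc, Prod.ext_iff, funext_iff]
  rw [e1, e2, et]
  constructor
  · rintro rfl
    refine ⟨fun b => by rw [wForm_phiLoc]; ring, fun a => ?_⟩
    rw [fst_eq_hForm h z, fst_eq_hForm h z X, hForm_phiLoc]
    simp only [wForm_phiLoc, hZ.gUp_symm hz a, mul_neg, Finset.sum_neg_distrib, mul_left_comm _ (2 : ℝ),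
      ← Finset.mul_sum]
    ring
  · rintro ⟨h1, h2⟩
    have h3 : ∀ b, wForm h z b Y = -wForm h z b X := fun b => eq_neg_of_add_eq_zero_left (h1 b)
    refine coframe_ext h z (fun i => ?_) fun b => by rw [wForm_phiLoc, h3]
    have := h2 i
    rw [hForm_phiLoc, hForm_apply, hForm_apply]
    simp only [h3, hZ.gUp_symm hz i, mul_neg, Finset.sum_neg_distrib, mul_left_comm _ (2 : ℝ),
      ← Finset.mul_sum] at this ⊢
    linarith

/-- Pairing JX with Y by θ gives the block g_{ij}. The vector ½(φX - X) + vX has base part g^{ib}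
w_b(X), so its pairing with vY gives the block g^{ab} with a minus sign. -/
theorem metricLoc_eq_thetaLoc (hZ : IsRegularOn h Z) (hz : z ∈ Z) (X Y : Coord n) :
    metricLoc h z X Y = thetaLoc n (tanLoc h z X) Y -
      thetaLoc n ((1 / 2 : ℝ) • (phiLoc h z X - X) + vertLoc h z X) (vertLoc h z Y) := by
  have e : ∀ i, ((1 / 2 : ℝ) • (phiLoc h z X - X) + vertLoc h z X).1 i =
      ∑ b, gUp h z i b * wForm h z b X := by
    intro i
    have h1 := fst_eq_hForm h z (phiLoc h z X) i
    have h2 := fst_eq_hForm h z X i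
    simp only [hForm_phiLoc, wForm_phiLoc, mul_neg, Finset.sum_neg_distrib] at h1
    simp only [Prod.fst_add, Prod.smul_fst, Prod.fst_sub, PiLp.add_apply, PiLp.smul_apply,
      PiLp.sub_apply, smul_eq_mul, vertLoc, PiLp.zero_apply, hZ.gUp_symm hz i]
    linarith
  rw [metricLoc_apply, thetaLoc_apply, thetaLoc_apply]
  simp only [e]
  have e1 : ∑ i, ∑ j, gLow h z i j * (X.1 i * Y.1 j) =
      ∑ j, (∑ i, gLow h z j i * X.1 i) * Y.1 j := by
    rw [Finset.sum_comm]
    refine Finset.sum_congr rfl fun j _ => ?_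
    rw [Finset.sum_mul]
    exact Finset.sum_congr rfl fun i _ => by rw [hZ.gLow_symm hz i j]; ring
  have e2 : ∑ a, ∑ b, gUp h z a b * (wForm h z a X * wForm h z b Y) =
      ∑ b, (∑ a, gUp h z b a * wForm h z a X) * wForm h z b Y := by
    rw [Finset.sum_comm]
    refine Finset.sum_congr rfl fun j _ => ?_
    rw [Finset.sum_mul]
    exact Finset.sum_congr rfl fun i _ => by rw [hZ.gUp_symm hz i j]; ring
  rw [e1, e2]
  simp [tanLoc, vertLoc]

end IsRegularOn

end Intrinsic

section SlitTarget

variable {n : ℕ} {M : Type*} [TopologicalSpace M] {e : OpenPartialHomeomorph M (Base n)}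

/-- The image of the slit cotangent bundle in a natural chart. -/
def slitTarget (e : OpenPartialHomeomorph M (Base n)) : Set (Coord n) :=
  {z | z.1 ∈ e.target ∧ z.2 ≠ 0}

theorem isOpen_slitTarget : IsOpen (slitTarget e) :=
  (e.open_target.preimage continuous_fst).inter
    ((isOpen_compl_singleton (x := (0 : Fin n → ℝ))).preimage continuous_snd)

end SlitTarget

/-! ### Chart independence of θ and regularity of H in charts. -/

section Naturality

variable {n : ℕ} {M : Type*} [TopologicalSpace M] [ChartedSpace (Base n) M]
  [IsManifold (𝓡 n) ∞ M] {e e' : OpenPartialHomeomorph M (Base n)}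

/-- The base coordinates factor through the projection π; hence verticality has the same meaning in
all natural charts. -/
theorem fst_dChart (he : e ∈ IsManifold.maximalAtlas (𝓡 n) ∞ M)
    {u : Cotangent n M} (hu : u.1 ∈ e.source) (X : TangentSpace (cotI n) u) :
    (dChart e u X).1 = mfderiv (𝓡 n) (𝓡 n) e u.1
      (mfderiv (cotI n) (𝓡 n) (fun v : Cotangent n M => v.1) u X) := by
  have h1 : HasMFDerivAt (cotI n) 𝓘(ℝ, Base n) (fun v : Cotangent n M => e v.1) u
      ((ContinuousLinearMap.fst ℝ (Base n) (Fin n → ℝ)) ∘L dChart e u) :=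
    HasMFDerivAt.comp (I' := 𝓘(ℝ, Coord n)) u (g := Prod.fst) (f := cotChart e)
      (ContinuousLinearMap.fst ℝ (Base n) (Fin n → ℝ)).hasMFDerivAt
      ((contMDiffAt_cotChart he hu).mdifferentiableAt (by simp)).hasMFDerivAt
  have h2 : HasMFDerivAt (cotI n) (𝓡 n) (fun v : Cotangent n M => e v.1) u
      ((mfderiv (𝓡 n) (𝓡 n) e u.1) ∘L
        mfderiv (cotI n) (𝓡 n) (fun v : Cotangent n M => v.1) u) :=
    HasMFDerivAt.comp u
      ((contMDiffAt_of_mem_maximalAtlas he hu).mdifferentiableAt (by simp)).hasMFDerivAt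
      (contMDiff_fst.contMDiffAt.mdifferentiableAt (by simp)).hasMFDerivAt
  exact congrArg (fun L => L X) (hasMFDerivAt_unique h1 h2)

theorem fst_dChart_eq_zero_iff (he : e ∈ IsManifold.maximalAtlas (𝓡 n) ∞ M)
    {u : Cotangent n M} (hu : u.1 ∈ e.source) (X : TangentSpace (cotI n) u) :
    (dChart e u X).1 = 0 ↔
      mfderiv (cotI n) (𝓡 n) (fun v : Cotangent n M => v.1) u X = 0 := by
  rw [fst_dChart he hu]
  obtain ⟨L, hL⟩ := isInvertible_mfderiv_of_mem_maximalAtlas he hu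
  rw [← hL]
  exact L.map_eq_zero_iff

theorem lamLoc_dChart (he : e ∈ IsManifold.maximalAtlas (𝓡 n) ∞ M)
    {u : Cotangent n M} (hu : u.1 ∈ e.source) (X : TangentSpace (cotI n) u) :
    lamLoc (cotChart e u) (dChart e u X) =
      u.2 (mfderiv (cotI n) (𝓡 n) (fun v : Cotangent n M => v.1) u X) := by
  rw [lamLoc_apply, fst_dChart he hu]
  have := sum_smul_proj_comp (isInvertible_mfderiv_of_mem_maximalAtlas he hu) u.2
  conv_rhs => rw [← this]
  rw [sum_apply]
  rfl

/-- The form p_i dx^i is the tautological form X ↦ u(dπ X), and θ is its differential. Cartan's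
formula then expresses θ by data that mention no chart, so all charts give the same θ. -/
theorem thetaLoc_dChart_eq_mlieBracket (he : e ∈ IsManifold.maximalAtlas (𝓡 n) ∞ M)
    {u : Cotangent n M} (hu : u.1 ∈ e.source) {X Y : VField n M} (hX : DiffAt X u)
    (hY : DiffAt Y u) :
    thetaLoc n (dChart e u (X u)) (dChart e u (Y u)) =
      mvfderiv (cotI n) (fun v => v.2 (mfderiv (cotI n) (𝓡 n)
        (fun v : Cotangent n M => v.1) v (Y v))) u (X u) -
      mvfderiv (cotI n) (fun v => v.2 (mfderiv (cotI n) (𝓡 n)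
        (fun v : Cotangent n M => v.1) v (X v))) u (Y u) -
      u.2 (mfderiv (cotI n) (𝓡 n) (fun v : Cotangent n M => v.1) u
        (VectorField.mlieBracket (cotI n) X Y u)) := by
  have hl : DifferentiableAt ℝ (lamLoc (n := n)) (cotChart e u) :=
    contDiffAt_lamLoc.differentiableAt (by simp)
  have key : ∀ Y : VField n M, DiffAt Y u → ∀ W, mvfderiv (cotI n) (fun v =>
      v.2 (mfderiv (cotI n) (𝓡 n) (fun v : Cotangent n M => v.1) v (Y v))) u W =
      fderiv ℝ (fun z => lamLoc z (chartRep e Y z)) (cotChart e u) (dChart e u W) := by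
    intro Y hY W
    refine mvfderiv_eq_fderiv he hu (hl.clm_apply (hY.chartRep he hu)) ?_ W
    filter_upwards [eventually_mem_source hu] with v hv
    rw [chartRep_cotChart he hv, lamLoc_dChart he hv]
  rw [key Y hY, key X hX, ← lamLoc_dChart he hu, dChart_mlieBracket he hu hX hY,
    ← dForm_lamLoc (z := cotChart e u), ← chartRep_cotChart he hu, ← chartRep_cotChart he hu,
    dForm_eq_lieBracket hl (hX.chartRep he hu) (hY.chartRep he hu)]

/-- The extension of a tangent vector with constant components in a natural chart. -/
def extend (e : OpenPartialHomeomorph M (Base n)) {u : Cotangent n M}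
    (X : TangentSpace (cotI n) u) : VField n M :=
  ofChart e fun _ => dChart e u X

theorem extend_self (he : e ∈ IsManifold.maximalAtlas (𝓡 n) ∞ M)
    {u : Cotangent n M} (hu : u.1 ∈ e.source) (X : TangentSpace (cotI n) u) :
    extend e X u = X :=
  dChart_inverse_dChart he hu X

theorem diffAt_extend (he : e ∈ IsManifold.maximalAtlas (𝓡 n) ∞ M)
    {u : Cotangent n M} (hu : u.1 ∈ e.source) (X : TangentSpace (cotI n) u) :
    DiffAt (extend e X) u :=
  diffAt_ofChart he hu (differentiableAt_const _)

theorem thetaLoc_dChart_eq (he : e ∈ IsManifold.maximalAtlas (𝓡 n) ∞ M)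
    (he' : e' ∈ IsManifold.maximalAtlas (𝓡 n) ∞ M) {u : Cotangent n M} (hu : u.1 ∈ e.source)
    (hu' : u.1 ∈ e'.source) (X Y : TangentSpace (cotI n) u) :
    thetaLoc n (dChart e u X) (dChart e u Y) = thetaLoc n (dChart e' u X) (dChart e' u Y) := by
  have h1 := thetaLoc_dChart_eq_mlieBracket he hu (diffAt_extend he hu X) (diffAt_extend he hu Y)
  have h2 := thetaLoc_dChart_eq_mlieBracket he' hu' (diffAt_extend he hu X)
    (diffAt_extend he hu Y)
  have := h1.trans h2.symm
  rwa [extend_self he hu, extend_self he hu] at this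

theorem theta_eq (he : e ∈ IsManifold.maximalAtlas (𝓡 n) ∞ M)
    {u : Cotangent n M} (hu : u.1 ∈ e.source) (X Y : TangentSpace (cotI n) u) :
    theta n M u X Y = thetaLoc n (dChart e u X) (dChart e u Y) :=
  thetaLoc_dChart_eq (IsManifold.chart_mem_maximalAtlas u.1) he (mem_chart_source _ u.1) hu X Y

/-! ### Regularity of the coordinate expression of a Hamilton function -/

theorem mem_slit_iff (he : e ∈ IsManifold.maximalAtlas (𝓡 n) ∞ M)
    {u : Cotangent n M} (hu : u.1 ∈ e.source) :
    u ∈ slit n M ↔ cotChart e u ∈ slitTarget e := by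
  have h : u.2 = 0 ↔ (cotChart e u).2 = 0 := by
    constructor
    · intro h
      ext a
      simp [cotChart, h]
    · intro h
      have h1 : ∀ a, u.2 ((mfderiv (𝓡 n) (𝓡 n) e u.1).inverse (EuclideanSpace.single a 1)) = 0 :=
        fun a => congrFun h a
      refine (sum_smul_proj_comp (isInvertible_mfderiv_of_mem_maximalAtlas he hu) u.2).symm.trans
        (Finset.sum_eq_zero fun a _ => ?_)
      exact (congrArg (· • _) (h1 a)).trans (zero_smul _ _)
  exact ⟨fun h' => ⟨e.map_source hu, fun h0 => h' (h.2 h0)⟩, fun h' h0 => h'.2 (h.1 h0)⟩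

theorem isOpen_slit : IsOpen (slit n M) := by
  refine isOpen_iff_mem_nhds.2 fun u hu => ?_
  have he := IsManifold.chart_mem_maximalAtlas (I := 𝓡 n) (n := ∞) u.1
  have hs := mem_chart_source (Base n) u.1
  filter_upwards [eventually_mem_source hs, (tendsto_cotChart he hs).eventually
    (isOpen_slitTarget.mem_nhds ((mem_slit_iff he hs).1 hu))] with v hv hv'
  exact (mem_slit_iff he hv).2 hv'

theorem cotChartSymm_mem_slit (he : e ∈ IsManifold.maximalAtlas (𝓡 n) ∞ M) {z : Coord n}
    (hz : z ∈ slitTarget e) : cotChartSymm (M := M) e z ∈ slit n M := by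
  rw [mem_slit_iff he (cotChartSymm_mem_source hz.1), cotChart_cotChartSymm he hz.1]
  exact hz

theorem IsHamiltonFunction.isRegularOn {H : Cotangent n M → ℝ} (hH : IsHamiltonFunction H)
    (he : e ∈ IsManifold.maximalAtlas (𝓡 n) ∞ M) : IsRegularOn (inChart e H) (slitTarget e) where
  isOpen := isOpen_slitTarget
  smooth z hz := by
    have h1 := (hH.smooth _ (cotChartSymm_mem_slit he hz)).contMDiffAt
      (isOpen_slit.mem_nhds (cotChartSymm_mem_slit he hz))
    exact (h1.comp z (contMDiffAt_cotChartSymm he hz.1)).contDiffAt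
  det_ne z hz := by
    have := hH.nondegenerate e he _ (cotChartSymm_mem_slit he hz) (cotChartSymm_mem_source hz.1)
    rwa [cotChart_cotChartSymm he hz.1] at this

end Naturality

/-! ### Chart independence of S, J, the vertical projection, φ and the metric. -/

section Tensors

variable {n : ℕ} {M : Type*} [TopologicalSpace M] [ChartedSpace (Base n) M]
  [IsManifold (𝓡 n) ∞ M] {e e' : OpenPartialHomeomorph M (Base n)} {H : Cotangent n M → ℝ}

theorem dChart_injective (he : e ∈ IsManifold.maximalAtlas (𝓡 n) ∞ M)
    {u : Cotangent n M} (hu : u.1 ∈ e.source) : Function.Injective (dChart e u) :=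
  Function.LeftInverse.injective (dChart_inverse_dChart he hu)

theorem dChart_add (e : OpenPartialHomeomorph M (Base n)) {u : Cotangent n M}
    (X Y : TangentSpace (cotI n) u) : dChart e u (X + Y) = dChart e u X + dChart e u Y :=
  ContinuousLinearMap.map_add _ _ _

theorem dChart_sub (e : OpenPartialHomeomorph M (Base n)) {u : Cotangent n M}
    (X Y : TangentSpace (cotI n) u) : dChart e u (X - Y) = dChart e u X - dChart e u Y :=
  ContinuousLinearMap.map_sub _ _ _

theorem dChart_neg (e : OpenPartialHomeomorph M (Base n)) {u : Cotangent n M}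
    (X : TangentSpace (cotI n) u) : dChart e u (-X) = -dChart e u X :=
  ContinuousLinearMap.map_neg _ _

theorem dChart_smul (e : OpenPartialHomeomorph M (Base n)) {u : Cotangent n M} (c : ℝ)
    (X : TangentSpace (cotI n) u) : dChart e u (c • X) = c • dChart e u X :=
  ContinuousLinearMap.map_smul _ _ _

theorem dChart_zero (e : OpenPartialHomeomorph M (Base n)) (u : Cotangent n M) :
    dChart e u 0 = 0 :=
  ContinuousLinearMap.map_zero _

theorem dChart_eq_zero_iff (he : e ∈ IsManifold.maximalAtlas (𝓡 n) ∞ M)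
    {u : Cotangent n M} (hu : u.1 ∈ e.source) (X : TangentSpace (cotI n) u) :
    dChart e u X = 0 ↔ X = 0 := by
  rw [← dChart_zero e u, (dChart_injective he hu).eq_iff]

theorem mvfderiv_eq_fderiv_inChart (hH : IsHamiltonFunction H)
    (he : e ∈ IsManifold.maximalAtlas (𝓡 n) ∞ M) {u : Cotangent n M} (hu : u.1 ∈ e.source)
    (hs : u ∈ slit n M) (X : TangentSpace (cotI n) u) :
    mvfderiv (cotI n) H u X = fderiv ℝ (inChart e H) (cotChart e u) (dChart e u X) := by
  refine mvfderiv_eq_fderiv he hu (((hH.isRegularOn he).smooth _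
    ((mem_slit_iff he hu).1 hs)).differentiableAt (by simp)) ?_ X
  filter_upwards [eventually_mem_source hu] with v hv
  rw [inChart, cotChartSymm_cotChart he hv]

/-- In each chart S is the vector with θ(S, ·) = -dH, and θ and dH are intrinsic. -/
theorem ofChart_hamLoc_eq (hH : IsHamiltonFunction H)
    (he : e ∈ IsManifold.maximalAtlas (𝓡 n) ∞ M) (he' : e' ∈ IsManifold.maximalAtlas (𝓡 n) ∞ M)
    {u : Cotangent n M} (hu : u.1 ∈ e.source) (hu' : u.1 ∈ e'.source) (hs : u ∈ slit n M) :
    ofChart e (hamLoc (inChart e H)) u = ofChart e' (hamLoc (inChart e' H)) u := by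
  refine dChart_injective he' hu' (eq_of_thetaLoc fun Y => ?_)
  have hY := dChart_dChart_inverse he' hu' Y
  rw [← hY, thetaLoc_dChart_eq he' he hu' hu, dChart_ofChart he hu, dChart_ofChart he' hu',
    thetaLoc_hamLoc, thetaLoc_hamLoc, ← mvfderiv_eq_fderiv_inChart hH he hu hs,
    ← mvfderiv_eq_fderiv_inChart hH he' hu' hs]

theorem dChart_mlieBracket_hamLoc (hH : IsHamiltonFunction H)
    (he : e ∈ IsManifold.maximalAtlas (𝓡 n) ∞ M) (he' : e' ∈ IsManifold.maximalAtlas (𝓡 n) ∞ M)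
    {u : Cotangent n M} (hu : u.1 ∈ e.source) (hu' : u.1 ∈ e'.source) (hs : u ∈ slit n M)
    {Y : VField n M} (hY : DiffAt Y u) :
    dChart e' u (VectorField.mlieBracket (cotI n) (ofChart e (hamLoc (inChart e H))) Y u) =
      VectorField.lieBracket ℝ (hamLoc (inChart e' H)) (chartRep e' Y) (cotChart e' u) := by
  have h1 : ofChart e (hamLoc (inChart e H)) =ᶠ[𝓝 u] ofChart e' (hamLoc (inChart e' H)) := by
    filter_upwards [eventually_mem_source hu, eventually_mem_source hu', isOpen_slit.mem_nhds hs]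
      with v hv hv' hvs
    exact ofChart_hamLoc_eq hH he he' hv hv' hvs
  have hd : DiffAt (ofChart e (hamLoc (inChart e H))) u :=
    diffAt_ofChart he hu (((hH.isRegularOn he).contDiffAt_hamLoc
      ((mem_slit_iff he hu).1 hs)).differentiableAt (by simp))
  rw [dChart_mlieBracket he' hu' hd hY]
  exact Filter.EventuallyEq.lieBracket_vectorField_eq
    ((chartRep_congr he' hu' h1).trans
      (chartRep_ofChart_eventuallyEq he' (cotChart_mem_target hu') _)) EventuallyEq.rfl

theorem exists_tanLoc_eq (hH : IsHamiltonFunction H) {u : Cotangent n M} (hs : u ∈ slit n M)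
    (X : TangentSpace (cotI n) u) :
    ∃ v : TangentSpace (cotI n) u, ∀ e ∈ IsManifold.maximalAtlas (𝓡 n) ∞ M, u.1 ∈ e.source →
      tanLoc (inChart e H) (cotChart e u) (dChart e u X) = dChart e u v := by
  obtain ⟨e₀, he₀, hu₀⟩ : ∃ e ∈ IsManifold.maximalAtlas (𝓡 n) ∞ M, u.1 ∈ e.source :=
    ⟨_, IsManifold.chart_mem_maximalAtlas u.1, mem_chart_source _ u.1⟩
  have hZ₀ := hH.isRegularOn he₀
  have hz₀ := (mem_slit_iff he₀ hu₀).1 hs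
  -- A vertical field with value -JX at `u`, as computed in one chart. In every chart J[S,V] = -V,
  -- so -V(u) will be the common value of JX.
  set V : VField n M := ofChart e₀ fun _ => -tanLoc (inChart e₀ H) (cotChart e₀ u) (dChart e₀ u X)
    with hV
  have hVd : DiffAt V u := diffAt_ofChart he₀ hu₀ (differentiableAt_const _)
  set B := VectorField.mlieBracket (cotI n) (ofChart e₀ (hamLoc (inChart e₀ H))) V u with hB
  have hV0 : ∀ e ∈ IsManifold.maximalAtlas (𝓡 n) ∞ M, u.1 ∈ e.source →
      ∀ᶠ z in 𝓝 (cotChart e u), (chartRep e V z).1 = 0 := by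
    intro e he hu
    filter_upwards [eventually_mem_target (cotChart_mem_target hu),
      (tendsto_cotChartSymm he hu).eventually (eventually_mem_source hu₀)] with z hz hz'
    rw [chartRep, fst_dChart_eq_zero_iff he (cotChartSymm_mem_source hz),
      ← fst_dChart_eq_zero_iff he₀ hz', hV, dChart_ofChart he₀ hz']
    simp [tanLoc]
  have hBt : ∀ e ∈ IsManifold.maximalAtlas (𝓡 n) ∞ M, u.1 ∈ e.source →
      tanLoc (inChart e H) (cotChart e u) (dChart e u B) = -dChart e u (V u) := by
    intro e he hu
    rw [hB, dChart_mlieBracket_hamLoc hH he₀ he hu₀ hu hs hVd,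
      (hH.isRegularOn he).tanLoc_lieBracket ((mem_slit_iff he hu).1 hs) (hVd.chartRep he hu)
        (hV0 e he hu), chartRep_cotChart he hu]
  -- The bracket B = [S,V] and X have the same projection to M, and J depends on nothing else, so JX
  -- = JB in every chart.
  have hB0 : (dChart e₀ u (B - X)).1 = 0 := by
    rw [dChart_sub, Prod.fst_sub, sub_eq_zero]
    ext i
    rw [hB, dChart_mlieBracket_hamLoc hH he₀ he₀ hu₀ hu₀ hs hVd,
      hZ₀.lieBracket_hamLoc_vertical hz₀ (hVd.chartRep he₀ hu₀) (hV0 e₀ he₀ hu₀),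
      chartRep_cotChart he₀ hu₀, hV, dChart_ofChart he₀ hu₀]
    simp only [tanLoc, Prod.snd_neg, Pi.neg_apply, mul_neg, Finset.sum_neg_distrib, neg_neg]
    exact sum_inverse_mul (hZ₀.gUp_mul_gLow hz₀) (fun j => (dChart e₀ u X).1 j) i
  refine ⟨-V u, fun e he hu => ?_⟩
  rw [dChart_neg, ← hBt e he hu]
  have : (dChart e u X).1 = (dChart e u B).1 := by
    have := (fst_dChart_eq_zero_iff he hu _).2 ((fst_dChart_eq_zero_iff he₀ hu₀ _).1 hB0)
    rw [dChart_sub, Prod.fst_sub, sub_eq_zero] at this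
    exact this.symm
  simp only [tanLoc, this]

/-- By `lieBracket_tanLoc`, vX is half of [S,JX] - J[S,X] + X for any extension of X; every
ingredient is already known to be intrinsic. -/
theorem exists_vertLoc_eq (hH : IsHamiltonFunction H) {u : Cotangent n M} (hs : u ∈ slit n M)
    (X : TangentSpace (cotI n) u) :
    ∃ v : TangentSpace (cotI n) u, ∀ e ∈ IsManifold.maximalAtlas (𝓡 n) ∞ M, u.1 ∈ e.source →
      vertLoc (inChart e H) (cotChart e u) (dChart e u X) = dChart e u v := by
  obtain ⟨e₀, he₀, hu₀⟩ : ∃ e ∈ IsManifold.maximalAtlas (𝓡 n) ∞ M, u.1 ∈ e.source :=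
    ⟨_, IsManifold.chart_mem_maximalAtlas u.1, mem_chart_source _ u.1⟩
  have hZ₀ := hH.isRegularOn he₀
  have hz₀ := (mem_slit_iff he₀ hu₀).1 hs
  have hXd := diffAt_extend he₀ hu₀ X
  set J : VField n M := ofChart e₀ fun z => tanLoc (inChart e₀ H) z (dChart e₀ u X) with hJ
  have hJd : DiffAt J u := diffAt_ofChart he₀ hu₀
    (hZ₀.differentiableAt_tanLoc hz₀ (differentiableAt_const (dChart e₀ u X)))
  have hJe : ∀ e ∈ IsManifold.maximalAtlas (𝓡 n) ∞ M, u.1 ∈ e.source → chartRep e J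
      =ᶠ[𝓝 (cotChart e u)] fun z => tanLoc (inChart e H) z (chartRep e (extend e₀ X) z) := by
    intro e he hu
    filter_upwards [eventually_mem_target (cotChart_mem_target hu),
      (tendsto_cotChartSymm he hu).eventually (eventually_mem_source hu₀),
      (tendsto_cotChartSymm he hu).eventually (isOpen_slit.mem_nhds hs)] with z hz hz' hzs
    obtain ⟨v, hv⟩ := exists_tanLoc_eq hH hzs (extend e₀ X (cotChartSymm e z))
    have h1 := hv e he (cotChartSymm_mem_source hz)
    rw [cotChart_cotChartSymm he hz] at h1
    have h2 := hv e₀ he₀ hz'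
    rw [chartRep, chartRep, h1, hJ]
    congr 1
    rw [extend, dChart_ofChart he₀ hz'] at h2
    rw [← dChart_inverse_dChart he₀ hz' v, ← h2]
    rfl
  set S := ofChart e₀ (hamLoc (inChart e₀ H))
  obtain ⟨v₁, hv₁⟩ := exists_tanLoc_eq hH hs (VectorField.mlieBracket (cotI n) S (extend e₀ X) u)
  refine ⟨(1 / 2 : ℝ) • (VectorField.mlieBracket (cotI n) S J u - v₁ + X), fun e he hu => ?_⟩
  have hz := (mem_slit_iff he hu).1 hs
  have key := (hH.isRegularOn he).lieBracket_tanLoc hz (hXd.chartRep he hu)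
  rw [← Filter.EventuallyEq.lieBracket_vectorField_eq EventuallyEq.rfl (hJe e he hu),
    ← dChart_mlieBracket_hamLoc hH he₀ he hu₀ hu hs hJd,
    ← dChart_mlieBracket_hamLoc hH he₀ he hu₀ hu hs hXd, hv₁ e he hu, chartRep_cotChart he hu,
    extend_self he₀ hu₀] at key
  rw [dChart_smul, dChart_add, dChart_sub, key, smul_smul]
  norm_num

theorem exists_phiLoc_eq (hH : IsHamiltonFunction H) {u : Cotangent n M} (hs : u ∈ slit n M)
    (X : TangentSpace (cotI n) u) :
    ∃ v : TangentSpace (cotI n) u, ∀ e ∈ IsManifold.maximalAtlas (𝓡 n) ∞ M, u.1 ∈ e.source →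
      phiLoc (inChart e H) (cotChart e u) (dChart e u X) = dChart e u v := by
  obtain ⟨e₀, he₀, hu₀⟩ : ∃ e ∈ IsManifold.maximalAtlas (𝓡 n) ∞ M, u.1 ∈ e.source :=
    ⟨_, IsManifold.chart_mem_maximalAtlas u.1, mem_chart_source _ u.1⟩
  set v := (dChart e₀ u).inverse (phiLoc (inChart e₀ H) (cotChart e₀ u) (dChart e₀ u X))
  have hv : dChart e₀ u v = phiLoc (inChart e₀ H) (cotChart e₀ u) (dChart e₀ u X) :=
    dChart_dChart_inverse he₀ hu₀ _
  obtain ⟨w, hw⟩ := exists_vertLoc_eq hH hs X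
  obtain ⟨a, ha⟩ := exists_vertLoc_eq hH hs (v - X + (2 : ℝ) • w)
  obtain ⟨b, hb⟩ := exists_tanLoc_eq hH hs (v - X + (2 : ℝ) • w)
  -- The criterion `eq_phiLoc_iff` becomes a condition on tangent vectors of T*M that does not
  -- mention the chart; it holds in one chart, hence in all.
  have key : ∀ e ∈ IsManifold.maximalAtlas (𝓡 n) ∞ M, u.1 ∈ e.source →
      (dChart e u v = phiLoc (inChart e H) (cotChart e u) (dChart e u X) ↔
        a = 0 ∧ b = (2 : ℝ) • w) := by
    intro e he hu
    have hi := dChart_injective he hu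
    have h1 : dChart e u v - dChart e u X +
        (2 : ℝ) • vertLoc (inChart e H) (cotChart e u) (dChart e u X) =
        dChart e u (v - X + (2 : ℝ) • w) := by
      rw [dChart_add, dChart_sub, dChart_smul, hw e he hu]
    rw [(hH.isRegularOn he).eq_phiLoc_iff ((mem_slit_iff he hu).1 hs), h1, ha e he hu, hb e he hu,
      hw e he hu, ← dChart_smul, hi.eq_iff, dChart_eq_zero_iff he hu]
  exact ⟨v, fun e he hu => ((key e he hu).2 ((key e₀ he₀ hu₀).1 hv)).symm⟩

theorem metricLoc_dChart_eq (hH : IsHamiltonFunction H)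
    (he : e ∈ IsManifold.maximalAtlas (𝓡 n) ∞ M) (he' : e' ∈ IsManifold.maximalAtlas (𝓡 n) ∞ M)
    {u : Cotangent n M} (hu : u.1 ∈ e.source) (hu' : u.1 ∈ e'.source) (hs : u ∈ slit n M)
    (X Y : TangentSpace (cotI n) u) :
    metricLoc (inChart e H) (cotChart e u) (dChart e u X) (dChart e u Y) =
      metricLoc (inChart e' H) (cotChart e' u) (dChart e' u X) (dChart e' u Y) := by
  obtain ⟨t, ht⟩ := exists_tanLoc_eq hH hs X
  obtain ⟨w, hw⟩ := exists_vertLoc_eq hH hs X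
  obtain ⟨w', hw'⟩ := exists_vertLoc_eq hH hs Y
  obtain ⟨f, hf⟩ := exists_phiLoc_eq hH hs X
  have key : ∀ e ∈ IsManifold.maximalAtlas (𝓡 n) ∞ M, u.1 ∈ e.source →
      metricLoc (inChart e H) (cotChart e u) (dChart e u X) (dChart e u Y) =
        thetaLoc n (dChart e u t) (dChart e u Y) -
          thetaLoc n (dChart e u ((1 / 2 : ℝ) • (f - X) + w)) (dChart e u w') := by
    intro e he hu
    rw [(hH.isRegularOn he).metricLoc_eq_thetaLoc ((mem_slit_iff he hu).1 hs), ht e he hu,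
      hw e he hu, hw' e he hu, hf e he hu]
    simp only [dChart_add, dChart_smul, dChart_sub]
  rw [key e he hu, key e' he' hu', thetaLoc_dChart_eq he he' hu hu',
    thetaLoc_dChart_eq he he' hu hu']

theorem canonicalPair_eq (hH : IsHamiltonFunction H)
    (he : e ∈ IsManifold.maximalAtlas (𝓡 n) ∞ M) {u : Cotangent n M} (hu : u.1 ∈ e.source)
    (hs : u ∈ slit n M) (X : TangentSpace (cotI n) u) :
    dChart e u (canonicalPair H u X) = phiLoc (inChart e H) (cotChart e u) (dChart e u X) := by
  obtain ⟨v, hv⟩ := exists_phiLoc_eq hH hs X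
  rw [hv e he hu]
  congr 1
  have hc := IsManifold.chart_mem_maximalAtlas (I := 𝓡 n) (n := ∞) u.1
  have hcs := mem_chart_source (Base n) u.1
  refine (congrArg (dChart (chartAt (Base n) u.1) u).inverse (hv _ hc hcs)).trans ?_
  exact dChart_inverse_dChart hc hcs v

theorem liftedMetric_eq (hH : IsHamiltonFunction H)
    (he : e ∈ IsManifold.maximalAtlas (𝓡 n) ∞ M) {u : Cotangent n M} (hu : u.1 ∈ e.source)
    (hs : u ∈ slit n M) (X Y : TangentSpace (cotI n) u) :
    liftedMetric H u X Y =
      metricLoc (inChart e H) (cotChart e u) (dChart e u X) (dChart e u Y) :=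
  metricLoc_dChart_eq hH (IsManifold.chart_mem_maximalAtlas u.1) he (mem_chart_source _ u.1) hu
    hs X Y

end Tensors

/-! ### The two projections in coordinates and differentiability of the tensors. -/

section FlatAux

variable {n : ℕ} {h : Coord n → ℝ} {Z : Set (Coord n)} {z : Coord n}

theorem hForm_wPart (h : Coord n → ℝ) (z X : Coord n) (i : Fin n) :
    hForm h z i ((1 / 2 : ℝ) • (X - phiLoc h z X)) = 0 := by
  rw [map_smul, map_sub, hForm_phiLoc, sub_self, smul_zero]

theorem wForm_wPart (h : Coord n → ℝ) (z X : Coord n) (b : Fin n) :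
    wForm h z b ((1 / 2 : ℝ) • (X - phiLoc h z X)) = wForm h z b X := by
  rw [map_smul, map_sub, wForm_phiLoc, smul_eq_mul]
  ring

theorem hForm_hPart (h : Coord n → ℝ) (z X : Coord n) (i : Fin n) :
    hForm h z i ((1 / 2 : ℝ) • (X + phiLoc h z X)) = hForm h z i X := by
  rw [map_smul, map_add, hForm_phiLoc, smul_eq_mul]
  ring

theorem wForm_hPart (h : Coord n → ℝ) (z X : Coord n) (b : Fin n) :
    wForm h z b ((1 / 2 : ℝ) • (X + phiLoc h z X)) = 0 := by
  rw [map_smul, map_add, wForm_phiLoc, add_neg_cancel, smul_zero]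

theorem connLoc_wPart (h : Coord n → ℝ) (Y : Coord n → Coord n) (z X : Coord n) :
    connLoc h (fun y => (1 / 2 : ℝ) • (Y y - phiLoc h y (Y y))) z X =
      (1 / 2 : ℝ) • (connLoc h Y z X - phiLoc h z (connLoc h Y z X)) := by
  refine coframe_ext h z (fun i => ?_) fun b => ?_
  · simp only [hForm_connLoc, hForm_wPart]
    simp
  · simp only [wForm_connLoc, wForm_wPart]

namespace IsRegularOn

variable {Y Y' : Coord n → Coord n}

theorem differentiableAt_phiLoc (hZ : IsRegularOn h Z) (hz : z ∈ Z)
    (hY : DifferentiableAt ℝ Y z) : DifferentiableAt ℝ (fun y => phiLoc h y (Y y)) z := by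
  simp only [phiLoc_apply]
  exact (DifferentiableAt.fun_sum fun i _ => (hZ.differentiableAt_hForm_apply hz hY i).smul
    ((hZ.contDiffAt_hVec hz i).differentiableAt (by simp))).sub
    (DifferentiableAt.fun_sum fun i _ => (hZ.differentiableAt_wForm_apply hz hY i).smul
    ((hZ.contDiffAt_wVec hz i).differentiableAt (by simp)))

theorem differentiableAt_metricLoc (hZ : IsRegularOn h Z) (hz : z ∈ Z)
    (hY : DifferentiableAt ℝ Y z) (hY' : DifferentiableAt ℝ Y' z) :
    DifferentiableAt ℝ (fun y => metricLoc h y (Y y) (Y' y)) z := by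
  have hx : ∀ {Y : Coord n → Coord n}, DifferentiableAt ℝ Y z → ∀ i,
      DifferentiableAt ℝ (fun y => (Y y).1 i) z := fun hY i =>
    (dxForm i).differentiableAt.comp z hY
  simp only [metricLoc_apply]
  exact (DifferentiableAt.fun_sum fun i _ => DifferentiableAt.fun_sum fun j _ =>
      ((hZ.contDiffAt_gLow hz i j).differentiableAt (by simp)).mul ((hx hY i).mul (hx hY' j))).add
    (DifferentiableAt.fun_sum fun i _ => DifferentiableAt.fun_sum fun j _ =>
      ((hZ.contDiffAt_gUp hz i j).differentiableAt (by simp)).mul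
        ((hZ.differentiableAt_wForm_apply hz hY i).mul
          (hZ.differentiableAt_wForm_apply hz hY' j)))

end IsRegularOn

theorem differentiableAt_thetaLoc {Y Y' : Coord n → Coord n}
    (hY : DifferentiableAt ℝ Y z) (hY' : DifferentiableAt ℝ Y' z) :
    DifferentiableAt ℝ (fun y => thetaLoc n (Y y) (Y' y)) z := by
  have hx : ∀ {Y : Coord n → Coord n}, DifferentiableAt ℝ Y z → ∀ i,
      DifferentiableAt ℝ (fun y => (Y y).1 i) z := fun hY i =>
    (dxForm i).differentiableAt.comp z hY
  have hp : ∀ {Y : Coord n → Coord n}, DifferentiableAt ℝ Y z → ∀ i,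
      DifferentiableAt ℝ (fun y => (Y y).2 i) z := fun hY i =>
    (dpForm i).differentiableAt.comp z hY
  simp only [thetaLoc_apply]
  exact DifferentiableAt.fun_sum fun i _ => ((hp hY i).mul (hx hY' i)).sub ((hx hY i).mul (hp hY' i))

end FlatAux

/-! ### The canonical connection over one natural chart. -/

section ChartConnection

variable {n : ℕ} {M : Type*} [TopologicalSpace M] [ChartedSpace (Base n) M]
  [IsManifold (𝓡 n) ∞ M] {e : OpenPartialHomeomorph M (Base n)} {H : Cotangent n M → ℝ}

theorem diffAt_of_chartRep (he : e ∈ IsManifold.maximalAtlas (𝓡 n) ∞ M)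
    {u : Cotangent n M} (hu : u.1 ∈ e.source) {Y : VField n M}
    (hY : DifferentiableAt ℝ (chartRep e Y) (cotChart e u)) : DiffAt Y u :=
  (diffAt_ofChart he hu hY).congr (ofChart_chartRep_eventuallyEq he hu Y)

theorem chartRep_canonicalPair (hH : IsHamiltonFunction H)
    (he : e ∈ IsManifold.maximalAtlas (𝓡 n) ∞ M) {u : Cotangent n M} (hu : u.1 ∈ e.source)
    (hs : u ∈ slit n M) (Y : VField n M) :
    chartRep e (fun v => canonicalPair H v (Y v)) =ᶠ[𝓝 (cotChart e u)]
      fun z => phiLoc (inChart e H) z (chartRep e Y z) := by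
  filter_upwards [isOpen_slitTarget.mem_nhds ((mem_slit_iff he hu).1 hs)] with z hz
  rw [chartRep, canonicalPair_eq hH he (cotChartSymm_mem_source hz.1) (cotChartSymm_mem_slit he hz),
    cotChart_cotChartSymm he hz.1, chartRep]

theorem dChart_hProj (hH : IsHamiltonFunction H)
    (he : e ∈ IsManifold.maximalAtlas (𝓡 n) ∞ M) {u : Cotangent n M} (hu : u.1 ∈ e.source)
    (hs : u ∈ slit n M) (X : TangentSpace (cotI n) u) :
    dChart e u (hProj (canonicalPair H) u X) = (1 / 2 : ℝ) •
      (dChart e u X + phiLoc (inChart e H) (cotChart e u) (dChart e u X)) := by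
  rw [← canonicalPair_eq hH he hu hs, ← dChart_add, ← dChart_smul]
  rfl

theorem dChart_wProj (hH : IsHamiltonFunction H)
    (he : e ∈ IsManifold.maximalAtlas (𝓡 n) ∞ M) {u : Cotangent n M} (hu : u.1 ∈ e.source)
    (hs : u ∈ slit n M) (X : TangentSpace (cotI n) u) :
    dChart e u (wProj (canonicalPair H) u X) = (1 / 2 : ℝ) •
      (dChart e u X - phiLoc (inChart e H) (cotChart e u) (dChart e u X)) := by
  rw [← canonicalPair_eq hH he hu hs, ← dChart_sub, ← dChart_smul]
  rfl

theorem chartRep_hProj (hH : IsHamiltonFunction H)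
    (he : e ∈ IsManifold.maximalAtlas (𝓡 n) ∞ M) {u : Cotangent n M} (hu : u.1 ∈ e.source)
    (hs : u ∈ slit n M) (Y : VField n M) :
    chartRep e (fun v => hProj (canonicalPair H) v (Y v)) =ᶠ[𝓝 (cotChart e u)] fun z =>
      (1 / 2 : ℝ) • (chartRep e Y z + phiLoc (inChart e H) z (chartRep e Y z)) := by
  filter_upwards [isOpen_slitTarget.mem_nhds ((mem_slit_iff he hu).1 hs)] with z hz
  rw [chartRep, dChart_hProj hH he (cotChartSymm_mem_source hz.1) (cotChartSymm_mem_slit he hz),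
    cotChart_cotChartSymm he hz.1, chartRep]

theorem chartRep_wProj (hH : IsHamiltonFunction H)
    (he : e ∈ IsManifold.maximalAtlas (𝓡 n) ∞ M) {u : Cotangent n M} (hu : u.1 ∈ e.source)
    (hs : u ∈ slit n M) (Y : VField n M) :
    chartRep e (fun v => wProj (canonicalPair H) v (Y v)) =ᶠ[𝓝 (cotChart e u)] fun z =>
      (1 / 2 : ℝ) • (chartRep e Y z - phiLoc (inChart e H) z (chartRep e Y z)) := by
  filter_upwards [isOpen_slitTarget.mem_nhds ((mem_slit_iff he hu).1 hs)] with z hz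
  rw [chartRep, dChart_wProj hH he (cotChartSymm_mem_source hz.1) (cotChartSymm_mem_slit he hz),
    cotChart_cotChartSymm he hz.1, chartRep]

/-- In a chart, ker(1 - φ) is the common kernel of the w_b and the vertical space that of the dx^i,
and (dx^i, w_b) is a coframe. Isotropy is read off θ = w_i ∧ h^i. -/
theorem isConnectionPair_canonicalPair (hH : IsHamiltonFunction H) :
    IsConnectionPair (canonicalPair H) (slit n M) := by
  have main : ∀ u ∈ slit n M, ∃ e ∈ IsManifold.maximalAtlas (𝓡 n) ∞ M, u.1 ∈ e.source :=
    fun u _ => ⟨_, IsManifold.chart_mem_maximalAtlas u.1, mem_chart_source _ u.1⟩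
  refine ⟨fun u hs X => ?_, fun u hs => ?_, fun u hs X Y hX hY => ?_, fun u hs X Y hX hY => ?_⟩
  all_goals obtain ⟨e, he, hu⟩ := main u hs
  all_goals have hz := (mem_slit_iff he hu).1 hs
  · refine dChart_injective he hu ?_
    rw [canonicalPair_eq hH he hu hs, canonicalPair_eq hH he hu hs, phiLoc_phiLoc]
  · have h1 : ∀ X : TangentSpace (cotI n) u, X ∈ LinearMap.ker (ContinuousLinearMap.id ℝ
        (TangentSpace (cotI n) u) - canonicalPair H u).toLinearMap ↔
        ∀ b, wForm (inChart e H) (cotChart e u) b (dChart e u X) = 0 := by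
      intro X
      have : X ∈ LinearMap.ker (ContinuousLinearMap.id ℝ
        (TangentSpace (cotI n) u) - canonicalPair H u).toLinearMap ↔
          X - canonicalPair H u X = 0 := LinearMap.mem_ker
      rw [this, sub_eq_zero, ← (dChart_injective he hu).eq_iff, canonicalPair_eq hH he hu hs]
      constructor
      · intro h b
        exact wForm_eq_zero_of_phiLoc h.symm b
      · intro h
        exact coframe_ext _ _ (fun i => (hForm_phiLoc _ _ _ i).symm) fun b => by
          rw [wForm_phiLoc, h, neg_zero]
    have h2 : ∀ X : TangentSpace (cotI n) u, X ∈ LinearMap.ker (mfderiv (cotI n) (𝓡 n)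
        (fun v : Cotangent n M => v.1) u).toLinearMap ↔ (dChart e u X).1 = 0 := fun X =>
      LinearMap.mem_ker.trans (fst_dChart_eq_zero_iff he hu X).symm
    refine ⟨Submodule.disjoint_def.2 fun X hX hX' => ?_, codisjoint_iff.2 ?_⟩
    · rw [h1] at hX
      rw [h2] at hX'
      rw [← dChart_eq_zero_iff he hu]
      refine Prod.ext hX' ?_
      ext b
      rw [snd_eq_wForm (inChart e H) (cotChart e u), hX, hX']
      simp
    · rw [eq_top_iff]
      intro X _
      set v := (dChart e u).inverse (vertLoc (inChart e H) (cotChart e u) (dChart e u X))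
      have hv : dChart e u v = vertLoc (inChart e H) (cotChart e u) (dChart e u X) :=
        dChart_dChart_inverse he hu _
      refine Submodule.mem_sup.2 ⟨X - v, (h1 _).2 fun b => ?_, v, (h2 _).2 ?_, sub_add_cancel X v⟩
      · rw [dChart_sub, map_sub, hv, wForm_apply (X := vertLoc _ _ _)]
        simp [vertLoc]
      · rw [hv]
        rfl
  · rw [theta_eq he hu, thetaLoc_eq (hH.isRegularOn he) hz]
    have hX' := wForm_eq_zero_of_phiLoc ((canonicalPair_eq hH he hu hs X).symm.trans
      (congrArg (dChart e u) hX))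
    have hY' := wForm_eq_zero_of_phiLoc ((canonicalPair_eq hH he hu hs Y).symm.trans
      (congrArg (dChart e u) hY))
    simp [hX', hY']
  · rw [theta_eq he hu, thetaLoc_eq (hH.isRegularOn he) hz]
    have hX' := hForm_eq_zero_of_phiLoc (((canonicalPair_eq hH he hu hs X).symm.trans
      (congrArg (dChart e u) hX)).trans (dChart_neg e X))
    have hY' := hForm_eq_zero_of_phiLoc (((canonicalPair_eq hH he hu hs Y).symm.trans
      (congrArg (dChart e u) hY)).trans (dChart_neg e Y))
    simp [hX', hY']

/-- The canonical connection in a natural chart. -/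
def connChart (e : OpenPartialHomeomorph M (Base n)) (H : Cotangent n M → ℝ) : Conn n M :=
  fun Y u => (dChart e u).inverse ∘L connLoc (inChart e H) (chartRep e Y) (cotChart e u) ∘L
    dChart e u

theorem dChart_connChart (he : e ∈ IsManifold.maximalAtlas (𝓡 n) ∞ M)
    {u : Cotangent n M} (hu : u.1 ∈ e.source) (Y : VField n M) (X : TangentSpace (cotI n) u) :
    dChart e u (connChart e H Y u X) =
      connLoc (inChart e H) (chartRep e Y) (cotChart e u) (dChart e u X) :=
  dChart_dChart_inverse he hu _

theorem connChart_add (hH : IsHamiltonFunction H) (he : e ∈ IsManifold.maximalAtlas (𝓡 n) ∞ M)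
    {u : Cotangent n M} (hu : u.1 ∈ e.source) (hs : u ∈ slit n M) {Y Y' : VField n M}
    (hY : DiffAt Y u) (hY' : DiffAt Y' u) :
    connChart e H (Y + Y') u = connChart e H Y u + connChart e H Y' u := by
  refine ContinuousLinearMap.ext fun X => dChart_injective he hu ?_
  have h1 : chartRep e (Y + Y') = fun z => chartRep e Y z + chartRep e Y' z :=
    funext fun z => dChart_add e _ _
  rw [dChart_connChart he hu, h1, (hH.isRegularOn he).connLoc_add ((mem_slit_iff he hu).1 hs)
    (hY.chartRep he hu) (hY'.chartRep he hu)]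
  refine Eq.trans ?_ (dChart_add e _ _).symm
  exact (congrArg₂ (· + ·) (dChart_connChart he hu Y X) (dChart_connChart he hu Y' X)).symm

theorem connChart_smul (hH : IsHamiltonFunction H) (he : e ∈ IsManifold.maximalAtlas (𝓡 n) ∞ M)
    {u : Cotangent n M} (hu : u.1 ∈ e.source) (hs : u ∈ slit n M) {Y : VField n M}
    {g : Cotangent n M → ℝ} (hY : DiffAt Y u) (hg : MDifferentiableAt (cotI n) 𝓘(ℝ, ℝ) g u) :
    connChart e H (fun v => g v • Y v) u = g u • connChart e H Y u +
      (mvfderiv (cotI n) g u).smulRight (Y u) := by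
  refine ContinuousLinearMap.ext fun X => dChart_injective he hu ?_
  have hz := cotChart_mem_target hu
  have hgd : DifferentiableAt ℝ (fun z => g (cotChartSymm e z)) (cotChart e u) := by
    rw [← cotChartSymm_cotChart he hu] at hg
    exact (hg.comp _ ((contMDiffAt_cotChartSymm he hz).mdifferentiableAt
      (by simp))).differentiableAt
  have hge : g =ᶠ[𝓝 u] fun v => g (cotChartSymm e (cotChart e v)) := by
    filter_upwards [eventually_mem_source hu] with v hv
    rw [cotChartSymm_cotChart he hv]
  have h1 : chartRep e (fun v => g v • Y v) = fun z => g (cotChartSymm e z) • chartRep e Y z :=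
    funext fun z => dChart_smul e _ _
  rw [dChart_connChart he hu, h1, (hH.isRegularOn he).connLoc_smul ((mem_slit_iff he hu).1 hs)
    hgd (hY.chartRep he hu), cotChartSymm_cotChart he hu]
  have h2 := mvfderiv_eq_fderiv he hu hgd hge X
  refine Eq.trans ?_ (dChart_add e _ _).symm
  refine congrArg₂ (fun a b : Coord n => a + b) ?_ ?_
  · refine Eq.trans ?_ (dChart_smul e _ _).symm
    exact congrArg (fun a : Coord n => g u • a) (dChart_connChart he hu Y X).symm
  · refine Eq.trans ?_ (dChart_smul e (mvfderiv (cotI n) g u X) (Y u)).symm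
    rw [h2, ← chartRep_cotChart he hu]
    rfl

theorem contMDiffAt_connChart (hH : IsHamiltonFunction H)
    (he : e ∈ IsManifold.maximalAtlas (𝓡 n) ∞ M)
    {u : Cotangent n M} (hu : u.1 ∈ e.source) (hs : u ∈ slit n M) {Y : VField n M}
    (hY : ContMDiffAt (cotI n) ((cotI n).prod 𝓘(ℝ, CotModel n)) ∞
      (fun v => TotalSpace.mk' (CotModel n) v (Y v)) u) :
    ContMDiffAt (cotI n) ((cotI n).prod 𝓘(ℝ, CotModel n →L[ℝ] CotModel n)) ∞
      (fun v => (⟨v, connChart e H Y v⟩ : TotalSpace (CotModel n →L[ℝ] CotModel n)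
        fun v : Cotangent n M => TangentSpace (cotI n) v →L[ℝ] TangentSpace (cotI n) v)) u :=
  contMDiffAt_conj_mfderiv (contMDiffAt_cotChart he hu) (isInvertible_dChart he hu)
    (A := connLoc (inChart e H) (chartRep e Y))
    (contMDiffAt_endo_iff.2 ((hH.isRegularOn he).contDiffAt_connLoc ((mem_slit_iff he hu).1 hs)
      (contDiffAt_chartRep he hu hY)))

theorem connChart_canonicalPair (hH : IsHamiltonFunction H)
    (he : e ∈ IsManifold.maximalAtlas (𝓡 n) ∞ M) {u : Cotangent n M} (hu : u.1 ∈ e.source)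
    (hs : u ∈ slit n M) (Y : VField n M) (X : TangentSpace (cotI n) u) :
    connChart e H (fun v => canonicalPair H v (Y v)) u X =
      canonicalPair H u (connChart e H Y u X) := by
  refine dChart_injective he hu ?_
  rw [dChart_connChart he hu, connLoc_congr (chartRep_canonicalPair hH he hu hs Y), connLoc_phiLoc,
    canonicalPair_eq hH he hu hs, dChart_connChart he hu]

theorem connChart_wProj (hH : IsHamiltonFunction H)
    (he : e ∈ IsManifold.maximalAtlas (𝓡 n) ∞ M) {u : Cotangent n M} (hu : u.1 ∈ e.source)
    (hs : u ∈ slit n M) (Y : VField n M) (X : TangentSpace (cotI n) u) :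
    connChart e H (fun v => wProj (canonicalPair H) v (Y v)) u X =
      wProj (canonicalPair H) u (connChart e H Y u X) := by
  refine dChart_injective he hu ?_
  rw [dChart_connChart he hu, connLoc_congr (chartRep_wProj hH he hu hs Y), connLoc_wPart,
    dChart_wProj hH he hu hs, dChart_connChart he hu]

theorem mvfderiv_theta (he : e ∈ IsManifold.maximalAtlas (𝓡 n) ∞ M) {u : Cotangent n M}
    (hu : u.1 ∈ e.source) {Y Y' : VField n M} (hY : DiffAt Y u) (hY' : DiffAt Y' u)
    (X : TangentSpace (cotI n) u) :
    mvfderiv (cotI n) (fun v => theta n M v (Y v) (Y' v)) u X =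
      fderiv ℝ (fun z => thetaLoc n (chartRep e Y z) (chartRep e Y' z)) (cotChart e u)
        (dChart e u X) := by
  refine mvfderiv_eq_fderiv he hu (differentiableAt_thetaLoc (hY.chartRep he hu)
    (hY'.chartRep he hu)) ?_ X
  filter_upwards [eventually_mem_source hu] with v hv
  rw [theta_eq he hv, chartRep_cotChart he hv, chartRep_cotChart he hv]

theorem mvfderiv_liftedMetric (hH : IsHamiltonFunction H)
    (he : e ∈ IsManifold.maximalAtlas (𝓡 n) ∞ M) {u : Cotangent n M} (hu : u.1 ∈ e.source)
    (hs : u ∈ slit n M) {Y Y' : VField n M} (hY : DiffAt Y u) (hY' : DiffAt Y' u)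
    (X : TangentSpace (cotI n) u) :
    mvfderiv (cotI n) (fun v => liftedMetric H v (Y v) (Y' v)) u X =
      fderiv ℝ (fun z => metricLoc (inChart e H) z (chartRep e Y z) (chartRep e Y' z))
        (cotChart e u) (dChart e u X) := by
  refine mvfderiv_eq_fderiv he hu ((hH.isRegularOn he).differentiableAt_metricLoc
    ((mem_slit_iff he hu).1 hs) (hY.chartRep he hu) (hY'.chartRep he hu)) ?_ X
  filter_upwards [eventually_mem_source hu, isOpen_slit.mem_nhds hs] with v hv hvs
  rw [liftedMetric_eq hH he hv hvs, chartRep_cotChart he hv, chartRep_cotChart he hv]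

theorem connChart_theta (hH : IsHamiltonFunction H)
    (he : e ∈ IsManifold.maximalAtlas (𝓡 n) ∞ M) {u : Cotangent n M} (hu : u.1 ∈ e.source)
    (hs : u ∈ slit n M) {Y Y' : VField n M} (hY : DiffAt Y u) (hY' : DiffAt Y' u)
    (X : TangentSpace (cotI n) u) :
    mvfderiv (cotI n) (fun v => theta n M v (Y v) (Y' v)) u X =
      theta n M u (connChart e H Y u X) (Y' u) + theta n M u (Y u) (connChart e H Y' u X) := by
  rw [mvfderiv_theta he hu hY hY', (hH.isRegularOn he).connLoc_thetaLoc
    ((mem_slit_iff he hu).1 hs) (hY.chartRep he hu) (hY'.chartRep he hu), theta_eq he hu,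
    theta_eq he hu, dChart_connChart he hu, dChart_connChart he hu, chartRep_cotChart he hu,
    chartRep_cotChart he hu]

theorem connChart_liftedMetric (hH : IsHamiltonFunction H)
    (he : e ∈ IsManifold.maximalAtlas (𝓡 n) ∞ M) {u : Cotangent n M} (hu : u.1 ∈ e.source)
    (hs : u ∈ slit n M) {Y Y' : VField n M} (hY : DiffAt Y u) (hY' : DiffAt Y' u)
    (X : TangentSpace (cotI n) u) :
    mvfderiv (cotI n) (fun v => liftedMetric H v (Y v) (Y' v)) u X =
      liftedMetric H u (connChart e H Y u X) (Y' u) +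
        liftedMetric H u (Y u) (connChart e H Y' u X) := by
  rw [mvfderiv_liftedMetric hH he hu hs hY hY', (hH.isRegularOn he).connLoc_metricLoc
    ((mem_slit_iff he hu).1 hs) (hY.chartRep he hu) (hY'.chartRep he hu),
    liftedMetric_eq hH he hu hs, liftedMetric_eq hH he hu hs, dChart_connChart he hu,
    dChart_connChart he hu, chartRep_cotChart he hu, chartRep_cotChart he hu]

theorem dChart_torsion_connChart (he : e ∈ IsManifold.maximalAtlas (𝓡 n) ∞ M)
    {u : Cotangent n M} (hu : u.1 ∈ e.source) {X Y : VField n M} (hX : DiffAt X u)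
    (hY : DiffAt Y u) :
    dChart e u (torsion (connChart e H) X Y u) =
      connLoc (inChart e H) (chartRep e Y) (cotChart e u) (chartRep e X (cotChart e u)) -
      connLoc (inChart e H) (chartRep e X) (cotChart e u) (chartRep e Y (cotChart e u)) -
      VectorField.lieBracket ℝ (chartRep e X) (chartRep e Y) (cotChart e u) := by
  rw [torsion, dChart_sub, dChart_sub, dChart_connChart he hu, dChart_connChart he hu,
    dChart_mlieBracket he hu hX hY, chartRep_cotChart he hu, chartRep_cotChart he hu]

theorem diffAt_hProj (hH : IsHamiltonFunction H) (he : e ∈ IsManifold.maximalAtlas (𝓡 n) ∞ M)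
    {u : Cotangent n M} (hu : u.1 ∈ e.source) (hs : u ∈ slit n M) {Y : VField n M}
    (hY : DiffAt Y u) : DiffAt (fun v => hProj (canonicalPair H) v (Y v)) u :=
  diffAt_of_chartRep he hu ((((hY.chartRep he hu).add ((hH.isRegularOn he).differentiableAt_phiLoc
    ((mem_slit_iff he hu).1 hs) (hY.chartRep he hu))).const_smul (1 / 2 : ℝ)).congr_of_eventuallyEq
      (chartRep_hProj hH he hu hs Y))

theorem diffAt_wProj (hH : IsHamiltonFunction H) (he : e ∈ IsManifold.maximalAtlas (𝓡 n) ∞ M)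
    {u : Cotangent n M} (hu : u.1 ∈ e.source) (hs : u ∈ slit n M) {Y : VField n M}
    (hY : DiffAt Y u) : DiffAt (fun v => wProj (canonicalPair H) v (Y v)) u :=
  diffAt_of_chartRep he hu ((((hY.chartRep he hu).sub ((hH.isRegularOn he).differentiableAt_phiLoc
    ((mem_slit_iff he hu).1 hs) (hY.chartRep he hu))).const_smul (1 / 2 : ℝ)).congr_of_eventuallyEq
      (chartRep_wProj hH he hu hs Y))

theorem connChart_torsion_h (hH : IsHamiltonFunction H)
    (he : e ∈ IsManifold.maximalAtlas (𝓡 n) ∞ M) {u : Cotangent n M} (hu : u.1 ∈ e.source)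
    (hs : u ∈ slit n M) {X Y : VField n M} (hX : DiffAt X u) (hY : DiffAt Y u) :
    hProj (canonicalPair H) u (torsion (connChart e H) (fun v => hProj (canonicalPair H) v (X v))
      (fun v => hProj (canonicalPair H) v (Y v)) u) = 0 := by
  have hX' := diffAt_hProj hH he hu hs hX
  have hY' := diffAt_hProj hH he hu hs hY
  rw [← dChart_eq_zero_iff he hu, dChart_hProj hH he hu hs]
  refine coframe_ext (inChart e H) (cotChart e u) (fun i => ?_) fun b => ?_
  · rw [hForm_hPart, dChart_torsion_connChart he hu hX' hY', map_zero]
    refine hForm_torsion (hH.isRegularOn he) ((mem_slit_iff he hu).1 hs) (hX'.chartRep he hu)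
      (hY'.chartRep he hu) (fun b => ?_) (fun b => ?_) i
    · rw [(chartRep_hProj hH he hu hs X).eq_of_nhds, wForm_hPart]
    · rw [(chartRep_hProj hH he hu hs Y).eq_of_nhds, wForm_hPart]
  · rw [wForm_hPart, map_zero]

theorem connChart_torsion_w (hH : IsHamiltonFunction H)
    (he : e ∈ IsManifold.maximalAtlas (𝓡 n) ∞ M) {u : Cotangent n M} (hu : u.1 ∈ e.source)
    (hs : u ∈ slit n M) {X Y : VField n M} (hX : DiffAt X u) (hY : DiffAt Y u) :
    wProj (canonicalPair H) u (torsion (connChart e H) (fun v => wProj (canonicalPair H) v (X v))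
      (fun v => wProj (canonicalPair H) v (Y v)) u) = 0 := by
  have hX' := diffAt_wProj hH he hu hs hX
  have hY' := diffAt_wProj hH he hu hs hY
  rw [← dChart_eq_zero_iff he hu, dChart_wProj hH he hu hs]
  refine coframe_ext (inChart e H) (cotChart e u) (fun i => ?_) fun b => ?_
  · rw [hForm_wPart, map_zero]
  · rw [wForm_wPart, dChart_torsion_connChart he hu hX' hY', map_zero]
    refine wForm_torsion (hH.isRegularOn he) ((mem_slit_iff he hu).1 hs) (hX'.chartRep he hu)
      (hY'.chartRep he hu) (fun b => ?_) (fun b => ?_) b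
    · rw [(chartRep_wProj hH he hu hs X).eq_of_nhds, hForm_wPart]
    · rw [(chartRep_wProj hH he hu hs Y).eq_of_nhds, hForm_wPart]

end ChartConnection

/-! ### From chart connections to global ones, and comparison through coefficients. -/

section Canonical

variable {n : ℕ} {M : Type*} [TopologicalSpace M] [ChartedSpace (Base n) M]
  [IsManifold (𝓡 n) ∞ M] {e : OpenPartialHomeomorph M (Base n)} {H : Cotangent n M → ℝ}
  {U : Set (Cotangent n M)} {D D' : Conn n M} {u : Cotangent n M}

set_option synthInstance.maxHeartbeats 200000 in
set_option maxHeartbeats 1000000 in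
theorem contMDiffOn_of_eq_connChart (hH : IsHamiltonFunction H) (hU : IsOpen U)
    (hUs : U ⊆ slit n M)
    (hD : ∀ u ∈ U, ∃ e ∈ IsManifold.maximalAtlas (𝓡 n) ∞ M, u.1 ∈ e.source ∧
      ∀ᶠ v in 𝓝 u, ∀ Y, DiffAt Y v → D Y v = connChart e H Y v) {Y : VField n M}
    (hY : ContMDiffOn (cotI n) ((cotI n).prod 𝓘(ℝ, CotModel n)) ∞
      (fun v => TotalSpace.mk' (CotModel n) v (Y v)) U) :
    ContMDiffOn (cotI n) ((cotI n).prod 𝓘(ℝ, CotModel n →L[ℝ] CotModel n)) ∞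
      (fun v => (⟨v, D Y v⟩ : TotalSpace (CotModel n →L[ℝ] CotModel n)
        fun v : Cotangent n M => TangentSpace (cotI n) v →L[ℝ] TangentSpace (cotI n) v)) U := by
  intro u hu
  obtain ⟨e, he, hue, h2⟩ := hD u hu
  have hYs : ∀ᶠ v in 𝓝 u, ContMDiffAt (cotI n) ((cotI n).prod 𝓘(ℝ, CotModel n)) ∞
      (fun v => TotalSpace.mk' (CotModel n) v (Y v)) v := by
    filter_upwards [hU.mem_nhds hu] with v hv
    exact (hY v hv).contMDiffAt (hU.mem_nhds hv)
  refine ((contMDiffAt_connChart hH he hue (hUs hu) hYs.self_of_nhds).congr_of_eventuallyEq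
    ?_).contMDiffWithinAt
  filter_upwards [h2, hYs] with v hv hv'
  rw [hv Y (hv'.mdifferentiableAt (by simp))]

theorem torsion_congr {X Y : VField n M} (hX : D X u = D' X u) (hY : D Y u = D' Y u) :
    torsion D X Y u = torsion D' X Y u := by
  rw [torsion, torsion, hX, hY]

theorem isCovariantDerivativeOn_of_eq_connChart (hH : IsHamiltonFunction H) (hUs : U ⊆ slit n M)
    (hD : ∀ u ∈ U, ∃ e ∈ IsManifold.maximalAtlas (𝓡 n) ∞ M, u.1 ∈ e.source ∧
      ∀ Y, D Y u = connChart e H Y u) :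
    IsCovariantDerivativeOn (I := cotI n) (CotModel n) D U where
  add {Y Y' u} hY hY' hu := by
    obtain ⟨e, he, hue, h1⟩ := hD u hu
    rw [h1, h1, h1]
    exact connChart_add hH he hue (hUs hu) hY hY'
  leibniz {Y g u} hY hg hu := by
    obtain ⟨e, he, hue, h1⟩ := hD u hu
    rw [h1, h1]
    exact connChart_smul hH he hue (hUs hu) hY hg

set_option synthInstance.maxHeartbeats 200000 in
set_option maxHeartbeats 1000000 in
theorem isLinearConnection_of_eq_connChart (hH : IsHamiltonFunction H) (hU : IsOpen U)
    (hUs : U ⊆ slit n M)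
    (hD : ∀ u ∈ U, ∃ e ∈ IsManifold.maximalAtlas (𝓡 n) ∞ M, u.1 ∈ e.source ∧
      (∀ Y, D Y u = connChart e H Y u) ∧
      ∀ᶠ v in 𝓝 u, ∀ Y, DiffAt Y v → D Y v = connChart e H Y v) : IsLinearConnection D U where
  covariant := isCovariantDerivativeOn_of_eq_connChart hH hUs fun u hu => by
    obtain ⟨e, he, hue, h1, -⟩ := hD u hu
    exact ⟨e, he, hue, h1⟩
  smooth := ⟨fun hY => contMDiffOn_of_eq_connChart hH hU hUs (fun u hu => by
    obtain ⟨e, he, hue, -, h2⟩ := hD u hu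
    exact ⟨e, he, hue, h2⟩) hY⟩

/-- The pointwise conditions need agreement with a chart connection only at the point itself, for
all fields. Smoothness needs it on a neighbourhood, where agreement on differentiable fields is
enough and is all that gluing provides. -/
theorem isCanonicalPhiConnection_of_eq_connChart (hH : IsHamiltonFunction H) (hU : IsOpen U)
    (hUs : U ⊆ slit n M)
    (hD : ∀ u ∈ U, ∃ e ∈ IsManifold.maximalAtlas (𝓡 n) ∞ M, u.1 ∈ e.source ∧
      (∀ Y, D Y u = connChart e H Y u) ∧
      ∀ᶠ v in 𝓝 u, ∀ Y, DiffAt Y v → D Y v = connChart e H Y v) :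
    IsCanonicalPhiConnection (canonicalPair H) (liftedMetric H) U D where
  linear := isLinearConnection_of_eq_connChart hH hU hUs hD
  parallel_phi u hu Y _ X := by
    obtain ⟨e, he, hue, h1, -⟩ := hD u hu
    rw [h1, h1]
    exact connChart_canonicalPair hH he hue (hUs hu) Y X
  parallel_w u hu Y _ X := by
    obtain ⟨e, he, hue, h1, -⟩ := hD u hu
    rw [h1, h1]
    exact connChart_wProj hH he hue (hUs hu) Y X
  metric u hu Y Y' hY hY' X := by
    obtain ⟨e, he, hue, h1, -⟩ := hD u hu
    rw [h1, h1]
    exact connChart_liftedMetric hH he hue (hUs hu) hY hY' X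
  symplectic u hu Y Y' hY hY' X := by
    obtain ⟨e, he, hue, h1, -⟩ := hD u hu
    rw [h1, h1]
    exact connChart_theta hH he hue (hUs hu) hY hY' X
  torsion_h u hu X Y hX hY := by
    obtain ⟨e, he, hue, h1, -⟩ := hD u hu
    rw [torsion_congr (h1 _) (h1 _)]
    exact connChart_torsion_h hH he hue (hUs hu) hX hY
  torsion_w u hu X Y hX hY := by
    obtain ⟨e, he, hue, h1, -⟩ := hD u hu
    rw [torsion_congr (h1 _) (h1 _)]
    exact connChart_torsion_w hH he hue (hUs hu) hX hY

theorem clm_map_sum_add_sum {E F : Type*} [AddCommGroup E] [Module ℝ E] [TopologicalSpace E]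
    [AddCommGroup F] [Module ℝ F] [TopologicalSpace F] (f : E →L[ℝ] F) (a b : Fin n → ℝ)
    (x y : Fin n → E) : f (∑ i, a i • x i + ∑ i, b i • y i) =
      ∑ i, a i • f (x i) + ∑ i, b i • f (y i) := by
  simp

/-- At `u`, the connection `D` has the canonical coefficients of `H` in the natural chart of `e`. -/
def HasCoeffsAt (H : Cotangent n M → ℝ) (D : Conn n M)
    (e : OpenPartialHomeomorph M (Base n)) (u : Cotangent n M) : Prop :=
  (∀ j k, D (hFrame H e j) u (hFrame H e k u) =
    ∑ i, coeffL (inChart e H) (cotChart e u) i j k • hFrame H e i u) ∧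
  (∀ b k, D (wFrame H e b) u (hFrame H e k u) =
    -∑ c, coeffL (inChart e H) (cotChart e u) b c k • wFrame H e c u) ∧
  (∀ j a, D (hFrame H e j) u (wFrame H e a u) =
    ∑ k, coeffC (inChart e H) (cotChart e u) j k a • hFrame H e k u) ∧
  (∀ b a, D (wFrame H e b) u (wFrame H e a u) =
    -∑ c, coeffC (inChart e H) (cotChart e u) c b a • wFrame H e c u)

theorem frame_expand (he : e ∈ IsManifold.maximalAtlas (𝓡 n) ∞ M) (hu : u.1 ∈ e.source)
    (H : Cotangent n M → ℝ) (X : TangentSpace (cotI n) u) :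
    X = ∑ i, hForm (inChart e H) (cotChart e u) i (dChart e u X) • hFrame H e i u +
      ∑ b, wForm (inChart e H) (cotChart e u) b (dChart e u X) • wFrame H e b u := by
  have h := congrArg (dChart e u).inverse
    (frame_decomp (inChart e H) (cotChart e u) (dChart e u X))
  rw [dChart_inverse_dChart he hu] at h
  exact h.trans (clm_map_sum_add_sum _ _ _ _ _)

theorem clm_ext_frameFields {F : Type*} [AddCommGroup F] [Module ℝ F] [TopologicalSpace F]
    (he : e ∈ IsManifold.maximalAtlas (𝓡 n) ∞ M) (hu : u.1 ∈ e.source)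
    (H : Cotangent n M → ℝ) {f g : TangentSpace (cotI n) u →L[ℝ] F}
    (h1 : ∀ i, f (hFrame H e i u) = g (hFrame H e i u))
    (h2 : ∀ b, f (wFrame H e b u) = g (wFrame H e b u)) : f = g := by
  refine ContinuousLinearMap.ext fun X => ?_
  have h := frame_expand he hu H X
  rw [h]
  refine (clm_map_sum_add_sum f _ _ _ _).trans (Eq.trans ?_ (clm_map_sum_add_sum g _ _ _ _).symm)
  simp only [h1, h2]

theorem diffAt_hFrame (hH : IsHamiltonFunction H) (he : e ∈ IsManifold.maximalAtlas (𝓡 n) ∞ M)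
    (hu : u.1 ∈ e.source) (hs : u ∈ slit n M) (i : Fin n) : DiffAt (hFrame H e i) u :=
  diffAt_ofChart he hu (((hH.isRegularOn he).contDiffAt_hVec
    ((mem_slit_iff he hu).1 hs) i).differentiableAt (by simp))

theorem diffAt_wFrame (hH : IsHamiltonFunction H) (he : e ∈ IsManifold.maximalAtlas (𝓡 n) ∞ M)
    (hu : u.1 ∈ e.source) (hs : u ∈ slit n M) (i : Fin n) : DiffAt (wFrame H e i) u :=
  diffAt_ofChart he hu (((hH.isRegularOn he).contDiffAt_wVec
    ((mem_slit_iff he hu).1 hs) i).differentiableAt (by simp))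

/-- The difference of two covariant derivatives is a tensor; equal coefficients make it vanish on
the frame, hence on every vector. -/
theorem HasCoeffsAt.eq (hH : IsHamiltonFunction H) (he : e ∈ IsManifold.maximalAtlas (𝓡 n) ∞ M)
    (hue : u.1 ∈ e.source) (hs : u ∈ slit n M) (hu : u ∈ U)
    (hD : IsCovariantDerivativeOn (I := cotI n) (CotModel n) D U)
    (hD' : IsCovariantDerivativeOn (I := cotI n) (CotModel n) D' U)
    (h : HasCoeffsAt H D e u) (h' : HasCoeffsAt H D' e u) {Y : VField n M} (hY : DiffAt Y u) :
    D Y u = D' Y u := by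
  have e1 : ∀ i, IsCovariantDerivativeOn.difference hD hD' u (hFrame H e i u) = 0 := by
    intro i
    rw [IsCovariantDerivativeOn.difference_apply hD hD' hu (diffAt_hFrame hH he hue hs i),
      sub_eq_zero]
    exact clm_ext_frameFields he hue H (fun k => (h.1 i k).trans (h'.1 i k).symm)
      fun k => (h.2.2.1 i k).trans (h'.2.2.1 i k).symm
  have e2 : ∀ i, IsCovariantDerivativeOn.difference hD hD' u (wFrame H e i u) = 0 := by
    intro i
    rw [IsCovariantDerivativeOn.difference_apply hD hD' hu (diffAt_wFrame hH he hue hs i),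
      sub_eq_zero]
    exact clm_ext_frameFields he hue H (fun k => (h.2.1 i k).trans (h'.2.1 i k).symm)
      fun k => (h.2.2.2 i k).trans (h'.2.2.2 i k).symm
  have e3 : IsCovariantDerivativeOn.difference hD hD' u = 0 :=
    clm_ext_frameFields he hue H e1 e2
  rw [← sub_eq_zero, ← IsCovariantDerivativeOn.difference_apply hD hD' hu hY, e3]
  rfl

end Canonical

/-! ### An arbitrary canonical connection read in a natural chart. -/

section Uniqueness

variable {n : ℕ} {M : Type*} [TopologicalSpace M] [ChartedSpace (Base n) M]
  [IsManifold (𝓡 n) ∞ M] {e : OpenPartialHomeomorph M (Base n)} {H : Cotangent n M → ℝ}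
  {U : Set (Cotangent n M)} {D : Conn n M} {u : Cotangent n M}

/-- The operator induced by a connection on vector fields in coordinates. -/
def flatConn (D : Conn n M) (e : OpenPartialHomeomorph M (Base n)) (u : Cotangent n M)
    (V : Coord n → Coord n) : Coord n →L[ℝ] Coord n :=
  dChart e u ∘L D (ofChart e V) u ∘L (dChart e u).inverse

theorem flatConn_dChart (he : e ∈ IsManifold.maximalAtlas (𝓡 n) ∞ M) (hue : u.1 ∈ e.source)
    (D : Conn n M) (V : Coord n → Coord n) (X : TangentSpace (cotI n) u) :
    flatConn D e u V (dChart e u X) = dChart e u (D (ofChart e V) u X) :=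
  congrArg (fun X => dChart e u (D (ofChart e V) u X)) (dChart_inverse_dChart he hue X)

theorem flatConn_neg (hD : IsCovariantDerivativeOn (I := cotI n) (CotModel n) D U)
    (hu : u ∈ U) (he : e ∈ IsManifold.maximalAtlas (𝓡 n) ∞ M) (hue : u.1 ∈ e.source)
    {V : Coord n → Coord n} (hV : DifferentiableAt ℝ V (cotChart e u)) (X : Coord n) :
    flatConn D e u (fun z => -V z) X = -flatConn D e u V X := by
  have h1 : (ofChart e fun z => -V z : VField n M) = fun v => (-1 : ℝ) • ofChart e V v := by
    funext v
    refine Eq.trans ?_ (neg_one_smul ℝ (ofChart e V v)).symm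
    exact ContinuousLinearMap.map_neg _ _
  have h2 := IsCovariantDerivativeOn.smul_const hD (-1 : ℝ) (diffAt_ofChart he hue hV) hu
  refine (congrArg (fun Y => dChart e u (D Y u ((dChart e u).inverse X))) h1).trans ?_
  refine (congrArg (fun L => dChart e u (L ((dChart e u).inverse X))) h2).trans ?_
  refine (dChart_smul e (-1) (D (ofChart e V) u ((dChart e u).inverse X))).trans ?_
  exact neg_one_smul ℝ _

variable (hH : IsHamiltonFunction H)
  (hD : IsCanonicalPhiConnection (canonicalPair H) (liftedMetric H) U D)
  (hu : u ∈ U) (hs : u ∈ slit n M) (he : e ∈ IsManifold.maximalAtlas (𝓡 n) ∞ M)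
  (hue : u.1 ∈ e.source) {V W : Coord n → Coord n}
  (hV : DifferentiableAt ℝ V (cotChart e u)) (hW : DifferentiableAt ℝ W (cotChart e u))

include hH hD hu hs he hue hV

theorem flatConn_phiLoc (hU : U ∈ 𝓝 u) (X : Coord n) :
    flatConn D e u (fun z => phiLoc (inChart e H) z (V z)) X =
      phiLoc (inChart e H) (cotChart e u) (flatConn D e u V X) := by
  have hz := (mem_slit_iff he hue).1 hs
  have hφ := diffAt_ofChart he hue ((hH.isRegularOn he).differentiableAt_phiLoc hz hV)
  have h1 : (fun v => canonicalPair H v (ofChart e V v)) =ᶠ[𝓝 u]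
      ofChart e fun z => phiLoc (inChart e H) z (V z) := by
    filter_upwards [eventually_mem_source hue, isOpen_slit.mem_nhds hs] with v hv hvs
    refine dChart_injective he hv ?_
    rw [canonicalPair_eq hH he hv hvs, dChart_ofChart he hv, dChart_ofChart he hv]
  have h2 := hD.parallel_phi u hu (ofChart e V) (diffAt_ofChart he hue hV)
    ((dChart e u).inverse X)
  -- The two fields agree only near `u`, so locality of D is used; this is why `U` must be a
  -- neighbourhood of `u`.
  rw [hD.linear.covariant.congr_of_eventuallyEq (hφ.congr h1) hφ hU h1] at h2
  exact (congrArg (dChart e u) h2).trans (canonicalPair_eq hH he hue hs _)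

include hW

theorem flatConn_metricLoc (X : Coord n) :
    fderiv ℝ (fun z => metricLoc (inChart e H) z (V z) (W z)) (cotChart e u) X =
      metricLoc (inChart e H) (cotChart e u) (flatConn D e u V X) (W (cotChart e u)) +
        metricLoc (inChart e H) (cotChart e u) (V (cotChart e u)) (flatConn D e u W X) := by
  have hV' := diffAt_ofChart he hue hV
  have hW' := diffAt_ofChart he hue hW
  have h := hD.metric u hu _ _ hV' hW' ((dChart e u).inverse X)
  rw [mvfderiv_liftedMetric hH he hue hs hV' hW', liftedMetric_eq hH he hue hs,
    liftedMetric_eq hH he hue hs, dChart_dChart_inverse he hue, dChart_ofChart he hue,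
    dChart_ofChart he hue] at h
  refine Eq.trans ?_ h
  refine congrArg (fun L : Coord n →L[ℝ] ℝ => L X) (Filter.EventuallyEq.fderiv_eq ?_)
  filter_upwards [chartRep_ofChart_eventuallyEq he (cotChart_mem_target hue) V,
    chartRep_ofChart_eventuallyEq he (cotChart_mem_target hue) W] with z hz hz'
  rw [hz, hz']

omit hH hs in
theorem flatConn_thetaLoc (X : Coord n) :
    fderiv ℝ (fun z => thetaLoc n (V z) (W z)) (cotChart e u) X =
      thetaLoc n (flatConn D e u V X) (W (cotChart e u)) +
        thetaLoc n (V (cotChart e u)) (flatConn D e u W X) := by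
  have hV' := diffAt_ofChart he hue hV
  have hW' := diffAt_ofChart he hue hW
  have h := hD.symplectic u hu _ _ hV' hW' ((dChart e u).inverse X)
  rw [mvfderiv_theta he hue hV' hW', theta_eq he hue, theta_eq he hue,
    dChart_dChart_inverse he hue, dChart_ofChart he hue, dChart_ofChart he hue] at h
  refine Eq.trans ?_ h
  refine congrArg (fun L : Coord n →L[ℝ] ℝ => L X) (Filter.EventuallyEq.fderiv_eq ?_)
  filter_upwards [chartRep_ofChart_eventuallyEq he (cotChart_mem_target hue) V,
    chartRep_ofChart_eventuallyEq he (cotChart_mem_target hue) W] with z hz hz'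
  rw [hz, hz']

omit hH hD hu hs in
theorem dChart_torsion_of_eventuallyEq
    (hD : IsCovariantDerivativeOn (I := cotI n) (CotModel n) D U) (hU : U ∈ 𝓝 u)
    {X Y : VField n M} (hX : X =ᶠ[𝓝 u] ofChart e V) (hY : Y =ᶠ[𝓝 u] ofChart e W) :
    dChart e u (torsion D X Y u) =
      flatConn D e u W (V (cotChart e u)) - flatConn D e u V (W (cotChart e u)) -
      VectorField.lieBracket ℝ V W (cotChart e u) := by
  have hV' := diffAt_ofChart he hue hV
  have hW' := diffAt_ofChart he hue hW
  have hX' := hV'.congr hX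
  have hY' := hW'.congr hY
  have e1 : chartRep e X =ᶠ[𝓝 (cotChart e u)] V := (chartRep_congr he hue hX).trans
    (chartRep_ofChart_eventuallyEq he (cotChart_mem_target hue) V)
  have e2 : chartRep e Y =ᶠ[𝓝 (cotChart e u)] W := (chartRep_congr he hue hY).trans
    (chartRep_ofChart_eventuallyEq he (cotChart_mem_target hue) W)
  rw [torsion, hD.congr_of_eventuallyEq hX' hV' hU hX, hD.congr_of_eventuallyEq hY' hW' hU hY,
    dChart_sub, dChart_sub, dChart_mlieBracket he hue hX' hY', ← flatConn_dChart he hue,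
    ← flatConn_dChart he hue, hX.eq_of_nhds, hY.eq_of_nhds, dChart_ofChart he hue,
    dChart_ofChart he hue, e1.lieBracket_vectorField_eq e2]

/-- A field killed by all w_b is fixed by the horizontal projection near `u`, so the torsion axiom,
stated for projected fields, applies to it directly. -/
theorem hForm_flatConn_torsion (hU : U ∈ 𝓝 u)
    (hVw : ∀ z b, wForm (inChart e H) z b (V z) = 0)
    (hWw : ∀ z b, wForm (inChart e H) z b (W z) = 0) (i : Fin n) :
    hForm (inChart e H) (cotChart e u) i
      (flatConn D e u W (V (cotChart e u)) - flatConn D e u V (W (cotChart e u)) -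
        VectorField.lieBracket ℝ V W (cotChart e u)) = 0 := by
  have key : ∀ V : Coord n → Coord n, (∀ z b, wForm (inChart e H) z b (V z) = 0) →
      (fun v => hProj (canonicalPair H) v (ofChart e V v)) =ᶠ[𝓝 u] ofChart e V := by
    intro V hVw
    filter_upwards [eventually_mem_source hue, isOpen_slit.mem_nhds hs] with v hv hvs
    refine dChart_injective he hv ?_
    rw [dChart_hProj hH he hv hvs, dChart_ofChart he hv]
    exact coframe_ext (inChart e H) (cotChart e v) (hForm_hPart _ _ _) fun b => by
      rw [wForm_hPart, hVw]
  have h := congrArg (dChart e u)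
    (hD.torsion_h u hu _ _ (diffAt_ofChart he hue hV) (diffAt_ofChart he hue hW))
  rw [dChart_hProj hH he hue hs, dChart_torsion_of_eventuallyEq he hue hV hW hD.linear.covariant hU
    (key V hVw) (key W hWw), dChart_zero] at h
  rw [← hForm_hPart, h, map_zero]

theorem wForm_flatConn_torsion (hU : U ∈ 𝓝 u)
    (hVw : ∀ z i, hForm (inChart e H) z i (V z) = 0)
    (hWw : ∀ z i, hForm (inChart e H) z i (W z) = 0) (b : Fin n) :
    wForm (inChart e H) (cotChart e u) b
      (flatConn D e u W (V (cotChart e u)) - flatConn D e u V (W (cotChart e u)) -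
        VectorField.lieBracket ℝ V W (cotChart e u)) = 0 := by
  have key : ∀ V : Coord n → Coord n, (∀ z i, hForm (inChart e H) z i (V z) = 0) →
      (fun v => wProj (canonicalPair H) v (ofChart e V v)) =ᶠ[𝓝 u] ofChart e V := by
    intro V hVw
    filter_upwards [eventually_mem_source hue, isOpen_slit.mem_nhds hs] with v hv hvs
    refine dChart_injective he hv ?_
    rw [dChart_wProj hH he hv hvs, dChart_ofChart he hv]
    exact coframe_ext (inChart e H) (cotChart e v) (fun i => by rw [hForm_wPart, hVw])
      (wForm_wPart _ _ _)
  have h := congrArg (dChart e u)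
    (hD.torsion_w u hu _ _ (diffAt_ofChart he hue hV) (diffAt_ofChart he hue hW))
  rw [dChart_wProj hH he hue hs, dChart_torsion_of_eventuallyEq he hue hV hW hD.linear.covariant hU
    (key V hVw) (key W hWw), dChart_zero] at h
  rw [← wForm_wPart, h, map_zero]

end Uniqueness

section FrameValues

variable {n : ℕ} {h : Coord n → ℝ} {Z : Set (Coord n)} {z : Coord n}

theorem IsRegularOn.metricLoc_hVec_left (hZ : IsRegularOn h Z) (hz : z ∈ Z) {X : Coord n}
    (hX : ∀ b, wForm h z b X = 0) (j : Fin n) :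
    metricLoc h z X (hVec h j z) = ∑ m, hForm h z m X * gLow h z m j := by
  rw [metricLoc_eq hZ hz]
  simp [hX, hForm_hVec, wForm_hVec, mul_comm]

theorem IsRegularOn.metricLoc_hVec_right (hZ : IsRegularOn h Z) (hz : z ∈ Z) {X : Coord n}
    (hX : ∀ b, wForm h z b X = 0) (i : Fin n) :
    metricLoc h z (hVec h i z) X = ∑ m, hForm h z m X * gLow h z i m := by
  rw [metricLoc_eq hZ hz]
  simp [hX, hForm_hVec, wForm_hVec, mul_comm]

theorem metricLoc_hVec (h : Coord n → ℝ) (z : Coord n) (i j : Fin n) :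
    metricLoc h z (hVec h i z) (hVec h j z) = gLow h z i j := by
  rw [metricLoc_apply]
  simp only [wForm_hVec]
  simp [hVec]

theorem IsRegularOn.thetaLoc_hVec_right (hZ : IsRegularOn h Z) (hz : z ∈ Z) (X : Coord n)
    (j : Fin n) : thetaLoc n X (hVec h j z) = wForm h z j X := by
  rw [thetaLoc_eq hZ hz]
  simp [hForm_hVec, wForm_hVec]

theorem IsRegularOn.thetaLoc_wVec_left (hZ : IsRegularOn h Z) (hz : z ∈ Z) (X : Coord n)
    (j : Fin n) : thetaLoc n (wVec h j z) X = hForm h z j X := by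
  rw [thetaLoc_eq hZ hz]
  simp [hForm_wVec, wForm_wVec]

end FrameValues

/-! ### Connection forms of a canonical connection, uniqueness and gluing. -/

section Uniqueness

variable {n : ℕ} {M : Type*} [TopologicalSpace M] [ChartedSpace (Base n) M]
  [IsManifold (𝓡 n) ∞ M] {e : OpenPartialHomeomorph M (Base n)} {H : Cotangent n M → ℝ}
  {U : Set (Cotangent n M)} {D : Conn n M} {u : Cotangent n M}

theorem wForm_flatConn_hVec (hH : IsHamiltonFunction H)
    (hD : IsCanonicalPhiConnection (canonicalPair H) (liftedMetric H) U D)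
    (hU : U ∈ 𝓝 u) (hs : u ∈ slit n M) (he : e ∈ IsManifold.maximalAtlas (𝓡 n) ∞ M)
    (hue : u.1 ∈ e.source) (j : Fin n) (X : Coord n) (b : Fin n) :
    wForm (inChart e H) (cotChart e u) b (flatConn D e u (hVec (inChart e H) j) X) = 0 := by
  have h1 := flatConn_phiLoc hH hD (mem_of_mem_nhds hU) hs he hue
    (((hH.isRegularOn he).contDiffAt_hVec ((mem_slit_iff he hue).1 hs) j).differentiableAt
      (by simp)) hU X
  simp only [phiLoc_hVec] at h1
  exact wForm_eq_zero_of_phiLoc h1.symm b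

theorem hForm_flatConn_wVec (hH : IsHamiltonFunction H)
    (hD : IsCanonicalPhiConnection (canonicalPair H) (liftedMetric H) U D)
    (hU : U ∈ 𝓝 u) (hs : u ∈ slit n M) (he : e ∈ IsManifold.maximalAtlas (𝓡 n) ∞ M)
    (hue : u.1 ∈ e.source) (b : Fin n) (X : Coord n) (i : Fin n) :
    hForm (inChart e H) (cotChart e u) i (flatConn D e u (wVec (inChart e H) b) X) = 0 := by
  have hd := ((hH.isRegularOn he).contDiffAt_wVec ((mem_slit_iff he hue).1 hs) b).differentiableAt
    (n := ∞) (by simp)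
  have h1 := flatConn_phiLoc hH hD (mem_of_mem_nhds hU) hs he hue hd hU X
  simp only [phiLoc_wVec] at h1
  rw [flatConn_neg hD.linear.covariant (mem_of_mem_nhds hU) he hue hd] at h1
  exact hForm_eq_zero_of_phiLoc h1.symm i

/-- The functions θ(w^b, e_j) are constant, so parallelism of θ makes the connection forms on the
two frames negative transposes of each other. -/
theorem wForm_flatConn_wVec (hH : IsHamiltonFunction H)
    (hD : IsCanonicalPhiConnection (canonicalPair H) (liftedMetric H) U D)
    (hU : U ∈ 𝓝 u) (hs : u ∈ slit n M) (he : e ∈ IsManifold.maximalAtlas (𝓡 n) ∞ M)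
    (hue : u.1 ∈ e.source) (b j : Fin n) (X : Coord n) :
    wForm (inChart e H) (cotChart e u) j (flatConn D e u (wVec (inChart e H) b) X) =
      -hForm (inChart e H) (cotChart e u) b (flatConn D e u (hVec (inChart e H) j) X) := by
  have hZ := hH.isRegularOn he
  have hz := (mem_slit_iff he hue).1 hs
  have h1 := flatConn_thetaLoc hD (mem_of_mem_nhds hU) he hue
    ((hZ.contDiffAt_wVec hz b).differentiableAt (by simp))
    ((hZ.contDiffAt_hVec hz j).differentiableAt (by simp)) X
  rw [hZ.thetaLoc_hVec_right hz, hZ.thetaLoc_wVec_left hz] at h1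
  have h2 : (fun z => thetaLoc n (wVec (inChart e H) b z) (hVec (inChart e H) j z))
      =ᶠ[𝓝 (cotChart e u)] fun _ => if j = b then 1 else 0 := by
    filter_upwards [hZ.eventually hz] with y hy
    rw [hZ.thetaLoc_hVec_right hy, wForm_wVec]
  rw [h2.fderiv_eq] at h1
  simp only [fderiv_fun_const, Pi.zero_apply, zero_apply] at h1
  linarith

/-- The e-frame yields the equation for g_{ij}, and the one for g^{ab} follows by inversion. The
coframe components of the frame fields are constant, so the torsion conditions contain the brackets
only through dh^i and dw_b. -/
theorem isCanonicalOmega_flatConn (hH : IsHamiltonFunction H)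
    (hD : IsCanonicalPhiConnection (canonicalPair H) (liftedMetric H) U D)
    (hU : U ∈ 𝓝 u) (hs : u ∈ slit n M) (he : e ∈ IsManifold.maximalAtlas (𝓡 n) ∞ M)
    (hue : u.1 ∈ e.source) :
    IsCanonicalOmega (inChart e H) (cotChart e u) fun i j =>
      hForm (inChart e H) (cotChart e u) i ∘L flatConn D e u (hVec (inChart e H) j) := by
  have hZ := hH.isRegularOn he
  have hz := (mem_slit_iff he hue).1 hs
  have dh := fun j => (hZ.contDiffAt_hVec hz j).differentiableAt (n := ∞) (by simp)
  have dw := fun j => (hZ.contDiffAt_wVec hz j).differentiableAt (n := ∞) (by simp)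
  have low : ∀ i j X, fderiv ℝ (fun y => gLow (inChart e H) y i j) (cotChart e u) X =
      ∑ m, hForm (inChart e H) (cotChart e u) m (flatConn D e u (hVec (inChart e H) i) X) *
        gLow (inChart e H) (cotChart e u) m j +
      ∑ m, hForm (inChart e H) (cotChart e u) m (flatConn D e u (hVec (inChart e H) j) X) *
        gLow (inChart e H) (cotChart e u) i m := by
    intro i j X
    have h1 := flatConn_metricLoc hH hD (mem_of_mem_nhds hU) hs he hue (dh i) (dh j) X
    simp only [metricLoc_hVec] at h1
    rw [h1, hZ.metricLoc_hVec_left hz (wForm_flatConn_hVec hH hD hU hs he hue i X),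
      hZ.metricLoc_hVec_right hz (wForm_flatConn_hVec hH hD hU hs he hue j X)]
  refine ⟨low, fun a b X => (fderiv_gLow_iff hZ hz (Matrix.of fun i j =>
    hForm (inChart e H) (cotChart e u) i (flatConn D e u (hVec (inChart e H) j) X)) X).1
      (fun i j => low i j X) a b, fun i k j => ?_, fun b k j => ?_⟩
  · have h1 := hForm_flatConn_torsion hH hD (mem_of_mem_nhds hU) hs he hue (dh k) (dh j) hU
      (fun z b => wForm_hVec _ z b k) (fun z b => wForm_hVec _ z b j) i
    have h2 := dForm_eq_lieBracket ((hZ.contDiffAt_hForm hz i).differentiableAt (by simp)) (dh k)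
      (dh j)
    simp only [hForm_hVec, fderiv_fun_const, Pi.zero_apply, zero_apply] at h2
    simp only [map_sub] at h1
    simp only [comp_apply]
    linarith
  · have h1 := wForm_flatConn_torsion hH hD (mem_of_mem_nhds hU) hs he hue (dw k) (dw j) hU
      (fun z b => hForm_wVec _ z b k) (fun z b => hForm_wVec _ z b j) b
    have h2 := dForm_eq_lieBracket ((hZ.contDiffAt_wForm hz b).differentiableAt (by simp)) (dw k)
      (dw j)
    simp only [wForm_wVec, fderiv_fun_const, Pi.zero_apply, zero_apply] at h2
    simp only [map_sub, wForm_flatConn_wVec hH hD hU hs he hue] at h1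
    simp only [comp_apply]
    linarith

theorem flatConn_hVec (hH : IsHamiltonFunction H)
    (hD : IsCanonicalPhiConnection (canonicalPair H) (liftedMetric H) U D)
    (hU : U ∈ 𝓝 u) (hs : u ∈ slit n M) (he : e ∈ IsManifold.maximalAtlas (𝓡 n) ∞ M)
    (hue : u.1 ∈ e.source) (j : Fin n) (X : Coord n) :
    flatConn D e u (hVec (inChart e H) j) X =
      ∑ i, omegaLoc (inChart e H) (cotChart e u) i j X • hVec (inChart e H) i (cotChart e u) := by
  have h1 := frame_expand_of_wForm (wForm_flatConn_hVec hH hD hU hs he hue j X)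
  rw [h1]
  refine Finset.sum_congr rfl fun i _ => ?_
  rw [← (isCanonicalOmega_flatConn hH hD hU hs he hue).eq_omegaLoc (hH.isRegularOn he)
    ((mem_slit_iff he hue).1 hs) i j]
  rfl

theorem flatConn_wVec (hH : IsHamiltonFunction H)
    (hD : IsCanonicalPhiConnection (canonicalPair H) (liftedMetric H) U D)
    (hU : U ∈ 𝓝 u) (hs : u ∈ slit n M) (he : e ∈ IsManifold.maximalAtlas (𝓡 n) ∞ M)
    (hue : u.1 ∈ e.source) (b : Fin n) (X : Coord n) :
    flatConn D e u (wVec (inChart e H) b) X =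
      -∑ c, omegaLoc (inChart e H) (cotChart e u) b c X • wVec (inChart e H) c (cotChart e u) := by
  have h1 := frame_expand_of_hForm (hForm_flatConn_wVec hH hD hU hs he hue b X)
  rw [h1, ← Finset.sum_neg_distrib]
  refine Finset.sum_congr rfl fun c _ => ?_
  rw [← (isCanonicalOmega_flatConn hH hD hU hs he hue).eq_omegaLoc (hH.isRegularOn he)
    ((mem_slit_iff he hue).1 hs) b c, wForm_flatConn_wVec hH hD hU hs he hue, neg_smul]
  rfl

theorem dChart_sum_smul (e : OpenPartialHomeomorph M (Base n)) (a : Fin n → ℝ)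
    (X : Fin n → TangentSpace (cotI n) u) :
    dChart e u (∑ i, a i • X i) = ∑ i, a i • dChart e u (X i) := by
  have key : ∀ {E F : Type} [AddCommGroup E] [Module ℝ E] [TopologicalSpace E] [AddCommGroup F]
      [Module ℝ F] [TopologicalSpace F] (f : E →L[ℝ] F) (x : Fin n → E),
      f (∑ i, a i • x i) = ∑ i, a i • f (x i) := by
    intros
    simp
  exact key (dChart e u) X

theorem IsCanonicalPhiConnection.hasCoeffsAt (hH : IsHamiltonFunction H)
    (hD : IsCanonicalPhiConnection (canonicalPair H) (liftedMetric H) U D)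
    (hU : U ∈ 𝓝 u) (hs : u ∈ slit n M) (he : e ∈ IsManifold.maximalAtlas (𝓡 n) ∞ M)
    (hue : u.1 ∈ e.source) : HasCoeffsAt H D e u := by
  have hh : ∀ i, dChart e u (hFrame H e i u) = hVec (inChart e H) i (cotChart e u) :=
    fun i => dChart_ofChart he hue _
  have hw : ∀ i, dChart e u (wFrame H e i u) = wVec (inChart e H) i (cotChart e u) :=
    fun i => dChart_ofChart he hue _
  have Dh : ∀ j X, dChart e u (D (hFrame H e j) u X) = _ := fun j X =>
    (flatConn_dChart he hue D _ X).symm.trans (flatConn_hVec hH hD hU hs he hue j _)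
  have Dw : ∀ j X, dChart e u (D (wFrame H e j) u X) = _ := fun j X =>
    (flatConn_dChart he hue D _ X).symm.trans (flatConn_wVec hH hD hU hs he hue j _)
  refine ⟨fun j k => ?_, fun j k => ?_, fun j k => ?_, fun j k => ?_⟩
  all_goals refine dChart_injective he hue ?_
  · rw [Dh, dChart_sum_smul]
    simp only [hh, omegaLoc_hVec]
  · rw [Dw, dChart_neg, dChart_sum_smul]
    simp only [hh, hw, omegaLoc_hVec]
  · rw [Dh, dChart_sum_smul]
    simp only [hh, hw, omegaLoc_wVec]
  · rw [Dw, dChart_neg, dChart_sum_smul]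
    simp only [hw, omegaLoc_wVec]

/-- Local uniqueness, with a separate neighbourhood for each connection, so that it also compares
the connections of two different charts. -/
theorem IsCanonicalPhiConnection.eq_of_mem_nhds (hH : IsHamiltonFunction H) {U' : Set (Cotangent n M)}
    {D' : Conn n M} (hD : IsCanonicalPhiConnection (canonicalPair H) (liftedMetric H) U D)
    (hD' : IsCanonicalPhiConnection (canonicalPair H) (liftedMetric H) U' D')
    (hU : U ∈ 𝓝 u) (hU' : U' ∈ 𝓝 u) (hs : u ∈ slit n M) {Y : VField n M} (hY : DiffAt Y u) :
    D Y u = D' Y u := by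
  have he := IsManifold.chart_mem_maximalAtlas (I := 𝓡 n) (n := ∞) u.1
  have hue := mem_chart_source (Base n) u.1
  have hm : u ∈ U ∩ U' := ⟨mem_of_mem_nhds hU, mem_of_mem_nhds hU'⟩
  exact HasCoeffsAt.eq hH he hue hs hm (hD.linear.covariant.mono Set.inter_subset_left)
    (hD'.linear.covariant.mono Set.inter_subset_right) (hD.hasCoeffsAt hH hU hs he hue)
    (hD'.hasCoeffsAt hH hU' hs he hue) hY

/-- The domain of a natural chart in the slit cotangent bundle. -/
def slitSource (e : OpenPartialHomeomorph M (Base n)) : Set (Cotangent n M) :=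
  slit n M ∩ {u | u.1 ∈ e.source}

theorem isOpen_slitSource (e : OpenPartialHomeomorph M (Base n)) : IsOpen (slitSource e) :=
  isOpen_slit.inter (isOpen_fst_preimage _ e.open_source)

theorem isCanonicalPhiConnection_connChart (hH : IsHamiltonFunction H)
    (he : e ∈ IsManifold.maximalAtlas (𝓡 n) ∞ M) :
    IsCanonicalPhiConnection (canonicalPair H) (liftedMetric H) (slitSource e) (connChart e H) :=
  isCanonicalPhiConnection_of_eq_connChart hH (isOpen_slitSource e) Set.inter_subset_left
    fun _ hu => ⟨e, he, hu.2, fun _ => rfl, Eventually.of_forall fun _ _ _ => rfl⟩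

/-- The canonical connection of a Hamilton function. -/
def canonicalConn (H : Cotangent n M → ℝ) : Conn n M :=
  fun Y u => connChart (chartAt (Base n) u.1) H Y u

theorem isCanonicalPhiConnection_canonicalConn (hH : IsHamiltonFunction H) :
    IsCanonicalPhiConnection (canonicalPair H) (liftedMetric H) (slit n M) (canonicalConn H) := by
  refine isCanonicalPhiConnection_of_eq_connChart hH isOpen_slit subset_rfl fun u hu =>
    ⟨_, IsManifold.chart_mem_maximalAtlas u.1, mem_chart_source _ u.1, fun _ => rfl, ?_⟩
  filter_upwards [(isOpen_slitSource (chartAt (Base n) u.1)).mem_nhds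
    ⟨hu, mem_chart_source _ u.1⟩] with v hv Y hY
  -- At a nearby point `v` the preferred chart may be another one. Both chart connections are
  -- canonical there, so uniqueness identifies them.
  have hv' : v ∈ slitSource (chartAt (Base n) v.1) := ⟨hv.1, mem_chart_source _ v.1⟩
  exact IsCanonicalPhiConnection.eq_of_mem_nhds hH
    (isCanonicalPhiConnection_connChart hH (IsManifold.chart_mem_maximalAtlas v.1))
    (isCanonicalPhiConnection_connChart hH (IsManifold.chart_mem_maximalAtlas u.1))
    ((isOpen_slitSource _).mem_nhds hv') ((isOpen_slitSource _).mem_nhds hv) hv.1 hY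

end Uniqueness

/-! ### Transport of tensors and connections by a diffeomorphism. -/

section PushForward

variable {n : ℕ} {M : Type*} [TopologicalSpace M] [ChartedSpace (Base n) M]
  [IsManifold (𝓡 n) ∞ M]

theorem isInvertible_mfderiv_diffeomorph
    (f : Cotangent n M ≃ₘ^∞⟮cotI n, cotI n⟯ Cotangent n M) (u : Cotangent n M) :
    (mfderiv (cotI n) (cotI n) f u).IsInvertible :=
  ⟨f.mfderivToContinuousLinearEquiv (by simp) u, rfl⟩

theorem mfderiv_symm_comp_mfderiv (f : Cotangent n M ≃ₘ^∞⟮cotI n, cotI n⟯ Cotangent n M)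
    (v : Cotangent n M) :
    (mfderiv (cotI n) (cotI n) f.symm v ∘L mfderiv (cotI n) (cotI n) f (f.symm v) :
      CotModel n →L[ℝ] CotModel n) = ContinuousLinearMap.id ℝ (CotModel n) := by
  have h1 := (f.mdifferentiable (by simp) (f.symm v)).hasMFDerivAt
  have h2 := (f.symm.mdifferentiable (by simp) (f (f.symm v))).hasMFDerivAt
  have h3 := h2.comp (f.symm v) h1
  have h4 : (f.symm ∘ f : Cotangent n M → Cotangent n M) = id := funext f.symm_apply_apply
  rw [h4] at h3
  have h5 := hasMFDerivAt_unique h3 (hasMFDerivAt_id (f.symm v))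
  rw [f.apply_symm_apply] at h5
  exact h5

theorem mfderiv_symm_mfderiv (f : Cotangent n M ≃ₘ^∞⟮cotI n, cotI n⟯ Cotangent n M)
    (v : Cotangent n M) (X : TangentSpace (cotI n) (f.symm v)) :
    (mfderiv (cotI n) (cotI n) f.symm v (mfderiv (cotI n) (cotI n) f (f.symm v) X :
      CotModel n) : CotModel n) = X :=
  congrArg (fun L : CotModel n →L[ℝ] CotModel n => L X) (mfderiv_symm_comp_mfderiv f v)

/-- The differential of the inverse of a diffeomorphism, between model spaces. -/
def dSymm (f : Cotangent n M ≃ₘ^∞⟮cotI n, cotI n⟯ Cotangent n M) (v : Cotangent n M) :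
    CotModel n →L[ℝ] CotModel n :=
  mfderiv (cotI n) (cotI n) f.symm v

theorem isInvertible_dSymm (f : Cotangent n M ≃ₘ^∞⟮cotI n, cotI n⟯ Cotangent n M)
    (v : Cotangent n M) : (dSymm f v).IsInvertible :=
  isInvertible_mfderiv_diffeomorph f.symm v

theorem inverse_dSymm_dSymm (f : Cotangent n M ≃ₘ^∞⟮cotI n, cotI n⟯ Cotangent n M)
    (v : Cotangent n M) (X : CotModel n) : (dSymm f v).inverse (dSymm f v X) = X := by
  obtain ⟨L, hL⟩ := isInvertible_dSymm f v
  rw [← hL]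
  simp

theorem dSymm_inverse_dSymm (f : Cotangent n M ≃ₘ^∞⟮cotI n, cotI n⟯ Cotangent n M)
    (v : Cotangent n M) (X : CotModel n) : dSymm f v ((dSymm f v).inverse X) = X := by
  obtain ⟨L, hL⟩ := isInvertible_dSymm f v
  rw [← hL]
  simp

theorem dSymm_injective (f : Cotangent n M ≃ₘ^∞⟮cotI n, cotI n⟯ Cotangent n M)
    (v : Cotangent n M) : Function.Injective (dSymm f v) :=
  Function.LeftInverse.injective (inverse_dSymm_dSymm f v)

theorem mfderiv_dSymm (f : Cotangent n M ≃ₘ^∞⟮cotI n, cotI n⟯ Cotangent n M)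
    (v : Cotangent n M) (X : CotModel n) :
    (mfderiv (cotI n) (cotI n) f (f.symm v) (dSymm f v X) : CotModel n) = X :=
  dSymm_injective f v (mfderiv_symm_mfderiv f v _)

theorem mpullback_symm_apply (f : Cotangent n M ≃ₘ^∞⟮cotI n, cotI n⟯ Cotangent n M)
    (Y : VField n M) (v : Cotangent n M) :
    VectorField.mpullback (cotI n) (cotI n) f Y (f.symm v) = dSymm f v (Y v) := by
  obtain ⟨L, hL⟩ := isInvertible_mfderiv_diffeomorph f (f.symm v)
  have h1 : mfderiv (cotI n) (cotI n) f (f.symm v) (dSymm f v (Y v)) = Y (f (f.symm v)) :=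
    (mfderiv_dSymm f v (Y v)).trans
      (congrArg (fun w => (Y w : CotModel n)) (f.apply_symm_apply v)).symm
  rw [VectorField.mpullback_apply, ← h1, ← hL, ContinuousLinearMap.inverse_equiv]
  exact L.symm_apply_apply _

/-- The endomorphism field `φ'` corresponds to `φ` under the diffeomorphism `f`. -/
def EndoRelated (f : Cotangent n M ≃ₘ^∞⟮cotI n, cotI n⟯ Cotangent n M) (φ φ' : EndoField n M) :
    Prop :=
  ∀ (v : Cotangent n M) (X : CotModel n), dSymm f v (φ' v X) = φ (f.symm v) (dSymm f v X)

/-- The field of bilinear forms `g'` corresponds to `g` under the diffeomorphism `f`. -/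
def FormRelated (f : Cotangent n M ≃ₘ^∞⟮cotI n, cotI n⟯ Cotangent n M) (g g' : FormField n M) :
    Prop :=
  ∀ (v : Cotangent n M) (X Y : CotModel n), g' v X Y = g (f.symm v) (dSymm f v X) (dSymm f v Y)

/-- The connection `D'` corresponds to `D` under the diffeomorphism `f`. -/
def ConnRelated (f : Cotangent n M ≃ₘ^∞⟮cotI n, cotI n⟯ Cotangent n M) (D D' : Conn n M) :
    Prop :=
  ∀ (Y : VField n M) (v : Cotangent n M) (X : CotModel n), dSymm f v (D' Y v X) =
    D (VectorField.mpullback (cotI n) (cotI n) f Y) (f.symm v) (dSymm f v X)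

end PushForward

theorem clm_half_add {E F : Type*} [AddCommGroup E] [Module ℝ E] [TopologicalSpace E]
    [AddCommGroup F] [Module ℝ F] [TopologicalSpace F] (L : E →L[ℝ] F) (X Y : E) :
    L ((1 / 2 : ℝ) • (X + Y)) = (1 / 2 : ℝ) • (L X + L Y) := by
  rw [L.map_smul, L.map_add]

theorem clm_half_sub {E F : Type*} [AddCommGroup E] [Module ℝ E] [TopologicalSpace E]
    [AddCommGroup F] [Module ℝ F] [TopologicalSpace F] (L : E →L[ℝ] F) (X Y : E) :
    L ((1 / 2 : ℝ) • (X - Y)) = (1 / 2 : ℝ) • (L X - L Y) := by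
  rw [L.map_smul, L.map_sub]

theorem clm_map_sub_sub {E F : Type*} [AddCommGroup E] [Module ℝ E] [TopologicalSpace E]
    [AddCommGroup F] [Module ℝ F] [TopologicalSpace F] (L : E →L[ℝ] F) (X Y Z : E) :
    L (X - Y - Z) = L X - L Y - L Z := by
  rw [L.map_sub, L.map_sub]

section PushForward

variable {n : ℕ} {M : Type*} [TopologicalSpace M] [ChartedSpace (Base n) M]
  [IsManifold (𝓡 n) ∞ M] {f : Cotangent n M ≃ₘ^∞⟮cotI n, cotI n⟯ Cotangent n M}
  {φ φ' : EndoField n M} {g g' : FormField n M} {U U' : Set (Cotangent n M)} {D D' : Conn n M}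

theorem DiffAt.mpullback (f : Cotangent n M ≃ₘ^∞⟮cotI n, cotI n⟯ Cotangent n M)
    {Y : VField n M} {v : Cotangent n M} (hY : DiffAt Y v) :
    DiffAt (VectorField.mpullback (cotI n) (cotI n) f Y) (f.symm v) := by
  rw [← f.apply_symm_apply v] at hY
  exact MDifferentiableAt.mpullback_vectorField (n := ∞) hY (f.contMDiff _)
    (isInvertible_mfderiv_diffeomorph f _) two_le_infty

theorem contMDiffAt_mpullback (f : Cotangent n M ≃ₘ^∞⟮cotI n, cotI n⟯ Cotangent n M)
    {Y : VField n M} {v : Cotangent n M}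
    (hY : ContMDiffAt (cotI n) ((cotI n).prod 𝓘(ℝ, CotModel n)) ∞
      (fun v => TotalSpace.mk' (CotModel n) v (Y v)) v) :
    ContMDiffAt (cotI n) ((cotI n).prod 𝓘(ℝ, CotModel n)) ∞
      (fun u => TotalSpace.mk' (CotModel n) u
        (VectorField.mpullback (cotI n) (cotI n) f Y u)) (f.symm v) := by
  rw [← f.apply_symm_apply v] at hY
  exact ContMDiffAt.mpullback_vectorField_preimage (n := ∞) hY (f.contMDiff _)
    (isInvertible_mfderiv_diffeomorph f _) (by simp)

theorem mpullback_endo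
    (hφ : EndoRelated f φ φ') (Y : VField n M) :
    VectorField.mpullback (cotI n) (cotI n) f (fun v => φ' v (Y v)) =
      fun u => φ u (VectorField.mpullback (cotI n) (cotI n) f Y u) := by
  funext u
  obtain ⟨v, rfl⟩ : ∃ v, f.symm v = u := ⟨f u, f.symm_apply_apply u⟩
  exact (mpullback_symm_apply f _ v).trans ((hφ v (Y v)).trans
    (congrArg (φ (f.symm v)) (mpullback_symm_apply f Y v).symm))

theorem mvfderiv_apply_of_not_mdifferentiableAt {ψ : Cotangent n M → ℝ} {u : Cotangent n M}
    (h : ¬ MDifferentiableAt (cotI n) 𝓘(ℝ, ℝ) ψ u) (X : TangentSpace (cotI n) u) :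
    mvfderiv (cotI n) ψ u X = 0 := by
  rw [mvfderiv, mfderiv_zero_of_not_mdifferentiableAt h]
  rfl

/-- The chain rule for a diffeomorphism, without differentiability of ψ: otherwise neither function
is differentiable and both derivatives are zero by default. This allows arbitrary fields of forms
below. -/
theorem mvfderiv_comp_symm (f : Cotangent n M ≃ₘ^∞⟮cotI n, cotI n⟯ Cotangent n M)
    (ψ : Cotangent n M → ℝ) (v : Cotangent n M) (X : TangentSpace (cotI n) v) :
    mvfderiv (cotI n) (fun v => ψ (f.symm v)) v X =
      mvfderiv (cotI n) ψ (f.symm v) (dSymm f v X) := by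
  have hs := f.symm.mdifferentiable (by simp) v
  by_cases h : MDifferentiableAt (cotI n) 𝓘(ℝ, ℝ) ψ (f.symm v)
  · have h1 : mfderiv (cotI n) 𝓘(ℝ, ℝ) (fun v => ψ (f.symm v)) v = _ :=
      (h.hasMFDerivAt.comp v hs.hasMFDerivAt).mfderiv
    rw [mvfderiv, mvfderiv, h1]
    rfl
  · have h' : ¬ MDifferentiableAt (cotI n) 𝓘(ℝ, ℝ) (fun v => ψ (f.symm v)) v := by
      intro h'
      apply h
      have h1 : MDifferentiableAt (cotI n) 𝓘(ℝ, ℝ) (fun v => ψ (f.symm v)) (f (f.symm v)) := by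
        rwa [f.apply_symm_apply]
      have h2 : (fun v => ψ (f.symm v)) ∘ f = ψ := funext fun u => by
        simp only [Function.comp_apply, f.symm_apply_apply]
      rw [← h2]
      exact MDifferentiableAt.comp (I' := cotI n) (f.symm v) h1
        (f.mdifferentiable (by simp) (f.symm v))
    exact (mvfderiv_apply_of_not_mdifferentiableAt h' X).trans
      (mvfderiv_apply_of_not_mdifferentiableAt h _).symm

theorem EndoRelated.hProj (hφ : EndoRelated f φ φ') : EndoRelated f (hProj φ) (hProj φ') :=
  fun v X => (clm_half_add (dSymm f v) X (φ' v X)).trans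
    (congrArg (fun Z : CotModel n => (1 / 2 : ℝ) • (dSymm f v X + Z)) (hφ v X))

theorem EndoRelated.wProj (hφ : EndoRelated f φ φ') : EndoRelated f (wProj φ) (wProj φ') :=
  fun v X => (clm_half_sub (dSymm f v) X (φ' v X)).trans
    (congrArg (fun Z : CotModel n => (1 / 2 : ℝ) • (dSymm f v X - Z)) (hφ v X))

theorem ConnRelated.parallelEndo (hD : ConnRelated f D D') (hφ : EndoRelated f φ φ')
    (hU : ∀ v ∈ U', f.symm v ∈ U) (h : ParallelEndo D φ U) : ParallelEndo D' φ' U' := by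
  intro v hv Y hY X
  refine dSymm_injective f v ((hD _ v X).trans (Eq.trans ?_
    ((hφ v _).trans (congrArg (φ (f.symm v)) (hD Y v X))).symm))
  rw [mpullback_endo hφ]
  exact h _ (hU v hv) _ (hY.mpullback f) _

theorem FormRelated.apply_eq (hg : FormRelated f g g') {v : Cotangent n M} {X Y X' Y' : CotModel n}
    (hX : dSymm f v X = X') (hY : dSymm f v Y = Y') : g' v X Y = g (f.symm v) X' Y' :=
  (hg v X Y).trans (congrArg₂ (fun A B : CotModel n => g (f.symm v) A B) hX hY)

/-- The function g'(Y,Z) is the function of the pulled-back fields composed with f⁻¹, so each term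
of the identity is transported by the chain rule. -/
theorem ConnRelated.parallelForm (hD : ConnRelated f D D') (hg : FormRelated f g g')
    (hU : ∀ v ∈ U', f.symm v ∈ U) (h : ParallelForm D g U) : ParallelForm D' g' U' := by
  intro v hv Y Z hY hZ X
  have h1 : (fun v => g' v (Y v) (Z v)) = fun v => (fun u =>
      g u (VectorField.mpullback (cotI n) (cotI n) f Y u)
        (VectorField.mpullback (cotI n) (cotI n) f Z u)) (f.symm v) := by
    funext v
    exact hg.apply_eq (mpullback_symm_apply f Y v).symm (mpullback_symm_apply f Z v).symm
  rw [h1]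
  refine (mvfderiv_comp_symm f _ v X).trans
    ((h _ (hU v hv) _ _ (hY.mpullback f) (hZ.mpullback f) _).trans (congrArg₂ (· + ·) ?_ ?_))
  · exact (hg.apply_eq (hD Y v X) (mpullback_symm_apply f Z v).symm).symm
  · exact (hg.apply_eq (mpullback_symm_apply f Y v).symm (hD Z v X)).symm

theorem ConnRelated.apply_eq (hD : ConnRelated f D D') (X Y : VField n M) (v : Cotangent n M) :
    dSymm f v (D' Y v (X v)) = D (VectorField.mpullback (cotI n) (cotI n) f Y) (f.symm v)
      (VectorField.mpullback (cotI n) (cotI n) f X (f.symm v)) :=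
  (hD Y v (X v)).trans (congrArg (D (VectorField.mpullback (cotI n) (cotI n) f Y) (f.symm v))
    (mpullback_symm_apply f X v).symm)

/-- The two covariant terms correspond by relatedness, the third by naturality of the bracket. -/
theorem ConnRelated.torsion (hD : ConnRelated f D D') {X Y : VField n M} {v : Cotangent n M}
    (hX : DiffAt X v) (hY : DiffAt Y v) :
    dSymm f v (torsion D' X Y v) =
      torsion D (VectorField.mpullback (cotI n) (cotI n) f X)
        (VectorField.mpullback (cotI n) (cotI n) f Y) (f.symm v) := by
  have : IsManifold (cotI n) (minSmoothness ℝ 2) (Cotangent n M) := by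
    rw [minSmoothness_of_isRCLikeNormedField]
    infer_instance
  rw [← f.apply_symm_apply v] at hX hY
  have h := VectorField.mpullback_mlieBracket (n := ∞) (I := cotI n) (I' := cotI n)
    (f := f) (x₀ := f.symm v) (V := X) (W := Y) hX hY (f.contMDiff _)
    (by rw [minSmoothness_of_isRCLikeNormedField]; exact two_le_infty)
  exact (clm_map_sub_sub (dSymm f v) (D' Y v (X v)) (D' X v (Y v))
    (VectorField.mlieBracket (cotI n) X Y v)).trans (congrArg₂ (fun A B : CotModel n => A - B)
      (congrArg₂ (fun A B : CotModel n => A - B) (hD.apply_eq X Y v) (hD.apply_eq Y X v))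
      ((mpullback_symm_apply f _ v).symm.trans h))

end PushForward

theorem clm_map_smul_add_smul {E F : Type*} [AddCommGroup E] [Module ℝ E] [TopologicalSpace E]
    [AddCommGroup F] [Module ℝ F] [TopologicalSpace F] (L : E →L[ℝ] F) (a b : ℝ) (X Y : E) :
    L (a • X + b • Y) = a • L X + b • L Y := by
  rw [L.map_add, L.map_smul, L.map_smul]

section PushForward

variable {n : ℕ} {M : Type*} [TopologicalSpace M] [ChartedSpace (Base n) M]
  [IsManifold (𝓡 n) ∞ M] {f : Cotangent n M ≃ₘ^∞⟮cotI n, cotI n⟯ Cotangent n M}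
  {φ φ' : EndoField n M} {g g' : FormField n M} {U U' : Set (Cotangent n M)} {D D' : Conn n M} {u : Cotangent n M}

/-- The points f(f⁻¹(v)) and v are equal but not definitionally so; vectors are compared in the
model space. -/
theorem theta_congr {u v : Cotangent n M} (h : u = v) {X X' Y Y' : CotModel n} (hX : X = X')
    (hY : Y = Y') : theta n M u (X : TangentSpace (cotI n) u) (Y : TangentSpace (cotI n) u) =
      theta n M v (X' : TangentSpace (cotI n) v) (Y' : TangentSpace (cotI n) v) := by
  subst h hX hY
  rfl

theorem IsSymplecticMorphism.formRelated (hf : IsSymplecticMorphism f) :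
    FormRelated f (theta n M) (theta n M) := fun v X Y =>
  (theta_congr (f.apply_symm_apply v) (mfderiv_dSymm f v X)
    (mfderiv_dSymm f v Y)).symm.trans (hf (f.symm v) _ _)

theorem IsSymplecticMorphism.symm (hf : IsSymplecticMorphism f) : IsSymplecticMorphism f.symm :=
  fun v X Y => (hf.formRelated v X Y).symm

set_option maxHeartbeats 1000000 in
theorem ConnRelated.isCovariantDerivativeOn (hD : ConnRelated f D D')
    (hU : ∀ v ∈ U', f.symm v ∈ U) (h : IsCovariantDerivativeOn (I := cotI n) (CotModel n) D U) :
    IsCovariantDerivativeOn (I := cotI n) (CotModel n) D' U' where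
  add {Y Y' v} hY hY' hv := by
    ext1 X
    refine dSymm_injective f v ((hD _ v X).trans ?_)
    have h1 := h.add (DiffAt.mpullback f hY) (DiffAt.mpullback f hY') (hU v hv)
    rw [VectorField.mpullback_add, h1]
    exact (((dSymm f v).map_add (D' Y v X) (D' Y' v X)).trans
      (congrArg₂ (fun A B : CotModel n => A + B) (hD Y v X) (hD Y' v X))).symm
  leibniz {Y ψ v} hY hψ hv := by
    ext1 X
    refine dSymm_injective f v ((hD _ v X).trans ?_)
    have h1 : MDifferentiableAt (cotI n) 𝓘(ℝ, ℝ) (ψ ∘ f) (f.symm v) :=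
      MDifferentiableAt.comp (I' := cotI n) (f.symm v) (by rwa [f.apply_symm_apply])
        (f.mdifferentiable (by simp) (f.symm v))
    have h2 := h.leibniz (DiffAt.mpullback f hY) h1 (hU v hv)
    have h3 := mvfderiv_comp_symm f (ψ ∘ f) v X
    simp only [Function.comp_apply, f.apply_symm_apply] at h3
    have h4 : (ψ ∘ f) (f.symm v) = ψ v := congrArg ψ (f.apply_symm_apply v)
    rw [VectorField.mpullback_smul, h2, h4]
    exact ((clm_map_smul_add_smul (dSymm f v) (ψ v) (mvfderiv (cotI n) ψ v X) (D' Y v X)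
      (Y v)).trans (congrArg₂ (fun A B : CotModel n => A + B)
        (congrArg (fun A : CotModel n => ψ v • A) (hD Y v X))
        (congrArg₂ (fun (a : ℝ) (A : CotModel n) => a • A) h3
          (mpullback_symm_apply f Y v).symm))).symm

set_option synthInstance.maxHeartbeats 200000 in
set_option maxHeartbeats 1000000 in
theorem ConnRelated.contMDiffOn (hD : ConnRelated f D D') (hU : ∀ v, v ∈ U' ↔ f.symm v ∈ U)
    (ho : IsOpen U)
    (h : ContMDiffCovariantDerivativeOn (I := cotI n) (CotModel n) ∞ D U) {Y : VField n M}
    (hY : ContMDiffOn (cotI n) ((cotI n).prod 𝓘(ℝ, CotModel n)) ∞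
      (fun v => TotalSpace.mk' (CotModel n) v (Y v)) U') :
    ContMDiffOn (cotI n) ((cotI n).prod 𝓘(ℝ, CotModel n →L[ℝ] CotModel n)) ∞
      (fun v => (⟨v, D' Y v⟩ : TotalSpace (CotModel n →L[ℝ] CotModel n)
        fun v : Cotangent n M => TangentSpace (cotI n) v →L[ℝ] TangentSpace (cotI n) v)) U' := by
  have ho' : IsOpen U' := by
    have : U' = f.symm ⁻¹' U := Set.ext hU
    rw [this]
    exact ho.preimage f.symm.continuous
  have h1 : ContMDiffOn (cotI n) ((cotI n).prod 𝓘(ℝ, CotModel n)) ∞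
      (fun u => TotalSpace.mk' (CotModel n) u
        (VectorField.mpullback (cotI n) (cotI n) f Y u)) U := by
    intro u hu
    obtain ⟨v, rfl⟩ : ∃ v, f.symm v = u := ⟨f u, f.symm_apply_apply u⟩
    have hv := (hU v).2 hu
    exact (contMDiffAt_mpullback f
      ((hY v hv).contMDiffAt (ho'.mem_nhds hv))).contMDiffWithinAt
  have h2 := h.contMDiff h1
  intro v hv
  have h3 := contMDiffAt_conj_mfderiv (f.symm.contMDiff v)
    (isInvertible_mfderiv_diffeomorph f.symm v)
    ((h2 (f.symm v) ((hU v).1 hv)).contMDiffAt (ho.mem_nhds ((hU v).1 hv)))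
  refine (h3.congr_of_eventuallyEq (Eventually.of_forall fun w => ?_)).contMDiffWithinAt
  have h4 : D' Y w = (mfderiv (cotI n) (cotI n) f.symm w).inverse ∘L
      D (VectorField.mpullback (cotI n) (cotI n) f Y) (f.symm w) ∘L
      mfderiv (cotI n) (cotI n) f.symm w := by
    ext1 X
    exact (inverse_dSymm_dSymm f w (D' Y w X)).symm.trans
      (congrArg (dSymm f w).inverse (hD Y w X))
  rw [h4]

set_option synthInstance.maxHeartbeats 200000 in
set_option maxHeartbeats 1000000 in
theorem ConnRelated.isLinearConnection (hD : ConnRelated f D D')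
    (hU : ∀ v, v ∈ U' ↔ f.symm v ∈ U) (ho : IsOpen U) (h : IsLinearConnection D U) :
    IsLinearConnection D' U' where
  covariant := hD.isCovariantDerivativeOn (fun v => (hU v).1) h.covariant
  smooth := ⟨fun hY => hD.contMDiffOn hU ho h.smooth hY⟩

theorem mpullback_symm_mpullback (f : Cotangent n M ≃ₘ^∞⟮cotI n, cotI n⟯ Cotangent n M)
    (Y : VField n M) : VectorField.mpullback (cotI n) (cotI n) f.symm
      (VectorField.mpullback (cotI n) (cotI n) f Y) = Y := by
  funext v
  exact (congrArg (dSymm f v).inverse (mpullback_symm_apply f Y v)).trans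
    (inverse_dSymm_dSymm f v (Y v))

theorem diffAt_of_mpullback {Y : VField n M} {v : Cotangent n M}
    (h : DiffAt (VectorField.mpullback (cotI n) (cotI n) f Y) (f.symm v)) : DiffAt Y v := by
  have h1 := DiffAt.mpullback f.symm h
  rw [mpullback_symm_mpullback] at h1
  rw [← f.apply_symm_apply v]
  exact h1

theorem EndoRelated.diffAt (hφ : EndoRelated f φ φ')
    (h : ∀ Y : VField n M, DiffAt Y u → DiffAt (fun u => φ u (Y u)) u) {v : Cotangent n M}
    (hu : f.symm v = u) {Y : VField n M} (hY : DiffAt Y v) :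
    DiffAt (fun v => φ' v (Y v)) v := by
  subst hu
  refine diffAt_of_mpullback (f := f) ?_
  rw [mpullback_endo hφ]
  exact h _ (hY.mpullback f)

/-- Applied to both projections. The hypothesis `hd` guarantees that projected fields stay
differentiable, which naturality of their bracket requires. -/
theorem ConnRelated.torsion_eq_zero (hD : ConnRelated f D D') (hφ : EndoRelated f φ φ')
    (hU : ∀ v ∈ U', f.symm v ∈ U)
    (hd : ∀ u ∈ U, ∀ Y : VField n M, DiffAt Y u → DiffAt (fun u => φ u (Y u)) u)
    (h : ∀ u ∈ U, ∀ X Y : VField n M, DiffAt X u → DiffAt Y u →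
      φ u (HamiltonGeometry.torsion D (fun v => φ v (X v)) (fun v => φ v (Y v)) u) = 0) :
    ∀ v ∈ U', ∀ X Y : VField n M, DiffAt X v → DiffAt Y v →
      φ' v (HamiltonGeometry.torsion D' (fun v => φ' v (X v)) (fun v => φ' v (Y v)) v) = 0 := by
  intro v hv X Y hX hY
  refine dSymm_injective f v (Eq.trans ?_ (dSymm f v).map_zero.symm)
  refine (hφ v _).trans ((congrArg (φ (f.symm v)) (hD.torsion
    (hφ.diffAt (hd _ (hU v hv)) rfl hX) (hφ.diffAt (hd _ (hU v hv)) rfl hY))).trans ?_)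
  rw [mpullback_endo hφ, mpullback_endo hφ]
  exact h _ (hU v hv) _ _ (hX.mpullback f) (hY.mpullback f)

/-- Each defining condition is natural; the condition on θ survives because a symplectic morphism
relates θ to itself. -/
theorem IsCanonicalPhiConnection.of_related (hf : IsSymplecticMorphism f)
    (hφ : EndoRelated f φ φ') (hg : FormRelated f g g') (hD : ConnRelated f D D')
    (hU : ∀ v, v ∈ U' ↔ f.symm v ∈ U) (ho : IsOpen U)
    (hdh : ∀ u ∈ U, ∀ Y : VField n M, DiffAt Y u → DiffAt (fun u => hProj φ u (Y u)) u)
    (hdw : ∀ u ∈ U, ∀ Y : VField n M, DiffAt Y u → DiffAt (fun u => wProj φ u (Y u)) u)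
    (h : IsCanonicalPhiConnection φ g U D) : IsCanonicalPhiConnection φ' g' U' D' where
  linear := hD.isLinearConnection hU ho h.linear
  parallel_phi := hD.parallelEndo hφ (fun v => (hU v).1) h.parallel_phi
  parallel_w := hD.parallelEndo hφ.wProj (fun v => (hU v).1) h.parallel_w
  metric := hD.parallelForm hg (fun v => (hU v).1) h.metric
  symplectic := hD.parallelForm hf.formRelated (fun v => (hU v).1) h.symplectic
  torsion_h := hD.torsion_eq_zero hφ.hProj (fun v => (hU v).1) hdh h.torsion_h
  torsion_w := hD.torsion_eq_zero hφ.wProj (fun v => (hU v).1) hdw h.torsion_w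

end PushForward

/-- Injectivity of L on the fixed space of P gives a trivial intersection; if the fixed space
already attains every value of L, subtracting a fixed vector leaves an element of ker L. -/
theorem isCompl_ker_of_bijective {E F : Type*} [AddCommGroup E] [Module ℝ E] [TopologicalSpace E]
    [IsTopologicalAddGroup E] [AddCommGroup F] [Module ℝ F] [TopologicalSpace F] {P : E →L[ℝ] E}
    {L : E →L[ℝ] F} (hinj : ∀ X, P X = X → L X = 0 → X = 0)
    (hsurj : ∀ X, ∃ Y, P Y = Y ∧ L Y = L X) :
    IsCompl (LinearMap.ker (ContinuousLinearMap.id ℝ E - P).toLinearMap)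
      (LinearMap.ker L.toLinearMap) := by
  have h1 : ∀ X, X ∈ LinearMap.ker (ContinuousLinearMap.id ℝ E - P).toLinearMap ↔ P X = X :=
    fun X => LinearMap.mem_ker.trans (sub_eq_zero.trans eq_comm)
  refine ⟨Submodule.disjoint_def.2 fun X hX hX' => hinj X ((h1 X).1 hX) hX',
    codisjoint_iff.2 (eq_top_iff.2 fun X _ => ?_)⟩
  obtain ⟨Y, hY, hYX⟩ := hsurj X
  refine Submodule.mem_sup.2 ⟨Y, (h1 Y).2 hY, X - Y, ?_, add_sub_cancel Y X⟩
  change L (X - Y) = 0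
  rw [L.map_sub, hYX, sub_self]

section PushForward

variable {n : ℕ} {M : Type*} [TopologicalSpace M] [ChartedSpace (Base n) M]
  [IsManifold (𝓡 n) ∞ M] {f : Cotangent n M ≃ₘ^∞⟮cotI n, cotI n⟯ Cotangent n M}
  {φ φ' : EndoField n M} {g g' : FormField n M} {U U' : Set (Cotangent n M)} {D D' : Conn n M}
  {H : Cotangent n M → ℝ}

theorem endoRelated_pushEndo (f : Cotangent n M ≃ₘ^∞⟮cotI n, cotI n⟯ Cotangent n M)
    (φ : EndoField n M) : EndoRelated f φ (pushEndo f φ) :=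
  fun v _ => dSymm_inverse_dSymm f v _

theorem formRelated_pushForm (f : Cotangent n M ≃ₘ^∞⟮cotI n, cotI n⟯ Cotangent n M)
    (g : FormField n M) : FormRelated f g (pushForm f g) :=
  fun _ _ _ => rfl

theorem connRelated_pushConn (f : Cotangent n M ≃ₘ^∞⟮cotI n, cotI n⟯ Cotangent n M)
    (D : Conn n M) : ConnRelated f D (pushConn f D) :=
  fun _ v _ => dSymm_inverse_dSymm f v _

theorem mem_image_diffeomorph_iff (f : Cotangent n M ≃ₘ^∞⟮cotI n, cotI n⟯ Cotangent n M)
    (U : Set (Cotangent n M)) (v : Cotangent n M) : v ∈ f '' U ↔ f.symm v ∈ U := by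
  constructor
  · rintro ⟨u, hu, rfl⟩
    rwa [f.symm_apply_apply]
  · exact fun h => ⟨f.symm v, h, f.apply_symm_apply v⟩

theorem endo_congr (φ : EndoField n M) {u v : Cotangent n M} (h : u = v) {X X' : CotModel n}
    (hX : X = X') : (φ u X : CotModel n) = φ v X' := by
  subst h hX
  rfl

theorem form_congr (g : FormField n M) {u v : Cotangent n M} (h : u = v) {X X' Y Y' : CotModel n}
    (hX : X = X') (hY : Y = Y') : g u X Y = g v X' Y' := by
  subst h hX hY
  rfl

theorem dSymm_dSymm_symm (f : Cotangent n M ≃ₘ^∞⟮cotI n, cotI n⟯ Cotangent n M)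
    (u : Cotangent n M) (X : CotModel n) : dSymm f (f u) (dSymm f.symm u X) = X := by
  obtain ⟨v, rfl⟩ : ∃ v, f.symm v = u := ⟨f u, f.symm_apply_apply u⟩
  have h := mfderiv_symm_mfderiv f v X
  rw [f.apply_symm_apply]
  exact h

theorem EndoRelated.symm (h : EndoRelated f φ φ') : EndoRelated f.symm φ' φ := by
  intro u X
  refine dSymm_injective f (f u) ((dSymm_dSymm_symm f u _).trans (Eq.symm ?_))
  exact (h (f u) (dSymm f.symm u X)).trans
    (endo_congr φ (f.symm_apply_apply u) (dSymm_dSymm_symm f u X))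

theorem FormRelated.symm (h : FormRelated f g g') : FormRelated f.symm g' g := by
  intro u X Y
  exact ((h (f u) (dSymm f.symm u X) (dSymm f.symm u Y)).trans
    (form_congr g (f.symm_apply_apply u) (dSymm_dSymm_symm f u X)
      (dSymm_dSymm_symm f u Y))).symm

theorem isCanonicalPhiConnection_pushConn (hf : IsSymplecticMorphism f) (hH : IsHamiltonFunction H)
    (h : IsCanonicalPhiConnection (canonicalPair H) (liftedMetric H) (slit n M) D) :
    IsCanonicalPhiConnection (pushEndo f (canonicalPair H)) (pushForm f (liftedMetric H))
      (f '' slit n M) (pushConn f D) :=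
  h.of_related hf (endoRelated_pushEndo f _) (formRelated_pushForm f _) (connRelated_pushConn f _)
    (mem_image_diffeomorph_iff f _) isOpen_slit
    (fun u hu _ hY => diffAt_hProj hH (IsManifold.chart_mem_maximalAtlas u.1)
      (mem_chart_source _ u.1) hu hY)
    (fun u hu _ hY => diffAt_wProj hH (IsManifold.chart_mem_maximalAtlas u.1)
      (mem_chart_source _ u.1) hu hY)

theorem isCanonicalPhiConnection_of_pushForward (hf : IsSymplecticMorphism f)
    (hH : IsHamiltonFunction H)
    (h : IsCanonicalPhiConnection (pushEndo f (canonicalPair H)) (pushForm f (liftedMetric H))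
      (f '' slit n M) D') :
    IsCanonicalPhiConnection (canonicalPair H) (liftedMetric H) (slit n M)
      (pushConn f.symm D') := by
  refine h.of_related hf.symm (endoRelated_pushEndo f _).symm (formRelated_pushForm f _).symm
    (connRelated_pushConn f.symm _) (fun u => ?_) ?_ (fun v hv Y hY => ?_) fun v hv Y hY => ?_
  · rw [mem_image_diffeomorph_iff]
    exact iff_of_eq (congrArg (· ∈ slit n M) (f.symm_apply_apply u).symm)
  · have : f '' slit n M = f.symm ⁻¹' slit n M := Set.ext (mem_image_diffeomorph_iff f _)
    rw [this]
    exact isOpen_slit.preimage f.symm.continuous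
  · exact (endoRelated_pushEndo f (canonicalPair H)).hProj.diffAt
      (fun _ hY => diffAt_hProj hH (IsManifold.chart_mem_maximalAtlas (f.symm v).1)
        (mem_chart_source _ _) ((mem_image_diffeomorph_iff f _ v).1 hv) hY) rfl hY
  · exact (endoRelated_pushEndo f (canonicalPair H)).wProj.diffAt
      (fun _ hY => diffAt_wProj hH (IsManifold.chart_mem_maximalAtlas (f.symm v).1)
        (mem_chart_source _ _) ((mem_image_diffeomorph_iff f _ v).1 hv) hY) rfl hY

/-- A competitor on the image is carried back by f⁻¹ to a canonical connection of H, where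
uniqueness is known, and the resulting equality is pushed forward. -/
theorem sameOn_pushConn (hf : IsSymplecticMorphism f) (hH : IsHamiltonFunction H)
    (h : IsCanonicalPhiConnection (canonicalPair H) (liftedMetric H) (slit n M) D)
    (h' : IsCanonicalPhiConnection (pushEndo f (canonicalPair H)) (pushForm f (liftedMetric H))
      (f '' slit n M) D') : SameOn D' (pushConn f D) (f '' slit n M) := by
  intro v hv Y hY
  have hs := (mem_image_diffeomorph_iff f _ v).1 hv
  have h1 := (isCanonicalPhiConnection_of_pushForward hf hH h').eq_of_mem_nhds hH h
    (isOpen_slit.mem_nhds hs) (isOpen_slit.mem_nhds hs) hs (hY.mpullback f)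
  ext1 X
  refine dSymm_injective f v (Eq.trans ?_ (connRelated_pushConn f D Y v X).symm)
  rw [← h1]
  have h2 := connRelated_pushConn f.symm D' (VectorField.mpullback (cotI n) (cotI n) f Y)
    (f.symm v) (dSymm f v X)
  rw [mpullback_symm_mpullback] at h2
  exact (congrArg (dSymm f v) (h2.trans (endo_congr (D' Y) (f.apply_symm_apply v)
    (mfderiv_dSymm f v X))).symm).trans (mfderiv_symm_mfderiv f v _)

theorem mfderiv_fst_dSymm (f : Cotangent n M ≃ₘ^∞⟮cotI n, cotI n⟯ Cotangent n M)
    (v : Cotangent n M) (X : CotModel n) :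
    (mfderiv (cotI n) (𝓡 n) (fun w : Cotangent n M => (f w).1) (f.symm v) (dSymm f v X) :
      Base n) = mfderiv (cotI n) (𝓡 n) (fun w : Cotangent n M => w.1) v X := by
  have hp : MDifferentiable (cotI n) (𝓡 n) (fun w : Cotangent n M => w.1) :=
    (Bundle.contMDiff_proj (n := ∞) _).mdifferentiable (by simp)
  have h1 : MDifferentiableAt (cotI n) (𝓡 n) (fun w : Cotangent n M => (f w).1) (f.symm v) :=
    MDifferentiableAt.comp (I' := cotI n) (f.symm v) (hp _) (f.mdifferentiable (by simp) _)
  have h2 := h1.hasMFDerivAt.comp v (f.symm.mdifferentiable (by simp) v).hasMFDerivAt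
  have h3 : (fun w : Cotangent n M => (f w).1) ∘ f.symm = fun w : Cotangent n M => w.1 :=
    funext fun w => congrArg (fun w : Cotangent n M => w.1) (f.apply_symm_apply w)
  rw [h3] at h2
  exact congrArg (fun L : CotModel n →L[ℝ] Base n => L X)
    (hasMFDerivAt_unique h2 (hp v).hasMFDerivAt)

/-- Through df⁻¹ the projection dπ on the pushed horizontal space becomes d(π ∘ f) on the original
one, so regularity is precisely the transversality needed. Isotropy is preserved because θ is. -/
theorem isConnectionPair_pushEndo (hf : IsSymplecticMorphism f)
    (h : IsConnectionPair φ U) (hr : IsRegularFor φ U f) :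
    IsConnectionPair (pushEndo f φ) (f '' U) := by
  have hφ := endoRelated_pushEndo f φ
  have hU := fun v => (mem_image_diffeomorph_iff f U v).1
  refine ⟨fun v hv X => ?_, fun v hv => ?_, fun v hv X Y hX hY => ?_, fun v hv X Y hX hY => ?_⟩
  · exact dSymm_injective f v ((hφ v _).trans ((congrArg (φ (f.symm v)) (hφ v X)).trans
      (h.involutive _ (hU v hv) _)))
  · refine isCompl_ker_of_bijective (fun X hX hX' => ?_) fun X => ?_
    · have h1 := (hr _ (hU v hv)).1
        (a₁ := ⟨dSymm f v X, (hφ v X).symm.trans (congrArg (dSymm f v) hX)⟩)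
        (a₂ := ⟨0, (φ (f.symm v)).map_zero⟩)
        ((mfderiv_fst_dSymm f v X).trans (hX'.trans (ContinuousLinearMap.map_zero _).symm))
      exact dSymm_injective f v ((congrArg Subtype.val h1).trans (dSymm f v).map_zero.symm)
    · obtain ⟨⟨Y, hY⟩, hY'⟩ := (hr _ (hU v hv)).2
        (mfderiv (cotI n) (𝓡 n) (fun w : Cotangent n M => w.1) v X : Base n)
      have hZ := dSymm_inverse_dSymm f v Y
      refine ⟨(dSymm f v).inverse Y, dSymm_injective f v ?_, ?_⟩
      · exact (hφ v _).trans ((congrArg (φ (f.symm v)) hZ).trans (Eq.trans hY hZ.symm))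
      · exact (mfderiv_fst_dSymm f v _).symm.trans ((congrArg (mfderiv (cotI n) (𝓡 n)
          (fun w : Cotangent n M => (f w).1) (f.symm v)) hZ).trans hY')
  · exact (hf.formRelated v X Y).trans (h.symmetric_h _ (hU v hv) _ _
      ((hφ v X).symm.trans (congrArg (dSymm f v) hX))
      ((hφ v Y).symm.trans (congrArg (dSymm f v) hY)))
  · exact (hf.formRelated v X Y).trans (h.symmetric_w _ (hU v hv) _ _
      ((hφ v X).symm.trans ((congrArg (dSymm f v) hX).trans ((dSymm f v).map_neg X)))
      ((hφ v Y).symm.trans ((congrArg (dSymm f v) hY).trans ((dSymm f v).map_neg Y))))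

end PushForward

/-! ### Frame components of the global tensors and assembly of the theorem. -/

section Main

variable {n : ℕ} {M : Type*} [TopologicalSpace M] [ChartedSpace (Base n) M]
  [IsManifold (𝓡 n) ∞ M] {H : Cotangent n M → ℝ} {e : OpenPartialHomeomorph M (Base n)}
  {u : Cotangent n M}

theorem metricLoc_hVec_vVec (h : Coord n → ℝ) (z : Coord n) (i b : Fin n) :
    metricLoc h z (hVec h i z) (vVec b z) = 0 := by
  rw [metricLoc_apply]
  simp only [wForm_hVec]
  simp [vVec]

theorem metricLoc_vVec_hVec (h : Coord n → ℝ) (z : Coord n) (i b : Fin n) :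
    metricLoc h z (vVec b z) (hVec h i z) = 0 := by
  rw [metricLoc_apply]
  simp only [wForm_hVec]
  simp [vVec]

theorem metricLoc_vVec (h : Coord n → ℝ) (z : Coord n) (a b : Fin n) :
    metricLoc h z (vVec a z) (vVec b z) = gUp h z a b := by
  rw [metricLoc_apply]
  simp only [wForm_vVec]
  simp [vVec]

theorem canonicalPair_hFrame (hH : IsHamiltonFunction H)
    (he : e ∈ IsManifold.maximalAtlas (𝓡 n) ∞ M) (hu : u.1 ∈ e.source) (hs : u ∈ slit n M)
    (i : Fin n) : canonicalPair H u (hFrame H e i u) = hFrame H e i u := by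
  have h1 : dChart e u (hFrame H e i u) = hVec (inChart e H) i (cotChart e u) :=
    dChart_ofChart he hu _
  refine dChart_injective he hu ?_
  rw [canonicalPair_eq hH he hu hs, h1, phiLoc_hVec]

theorem canonicalPair_wFrame (hH : IsHamiltonFunction H)
    (he : e ∈ IsManifold.maximalAtlas (𝓡 n) ∞ M) (hu : u.1 ∈ e.source) (hs : u ∈ slit n M)
    (b : Fin n) : canonicalPair H u (wFrame H e b u) = -wFrame H e b u := by
  have h1 : dChart e u (wFrame H e b u) = wVec (inChart e H) b (cotChart e u) :=
    dChart_ofChart he hu _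
  refine dChart_injective he hu ?_
  rw [canonicalPair_eq hH he hu hs, dChart_neg, h1, phiLoc_wVec]

theorem IsCanonicalPhiConnection.hasCanonicalCoeffs (hH : IsHamiltonFunction H) {D : Conn n M}
    (hD : IsCanonicalPhiConnection (canonicalPair H) (liftedMetric H) (slit n M) D) :
    HasCanonicalCoeffs H D := by
  intro e he u hs hu
  have h := hD.hasCoeffsAt hH (isOpen_slit.mem_nhds hs) hs he hu
  exact ⟨h.1, h.2.1, h.2.2.1, h.2.2.2⟩

theorem HasCanonicalCoeffs.hasCoeffsAt {D : Conn n M} (h : HasCanonicalCoeffs H D)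
    (he : e ∈ IsManifold.maximalAtlas (𝓡 n) ∞ M) (hu : u.1 ∈ e.source) (hs : u ∈ slit n M) :
    HasCoeffsAt H D e u := by
  obtain ⟨h1, h2, h3, h4⟩ := h e he u hs hu
  exact ⟨h1, h2, h3, h4⟩

theorem frame_components (hH : IsHamiltonFunction H)
    (he : e ∈ IsManifold.maximalAtlas (𝓡 n) ∞ M) (hu : u.1 ∈ e.source) (hs : u ∈ slit n M) :
    (∀ i, canonicalPair H u (hFrame H e i u) = hFrame H e i u) ∧
    (∀ b, canonicalPair H u (wFrame H e b u) = -wFrame H e b u) ∧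
    (∀ i j, liftedMetric H u (hFrame H e i u) (hFrame H e j u) =
      gLow (inChart e H) (cotChart e u) i j) ∧
    (∀ i b, liftedMetric H u (hFrame H e i u) (vFrame e b u) = 0 ∧
      liftedMetric H u (vFrame e b u) (hFrame H e i u) = 0) ∧
    (∀ a b, liftedMetric H u (vFrame e a u) (vFrame e b u) =
      gUp (inChart e H) (cotChart e u) a b) := by
  have h1 : ∀ i, dChart e u (hFrame H e i u) = hVec (inChart e H) i (cotChart e u) :=
    fun i => dChart_ofChart he hu _
  have h2 : ∀ i, dChart e u (vFrame e i u) = vVec i (cotChart e u) :=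
    fun i => dChart_ofChart he hu _
  refine ⟨canonicalPair_hFrame hH he hu hs, canonicalPair_wFrame hH he hu hs, fun i j => ?_,
    fun i b => ⟨?_, ?_⟩, fun a b => ?_⟩
  · rw [liftedMetric_eq hH he hu hs, h1, h1, metricLoc_hVec]
  · rw [liftedMetric_eq hH he hu hs, h1, h2, metricLoc_hVec_vVec]
  · rw [liftedMetric_eq hH he hu hs, h1, h2, metricLoc_vVec_hVec]
  · rw [liftedMetric_eq hH he hu hs, h2, h2, metricLoc_vVec]

end Main

end HamiltonGeometry

end

theorem mainTheorem6 {n : ℕ} (hn : 2 ≤ n) {M : Type*} [TopologicalSpace M] [T2Space M]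
    [SecondCountableTopology M] [ChartedSpace (Base n) M] [IsManifold (𝓡 n) ∞ M]
    (H : Cotangent n M → ℝ) (hH : IsHamiltonFunction H) :
    -- the tensor fields generated by `H` have the expected components in every natural chart
    (∀ e ∈ IsManifold.maximalAtlas (𝓡 n) ∞ M, ∀ u : Cotangent n M, u.1 ∈ e.source →
      (∀ X Y, theta n M u X Y = thetaLoc n (dChart e u X) (dChart e u Y)) ∧
      (u ∈ slit n M →
        (∀ i, canonicalPair H u (hFrame H e i u) = hFrame H e i u) ∧
        (∀ b, canonicalPair H u (wFrame H e b u) = -wFrame H e b u) ∧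
        (∀ i j, liftedMetric H u (hFrame H e i u) (hFrame H e j u) =
          gLow (inChart e H) (cotChart e u) i j) ∧
        (∀ i b, liftedMetric H u (hFrame H e i u) (vFrame e b u) = 0 ∧
          liftedMetric H u (vFrame e b u) (hFrame H e i u) = 0) ∧
        (∀ a b, liftedMetric H u (vFrame e a u) (vFrame e b u) =
          gUp (inChart e H) (cotChart e u) a b))) ∧
    IsConnectionPair (canonicalPair H) (slit n M) ∧
    ∃ D : Conn n M,
      -- existence, with the explicit coefficients
      IsCanonicalPhiConnection (canonicalPair H) (liftedMetric H) (slit n M) D ∧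
      HasCanonicalCoeffs H D ∧
      -- uniqueness, by the properties and by the coefficients
      (∀ D' : Conn n M,
        IsCanonicalPhiConnection (canonicalPair H) (liftedMetric H) (slit n M) D' →
        SameOn D' D (slit n M)) ∧
      (∀ D' : Conn n M, IsLinearConnection D' (slit n M) → HasCanonicalCoeffs H D' →
        SameOn D' D (slit n M)) ∧
      -- push-forwards by regular symplectic morphisms
      (∀ f : Cotangent n M ≃ₘ^∞⟮cotI n, cotI n⟯ Cotangent n M,
        IsSymplecticMorphism f → IsRegularFor (canonicalPair H) (slit n M) f →
        IsConnectionPair (pushEndo f (canonicalPair H)) (f '' slit n M) ∧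
        IsCanonicalPhiConnection (pushEndo f (canonicalPair H)) (pushForm f (liftedMetric H))
          (f '' slit n M) (pushConn f D) ∧
        (∀ D' : Conn n M,
          IsCanonicalPhiConnection (pushEndo f (canonicalPair H)) (pushForm f (liftedMetric H))
            (f '' slit n M) D' →
          SameOn D' (pushConn f D) (f '' slit n M))) := by
  refine ⟨fun e he u hu => ⟨theta_eq he hu, fun hs => frame_components hH he hu hs⟩,
    isConnectionPair_canonicalPair hH, canonicalConn H, isCanonicalPhiConnection_canonicalConn hH,
    (isCanonicalPhiConnection_canonicalConn hH).hasCanonicalCoeffs hH,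
    fun D' hD' u hs Y hY => ?_, fun D' hD' hD'' u hs Y hY => ?_, fun f hf hr => ⟨?_, ?_, ?_⟩⟩
  · exact hD'.eq_of_mem_nhds hH (isCanonicalPhiConnection_canonicalConn hH)
      (isOpen_slit.mem_nhds hs) (isOpen_slit.mem_nhds hs) hs hY
  · have he := IsManifold.chart_mem_maximalAtlas (I := 𝓡 n) (n := ∞) u.1
    have hu := mem_chart_source (Base n) u.1
    have hD := isCanonicalPhiConnection_canonicalConn hH
    exact HasCoeffsAt.eq hH he hu hs hs hD'.covariant hD.linear.covariant
      (hD''.hasCoeffsAt he hu hs) ((hD.hasCanonicalCoeffs hH).hasCoeffsAt he hu hs) hY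
  · exact isConnectionPair_pushEndo hf (isConnectionPair_canonicalPair hH) hr
  · exact isCanonicalPhiConnection_pushConn hf hH (isCanonicalPhiConnection_canonicalConn hH)
  · exact fun D' hD' =>
      sameOn_pushConn hf hH (isCanonicalPhiConnection_canonicalConn hH) hD'
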